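/- Let $m\ge 3$. From a sequence of distinct keys $x_1,\dots,x_n$ an $m$-ary search tree is built as follows: if $n=0$ the tree is empty; if $1\le n<m$ all keys are stored in the root; if $n\ge m$ the first $m-1$ keys are sorted and stored in the root, and the remaining keys are directed, in their order of arrival, to $m$ subtrees, one for each of the $m$ intervals formed by the sorted root keys, each subtree being built recursively by the same rule. Let the input be a uniformly random permutation of $\{1,\dots,n\}$; let $S_n$ (space requirement) be the number of nodes of the resulting tree, and let $K_n$ (key path length) be the sum, over all keys, of the distance from the root to the node containing the key. **Theorem 2.1.** (i) If $3\le m\le 13$, there is a constant $C_R=C_R(m)\neq 0$ such that $$\mathrm{Cov}(S_n,K_n)\sim C_R\,n\qquad(n\to\infty).$$ (ii) Let $m\ge 14$ and $\Lambda(z)=z(z+1)\cdots(z+m-2)-m!$. Then $\Lambda$ has a zero $\lambda=\alpha+i\beta$ with $\beta>0$ that is second largest in real part: some zero $r$ of $\Lambda$ satisfies $\Re r>\alpha$, and every other zero $z\neq r$ satisfies $\Re z\le\alpha$. For any such $\lambda=\alpha+i\beta$, $$\mathrm{Cov}(S_n,K_n)=F_2(\beta\log n)\,n^{\alpha}+o(n^{\alpha})\qquad(n\to\infty),$$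 where $F_2$ is the $2\pi$-periodic function $$F_2(z)=4\phi\,\Re\left(\frac{(\lambda+m-1)\,A\,e^{iz}}{(m-1)\Gamma(\lambda)}\left(\frac1{2\phi}-\frac{(\lambda+m-1)\psi(\lambda+m)-\lambda\,\psi(\lambda+1)-(m-1)(1-\gamma)}{\lambda+m-1}\right)\right),$$ with $$\phi=\frac1{2(H_m-1)},\qquad H_m=\sum_{j=1}^m\frac1j,\qquad A=\frac1{\lambda(\lambda-1)\sum_{0\le j\le m-2}\frac1{j+\lambda}},$$ $\psi=\Gamma'/\Gamma$ the digamma function and $\gamma$ Euler's constant. -/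

import Mathlib

open Filter Asymptotics MeasureTheory ProbabilityTheory

namespace MarySearch

/-- An `m`-ary tree whose nodes store finite lists of keys: it is either empty, or a root node
together with an ordered `m`-tuple of subtrees. -/
inductive MaryTree (m : ℕ) : Type where
  | empty : MaryTree m
  | node (keys : List ℕ) (children : Fin m → MaryTree m) : MaryTree m

/-- The `m`-ary search tree built from a sequence of (distinct) keys, `2 ≤ m`.
The empty sequence gives the empty tree.  Between `1` and `m - 1` keys are all stored in the root.
Otherwise the first `m - 1` keys are sorted and stored in the root, and the remaining keys are
directed, in their order of arrival, to the `m` subtrees: the subtree with index `i : Fin m`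
(indices starting at `0`) receives the keys lying in the `i`-th of the `m` intervals formed by the
root keys, i.e. the keys that exceed exactly `i` of the root keys.
(For the meaningless values `m ≤ 1` all keys are put into the root, so that the recursion ends.) -/
def searchTree (m : ℕ) (l : List ℕ) : MaryTree m :=
  if l = [] then .empty
  else if l.length < m ∨ m ≤ 1 then .node (l.insertionSort (· ≤ ·)) fun _ => .empty
  else
    .node ((l.take (m - 1)).insertionSort (· ≤ ·)) fun i =>
      searchTree m
        ((l.drop (m - 1)).filter fun x => (l.take (m - 1)).countP (fun y => y < x) = i.val)
termination_by l.length
decreasing_by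
  have h := List.length_filter_le
    (fun x => decide ((l.take (m - 1)).countP (fun y => y < x) = i.val)) (l.drop (m - 1))
  simp only [List.length_drop] at h
  omega

/-- The space requirement: the number of nodes of the tree. -/
def MaryTree.space {m : ℕ} : MaryTree m → ℕ
  | .empty => 0
  | .node _ children => 1 + ∑ i, (children i).space

/-- The sum, over all keys of the tree, of `d` plus the distance from the root of the tree to the
node that stores the key. -/
def MaryTree.keyPathLengthFrom {m : ℕ} : MaryTree m → ℕ → ℕ
  | .empty, _ => 0
  | .node keys children, d =>
      d * keys.length + ∑ i, (children i).keyPathLengthFrom (d + 1)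

/-- The key path length: the sum, over all keys, of the distance between the root and the key. -/
def MaryTree.keyPathLength {m : ℕ} (t : MaryTree m) : ℕ := t.keyPathLengthFrom 0

/-- The `m`-ary search tree built from the sequence `σ(1), …, σ(n)`, where `σ` is a permutation of
`{1, …, n}`. -/
def permTree (m n : ℕ) (σ : Equiv.Perm (Fin n)) : MaryTree m :=
  searchTree m (List.ofFn fun i => (σ i).val + 1)

/-- Every set of permutations is an event. -/
instance permMeasurableSpace (n : ℕ) : MeasurableSpace (Equiv.Perm (Fin n)) := ⊤

/-- The uniform distribution on the `n!` permutations of `n` elements. -/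
noncomputable def uniformPerm (n : ℕ) : Measure (Equiv.Perm (Fin n)) :=
  (PMF.uniformOfFintype (Equiv.Perm (Fin n))).toMeasure

/-- The space requirement `S_n` of the random `m`-ary search tree with `n` keys. -/
noncomputable def S (m n : ℕ) (σ : Equiv.Perm (Fin n)) : ℝ := (permTree m n σ).space

/-- The key path length `K_n` of the random `m`-ary search tree with `n` keys. -/
noncomputable def K (m n : ℕ) (σ : Equiv.Perm (Fin n)) : ℝ := (permTree m n σ).keyPathLength

/-- `Cov(S_n, K_n)`. -/
noncomputable def covSK (m n : ℕ) : ℝ := covariance (S m n) (K m n) (uniformPerm n)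

/-- The indicial function `Λ(z) = z (z + 1) ⋯ (z + m - 2) - m!`. -/
noncomputable def indicial (m : ℕ) (z : ℂ) : ℂ :=
  ∏ j ∈ Finset.range (m - 1), (z + j) - (m.factorial : ℂ)

/-- `l` is the zero of `Λ` with the second largest real part and positive imaginary part:
there is a zero `r` with a strictly larger real part, and all the other zeros have real part at
most that of `l`. -/
def IsSecondZero (m : ℕ) (l : ℂ) : Prop :=
  indicial m l = 0 ∧ 0 < l.im ∧
    ∃ r : ℂ, indicial m r = 0 ∧ l.re < r.re ∧ ∀ z : ℂ, indicial m z = 0 → z ≠ r → z.re ≤ l.re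

/-- The occupancy constant `φ = 1 / (2 (H_m - 1))`. -/
noncomputable def occupancy (m : ℕ) : ℝ := 1 / (2 * ((harmonic m : ℝ) - 1))

/-- The coefficient `A = 1 / (l (l - 1) ∑_{0 ≤ j ≤ m - 2} 1 / (j + l))` attached to a zero `l`
of `Λ`. -/
noncomputable def coeffA (m : ℕ) (l : ℂ) : ℂ :=
  1 / (l * (l - 1) * ∑ j ∈ Finset.range (m - 1), 1 / ((j : ℂ) + l))

/-- The function
`F₂(z) = 4 φ Re ( (l + m - 1) A e^{iz} / ((m - 1) Γ(l)) *
  ( 1 / (2 φ) - ((l + m - 1) ψ(l + m) - l ψ(l + 1) - (m - 1) (1 - γ)) / (l + m - 1) ) )`,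
where `ψ` is the digamma function and `γ` is Euler's constant. -/
noncomputable def F₂ (m : ℕ) (l : ℂ) (z : ℝ) : ℝ :=
  4 * occupancy m *
    (((l + m - 1) * coeffA m l * Complex.exp (Complex.I * z) / ((m - 1) * Complex.Gamma l)) *
      (1 / (2 * (occupancy m : ℂ)) -
        ((l + m - 1) * Complex.digamma (l + m) - l * Complex.digamma (l + 1) -
          (m - 1) * (1 - (Real.eulerMascheroniConstant : ℂ))) / (l + m - 1))).re

end MarySearch

/-! ### Formal power series and the Euler operator -/

namespace MarySearch

open PowerSeries

/-! Put k = m - 1 and D = (1 - X) d/dX. Given the set of root keys, the subtrees are independent and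
built from uniform permutations (`choose_mul_mean_prod_block`), so generating functions of means
satisfy Euler equations Λ(D) f = g. The series (1 - X)^(-s) is an eigenvector of D with eigenvalue
s. The zeros of Λ are simple, and 2 is the one of largest real part.

The space requirement may be changed by a function of n without affecting the covariance.
Subtracting φ(n + 1) - 1/k makes it additive over the subtrees, and this choice of φ removes the
component at the zero 2. Its mean then has the generating function Σ A_z (1 - X)^(-z) over the zeros
z ≠ 2 (`spaceGf_eq`). The key path length has an explicit forcing term (`op_keyGf`), and the mean of
the product satisfies an equation whose forcing is built from the two means (`op_prodGf`). The
covariance is read off from these series in `covSK_eq`.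

Asymptotics are obtained without complex contour analysis of the generating functions: if every root
of p has real part below s + 1, then p(D) f = o(n^s) implies f = o(n^s) (`smallO_of_op`), by
comparing first-order recurrences with the coefficients of (1 - X)^(-σ). What matters is therefore
whether a zero other than 2 has real part above 1. Writing Λ(z) = 0 as a condition on the modulus
and the argument of z(z + 1)⋯(z + k - 1) shows that this happens exactly from m = 14 on
(`re_lt_one`, `exists_zero_one_lt_re`).

For m ≤ 13 the forcing, solved for the factor D - 2, is o(n), so a multiple of (1 - X)^(-2)
dominates. Its coefficient is fixed by the initial values. It is a sum of a rational function over
the zeros of Λ, hence a rational number, and explicit polynomial certificates show that it is not 0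
(`coeff_zero_forcingSolution`).

For m ≥ 14 the two conjugate zeros λ and its conjugate dominate. Solving the equation with the
forcing belonging to them gives n^α log n terms, which cancel against the product of the means. What
remains has order n^α, and its constant comes from the limit of Σ 1/(s + j) - log n, which is -ψ(s)
(`tendsto_sum_sub_log`, `tendsto_covMain_div`). -/

/-- The Euler derivation `(1 - X) d/dX`, which is `d/dt` in terms of `t = log (1 / (1 - X))`. -/
noncomputable def eulerD : Derivation ℂ ℂ⟦X⟧ ℂ⟦X⟧ := (1 - X : ℂ⟦X⟧) • d⁄dX ℂ

/-- The differential operator `p(D)` for the Euler derivation `D`. -/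
noncomputable def op (p : Polynomial ℂ) (a : ℂ⟦X⟧) : ℂ⟦X⟧ :=
  Polynomial.aeval (eulerD.toLinearMap : Module.End ℂ ℂ⟦X⟧) p a

/-- The power series of `(1 - X) ^ (-s)`. -/
noncomputable def negPow (s : ℂ) : ℂ⟦X⟧ :=
  PowerSeries.mk fun n => ∏ i ∈ Finset.range n, (s + i) / (i + 1)

/-- The power series of `log (1 / (1 - X))`. -/
noncomputable def logSeries : ℂ⟦X⟧ := PowerSeries.mk fun n => 1 / (n : ℂ)

lemma coeff_eulerD (a : ℂ⟦X⟧) (n : ℕ) :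
    coeff n (eulerD a) = (n + 1) * coeff (n + 1) a - n * coeff n a := by
  have h : eulerD a = d⁄dX ℂ a - X * d⁄dX ℂ a := by
    simp [eulerD, sub_mul]
  rw [h, map_sub, coeff_derivative]
  cases n with
  | zero => simp
  | succ k =>
    rw [coeff_succ_X_mul, coeff_derivative]; push_cast; ring

section op

variable (p q : Polynomial ℂ) (a b : ℂ⟦X⟧)

@[simp] lemma op_add : op p (a + b) = op p a + op p b := map_add _ _ _
@[simp] lemma op_sub : op p (a - b) = op p a - op p b := map_sub _ _ _
@[simp] lemma op_smul (c : ℂ) : op p (c • a) = c • op p a := map_smul _ _ _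
lemma op_sum {ι : Type*} (s : Finset ι) (f : ι → ℂ⟦X⟧) :
    op p (∑ i ∈ s, f i) = ∑ i ∈ s, op p (f i) := map_sum _ _ _
lemma op_mul : op (p * q) a = op p (op q a) := by simp [op]
lemma add_op : op (p + q) a = op p a + op q a := by simp [op]
lemma sub_op : op (p - q) a = op p a - op q a := by simp [op]
lemma op_C (c : ℂ) : op (Polynomial.C c) a = c • a := by simp [op, Module.algebraMap_end_apply]
lemma op_one : op 1 a = a := by simp [op]
lemma op_X : op Polynomial.X a = eulerD a := by simp [op]
lemma op_X_sub_C (c : ℂ) : op (Polynomial.X - Polynomial.C c) a = eulerD a - c • a := by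
  rw [sub_op, op_X, op_C]
lemma op_X_add_C (c : ℂ) : op (Polynomial.X + Polynomial.C c) a = eulerD a + c • a := by
  rw [add_op, op_X, op_C]

end op

/-- Induction on polynomials for statements about operators: constants, sums and `p * X`. -/
lemma op_induction {P : Polynomial ℂ → Prop} (hC : ∀ c, P (Polynomial.C c))
    (hadd : ∀ p q, P p → P q → P (p + q)) (hX : ∀ p, P p → P (p * Polynomial.X))
    (p : Polynomial ℂ) : P p := by
  induction p using Polynomial.induction_on with
  | C c => exact hC c
  | add p q hp hq => exact hadd p q hp hq
  | monomial n c h => rw [pow_succ, ← mul_assoc]; exact hX _ h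

lemma op_of_eigen {a : ℂ⟦X⟧} {s : ℂ} (h : eulerD a = s • a) (p : Polynomial ℂ) :
    op p a = p.eval s • a := by
  induction p using op_induction with
  | hC c => simp [op_C]
  | hadd p q hp hq => rw [add_op, hp, hq, Polynomial.eval_add, add_smul]
  | hX p hp => rw [op_mul, op_X, h, op_smul, hp, smul_smul, Polynomial.eval_mul,
      Polynomial.eval_X, mul_comm]

@[simp] lemma coeff_negPow (s : ℂ) (n : ℕ) :
    coeff n (negPow s) = ∏ i ∈ Finset.range n, (s + i) / (i + 1) := by
  simp [negPow]

lemma coeff_succ_negPow (s : ℂ) (n : ℕ) :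
    ((n : ℂ) + 1) * coeff (n + 1) (negPow s) = (s + n) * coeff n (negPow s) := by
  have : (n : ℂ) + 1 ≠ 0 := by exact_mod_cast n.succ_ne_zero
  rw [coeff_negPow, coeff_negPow, Finset.prod_range_succ]; field_simp

lemma eulerD_negPow (s : ℂ) : eulerD (negPow s) = s • negPow s := by
  ext n
  rw [coeff_eulerD, coeff_succ_negPow, coeff_smul, smul_eq_mul]; ring

lemma op_negPow (p : Polynomial ℂ) (s : ℂ) : op p (negPow s) = p.eval s • negPow s :=
  op_of_eigen (eulerD_negPow s) p

lemma constCoeff_negPow (s : ℂ) : coeff 0 (negPow s) = 1 := by simp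

/-- A first-order recurrence with zero initial value and no forcing only has the zero solution. -/
lemma eq_smul_negPow {a : ℂ⟦X⟧} {s : ℂ} (h : eulerD a = s • a) :
    a = coeff 0 a • negPow s := by
  ext n
  induction n with
  | zero => simp
  | succ n ih =>
    have hn : (n : ℂ) + 1 ≠ 0 := by exact_mod_cast n.succ_ne_zero
    have h1 := congrArg (coeff n) h
    rw [coeff_eulerD, coeff_smul, smul_eq_mul] at h1
    have h2 := coeff_succ_negPow s n
    rw [coeff_smul, smul_eq_mul] at ih ⊢
    apply mul_left_cancel₀ hn
    linear_combination h1 + (s + n) * ih - coeff 0 a * h2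

/-- The product is an eigenvector of `eulerD` with constant coefficient 1, and `eq_smul_negPow`
leaves only one such series; no Vandermonde convolution is computed. -/
lemma negPow_mul (s r : ℂ) : negPow s * negPow r = negPow (s + r) := by
  have h : eulerD (negPow s * negPow r) = (s + r) • (negPow s * negPow r) := by
    rw [Derivation.leibniz, eulerD_negPow, eulerD_negPow]
    simp only [smul_eq_mul, PowerSeries.smul_eq_C_mul, map_add]; ring
  rw [eq_smul_negPow h, coeff_mul]
  simp

lemma negPow_zero : negPow 0 = 1 := by
  ext n
  rw [coeff_negPow, coeff_one]
  cases n with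
  | zero => simp
  | succ n => simp [Finset.prod_range_succ']

lemma negPow_neg_one : negPow (-1) = 1 - X := by
  ext n
  rw [coeff_negPow, map_sub, coeff_one, coeff_X]
  rcases n with _ | _ | n
  · simp
  · simp
  · rw [Finset.prod_eq_zero (i := 1)] <;> simp

lemma one_sub_X_mul_negPow (s : ℂ) : (1 - X) * negPow s = negPow (s - 1) := by
  rw [← negPow_neg_one, negPow_mul]; ring_nf

lemma coeff_negPow_one (n : ℕ) : coeff n (negPow 1) = 1 := by
  rw [coeff_negPow]
  refine Finset.prod_eq_one fun i _ => ?_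
  have : (i : ℂ) + 1 ≠ 0 := by exact_mod_cast i.succ_ne_zero
  rw [add_comm, div_self this]

lemma coeff_negPow_two (n : ℕ) : coeff n (negPow 2) = n + 1 := by
  rw [coeff_negPow]
  induction n with
  | zero => simp
  | succ n ih =>
    rw [Finset.prod_range_succ, ih]
    have : (n : ℂ) + 1 ≠ 0 := by exact_mod_cast n.succ_ne_zero
    push_cast; field_simp; ring

lemma negPow_natCast (k : ℕ) : negPow k = negPow 1 ^ k := by
  induction k with
  | zero => simp [negPow_zero]
  | succ k ih => rw [pow_succ, ← ih, negPow_mul]; push_cast; rfl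

/-- Exponential shift: with t = log (1 / (1 - X)) the factor is e^(st), and conjugation by it
replaces D by D + s. -/
lemma op_negPow_mul (p : Polynomial ℂ) (s : ℂ) (a : ℂ⟦X⟧) :
    op p (negPow s * a) = negPow s * op (p.comp (Polynomial.X + Polynomial.C s)) a := by
  induction p using op_induction generalizing a with
  | hC c => simp [op_C]
  | hadd p q hp hq => rw [add_op, hp, hq, Polynomial.add_comp, add_op, mul_add]
  | hX p hp =>
    have h : eulerD (negPow s * a) = negPow s * (eulerD a + s • a) := by
      rw [Derivation.leibniz, eulerD_negPow]
      simp only [smul_eq_mul, PowerSeries.smul_eq_C_mul]; ring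
    rw [op_mul, op_X, h, hp, Polynomial.mul_comp, op_mul, Polynomial.X_comp, op_X_add_C]

lemma eulerD_logSeries : eulerD logSeries = 1 := by
  ext n
  rw [coeff_eulerD, coeff_one, logSeries, coeff_mk, coeff_mk]
  have : (n : ℂ) + 1 ≠ 0 := by exact_mod_cast n.succ_ne_zero
  cases n with
  | zero => simp
  | succ n =>
    have : (n : ℂ) + 1 ≠ 0 := by exact_mod_cast n.succ_ne_zero
    have : (n : ℂ) + 1 + 1 ≠ 0 := by exact_mod_cast (n + 1).succ_ne_zero
    simp only [Nat.add_eq_zero_iff, one_ne_zero, and_false, if_false]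
    push_cast
    field_simp
    ring

lemma eulerD_logSeries_mul_negPow (s : ℂ) :
    eulerD (logSeries * negPow s) = s • (logSeries * negPow s) + negPow s := by
  rw [Derivation.leibniz, eulerD_negPow, eulerD_logSeries]
  simp only [smul_eq_mul, PowerSeries.smul_eq_C_mul]; ring

/-- This is the derivative with respect to s of p(D) e^(st) = p(s) e^(st). -/
lemma op_logSeries_mul_negPow (p : Polynomial ℂ) (s : ℂ) :
    op p (logSeries * negPow s) =
      p.eval s • (logSeries * negPow s) + p.derivative.eval s • negPow s := by
  induction p using op_induction with
  | hC c => simp [op_C]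
  | hadd p q hp hq =>
    simp only [add_op, hp, hq, Polynomial.eval_add, Polynomial.derivative_add, add_smul]; abel
  | hX p hp =>
    rw [op_mul, op_X, eulerD_logSeries_mul_negPow, op_add, op_smul, hp, op_negPow]
    simp only [Polynomial.derivative_mul, Polynomial.derivative_X, mul_one, Polynomial.eval_add,
      Polynomial.eval_mul, Polynomial.eval_X, PowerSeries.smul_eq_C_mul, map_add, map_mul]
    ring

lemma coeff_logSeries_mul_negPow {s : ℂ} (hs : ∀ n : ℕ, s + n ≠ 0) (n : ℕ) :
    coeff n (logSeries * negPow s) =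
      coeff n (negPow s) * ∑ i ∈ Finset.range n, 1 / (s + i) := by
  induction n with
  | zero => simp [logSeries]
  | succ n ih =>
    have hn : (n : ℂ) + 1 ≠ 0 := by exact_mod_cast n.succ_ne_zero
    have h1 := congrArg (coeff n) (eulerD_logSeries_mul_negPow s)
    rw [coeff_eulerD, map_add, coeff_smul, smul_eq_mul, ih] at h1
    have h2 := coeff_succ_negPow s n
    rw [Finset.sum_range_succ]
    apply mul_left_cancel₀ hn
    have h3 : (s + n) * (1 / (s + n)) = 1 := by field_simp [hs n]
    linear_combination h1 - (∑ i ∈ Finset.range n, 1 / (s + i) + 1 / (s + n)) * h2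
      - coeff n (negPow s) * h3

/-- The rising product `X (X + 1) ⋯ (X + k - 1)`. -/
noncomputable def rising (k : ℕ) : Polynomial ℂ :=
  ∏ j ∈ Finset.range k, (Polynomial.X + Polynomial.C (j : ℂ))

/-- In the induction the factor D + k cancels exactly the term that comes from differentiating (1 -
X)^k. -/
lemma op_rising (k : ℕ) (a : ℂ⟦X⟧) :
    op (rising k) a = (1 - X) ^ k * (d⁄dX ℂ)^[k] a := by
  induction k with
  | zero => simp [rising, op_one]
  | succ k ih =>
    rw [rising, Finset.prod_range_succ, mul_comm, op_mul, ← rising, ih, op_X_add_C,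
      Derivation.leibniz, Derivation.leibniz_pow, Function.iterate_succ_apply']
    have h1 : eulerD (1 - X : ℂ⟦X⟧) = -(1 - X) := by
      simp [eulerD]
    have h2 : eulerD ((d⁄dX ℂ)^[k] a) = (1 - X) * d⁄dX ℂ ((d⁄dX ℂ)^[k] a) := by
      simp [eulerD]
    rw [h1, h2]
    simp only [smul_eq_mul, nsmul_eq_mul, PowerSeries.smul_eq_C_mul, map_natCast]
    cases k with
    | zero => simp
    | succ k => simp only [Nat.add_sub_cancel]; ring

lemma coeff_iterate_derivative (k : ℕ) (a : ℂ⟦X⟧) (n : ℕ) :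
    coeff n ((d⁄dX ℂ)^[k] a) = (∏ j ∈ Finset.range k, ((n : ℂ) + j + 1)) * coeff (n + k) a := by
  induction k generalizing n with
  | zero => simp
  | succ k ih =>
    rw [Function.iterate_succ_apply', coeff_derivative, ih, Finset.prod_range_succ']
    push_cast
    have : n + 1 + k = n + (k + 1) := by ring
    rw [this]
    have h : ∏ j ∈ Finset.range k, ((n : ℂ) + 1 + j + 1) =
      ∏ j ∈ Finset.range k, ((n : ℂ) + (j + 1) + 1) :=
      Finset.prod_congr rfl fun j _ => by ring
    rw [h]; ring

/-- `op (rising k) a = b` is the coefficient identity for the `k`-th derivative. -/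
lemma op_rising_eq {k : ℕ} {a b : ℂ⟦X⟧}
    (h : ∀ n : ℕ, (∏ j ∈ Finset.range k, ((n : ℂ) + j + 1)) * coeff (n + k) a =
      coeff n (b * negPow k)) : op (rising k) a = b := by
  have h1 : (d⁄dX ℂ)^[k] a = b * negPow k := by
    ext n; rw [coeff_iterate_derivative, h]
  have h2 : (1 - X : ℂ⟦X⟧) ^ k * negPow k = 1 := by
    rw [negPow_natCast, ← mul_pow, one_sub_X_mul_negPow]; simp [negPow_zero]
  rw [op_rising, h1, mul_left_comm, h2, mul_one]

/-- Each application of D looks one coefficient further, so coefficient n of p(D) a involves only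
the coefficients of a up to n + deg p. -/
lemma coeff_op_eq_zero {k : ℕ} {a : ℂ⟦X⟧} (ha : ∀ n < k, coeff n a = 0) (p : Polynomial ℂ)
    {n : ℕ} (hn : n + p.natDegree < k) : coeff n (op p a) = 0 := by
  have key : ∀ i n, n + i < k → coeff n (((eulerD.toLinearMap : Module.End ℂ ℂ⟦X⟧) ^ i) a) = 0 := by
    intro i
    induction i with
    | zero => intro n hn; simpa using ha n hn
    | succ i ih =>
      intro n hn
      rw [pow_succ', Module.End.mul_apply]
      refine (coeff_eulerD _ n).trans ?_
      rw [ih _ (by omega), ih _ (by omega)]; simp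
  rw [op, Polynomial.aeval_endomorphism, Polynomial.sum, map_sum]
  refine Finset.sum_eq_zero fun i hi => ?_
  rw [coeff_smul, key i n, smul_zero]
  have := Polynomial.le_natDegree_of_mem_supp i hi
  omega

/-- A solution of `p(D) a = 0` is determined by its first `deg p` coefficients. -/
lemma eq_zero_of_op_eq_zero {p : Polynomial ℂ} (hp : p ≠ 0) {a : ℂ⟦X⟧}
    (ha : ∀ n < p.natDegree, coeff n a = 0) (h : op p a = 0) : a = 0 := by
  induction hd : p.natDegree generalizing p a with
  | zero =>
    rw [Polynomial.natDegree_eq_zero] at hd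
    obtain ⟨c, rfl⟩ := hd
    rw [op_C] at h
    have hc : c ≠ 0 := by rintro rfl; simp at hp
    exact (smul_eq_zero.mp h).resolve_left hc
  | succ d ih =>
    obtain ⟨s, hs⟩ := Complex.exists_root (f := p)
      (Polynomial.natDegree_pos_iff_degree_pos.mp (by omega))
    obtain ⟨q, rfl⟩ := Polynomial.dvd_iff_isRoot.mpr hs
    have hq : q ≠ 0 := right_ne_zero_of_mul hp
    have hdeg : q.natDegree = d := by
      rw [Polynomial.natDegree_mul (Polynomial.X_sub_C_ne_zero s) hq,
        Polynomial.natDegree_X_sub_C] at hd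
      omega
    refine ih hq (fun n hn => ha n (by omega)) ?_ hdeg
    -- With p = (X - s) q, the series q(D) a is an eigenvector; its constant coefficient vanishes
    -- since deg q = d, so it is 0 and induction applies to q.
    rw [op_mul, op_X_sub_C, sub_eq_zero] at h
    rw [eq_smul_negPow h, coeff_op_eq_zero (k := d + 1) (fun n hn => ha n (by omega)) q (by omega),
      zero_smul]

end MarySearch

/-! ### Growth of coefficients and transfer through differential operators -/

namespace MarySearch

open PowerSeries Topology

lemma coeff_negPow_eq_div (s : ℂ) (n : ℕ) :
    coeff n (negPow s) = (∏ i ∈ Finset.range n, (s + i)) / (n.factorial : ℂ) := by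
  rw [coeff_negPow, Finset.prod_div_distrib, ← Finset.prod_range_add_one_eq_factorial]
  push_cast; rfl

lemma add_natCast_ne_zero_of_re_pos {s : ℂ} (hs : 0 < s.re) (n : ℕ) : s + n ≠ 0 := by
  intro h
  have := congrArg Complex.re h
  simp at this
  have : (0 : ℝ) ≤ n := n.cast_nonneg
  linarith

/-- The quotient is 1 / `GammaSeq` times n / (n + s), so this is Euler's limit formula for Γ. -/
lemma tendsto_coeff_negPow_div {s : ℂ} (hs : 0 < s.re) :
    Tendsto (fun n : ℕ => coeff n (negPow s) / (n : ℂ) ^ (s - 1)) atTop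
      (𝓝 (1 / Complex.Gamma s)) := by
  have h1 := (Complex.GammaSeq_tendsto_Gamma s).inv₀ (Complex.Gamma_ne_zero_of_re_pos hs)
  have h2 := tendsto_natCast_div_add_atTop (s : ℂ)
  have h3 := h1.mul h2
  rw [mul_one, ← one_div] at h3
  refine h3.congr' ?_
  filter_upwards [eventually_ge_atTop 1] with n hn
  have hn0 : (n : ℂ) ≠ 0 := by exact_mod_cast (by omega : n ≠ 0)
  have hsn := add_natCast_ne_zero_of_re_pos hs n
  have hc : (n : ℂ) ^ s ≠ 0 := by simp [Complex.cpow_eq_zero_iff, hn0]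
  have hf : (n.factorial : ℂ) ≠ 0 := by exact_mod_cast n.factorial_ne_zero
  rw [coeff_negPow_eq_div, Complex.cpow_sub _ _ hn0, Complex.cpow_one, Complex.GammaSeq,
    Finset.prod_range_succ, add_comm (n : ℂ) s]
  field_simp

/-- The coefficients of `(1 - X) ^ (-σ)` for real `σ`. -/
noncomputable def weight (σ : ℝ) (n : ℕ) : ℝ := ∏ i ∈ Finset.range n, (σ + i) / (i + 1)

lemma coeff_negPow_ofReal (σ : ℝ) (n : ℕ) : coeff n (negPow (σ : ℂ)) = (weight σ n : ℂ) := by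
  rw [coeff_negPow, weight]; push_cast; rfl

lemma weight_pos {σ : ℝ} (hσ : 0 < σ) (n : ℕ) : 0 < weight σ n :=
  Finset.prod_pos fun i _ => by positivity

lemma succ_mul_weight (σ : ℝ) (n : ℕ) :
    ((n : ℝ) + 1) * weight σ (n + 1) = (σ + n) * weight σ n := by
  rw [weight, weight, Finset.prod_range_succ]
  have : (n : ℝ) + 1 ≠ 0 := by positivity
  field_simp

lemma sum_weight_mul_weight (σ τ : ℝ) (n : ℕ) :
    ∑ p ∈ Finset.HasAntidiagonal.antidiagonal n, weight σ p.1 * weight τ p.2 =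
      weight (σ + τ) n := by
  have h := congrArg (coeff n) (negPow_mul (σ : ℂ) (τ : ℂ))
  rw [coeff_mul, ← Complex.ofReal_add, coeff_negPow_ofReal] at h
  simp only [coeff_negPow_ofReal] at h
  exact_mod_cast h

lemma tendsto_weight_div {σ : ℝ} (hσ : 0 < σ) :
    Tendsto (fun n : ℕ => weight σ n / (n : ℝ) ^ (σ - 1)) atTop (𝓝 (1 / Real.Gamma σ)) := by
  have h := tendsto_coeff_negPow_div (s := (σ : ℂ)) (by simpa using hσ)
  have h2 := (Complex.continuous_re.tendsto _).comp h
  have h3 : (1 / Complex.Gamma (σ : ℂ)).re = 1 / Real.Gamma σ := by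
    rw [Complex.Gamma_ofReal]; norm_cast
  rw [h3] at h2
  refine h2.congr fun n => ?_
  have : ((n : ℂ) ^ ((σ : ℂ) - 1)) = (((n : ℝ) ^ (σ - 1) : ℝ) : ℂ) := by
    rw [Complex.ofReal_cpow n.cast_nonneg]; push_cast; rfl
  simp only [Function.comp_apply]
  rw [coeff_negPow_ofReal, this]; norm_cast

lemma weight_isTheta {σ : ℝ} (hσ : 0 < σ) :
    (fun n : ℕ => weight σ n) =Θ[atTop] fun n : ℕ => (n : ℝ) ^ (σ - 1) :=
  (isTheta_of_div_tendsto_nhds_ne_zero (tendsto_weight_div hσ)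
    (one_div_ne_zero (Real.Gamma_pos_of_pos hσ).ne')).symm

lemma isLittleO_natCast_rpow {s t : ℝ} (h : s < t) :
    (fun n : ℕ => (n : ℝ) ^ s) =o[atTop] fun n : ℕ => (n : ℝ) ^ t := by
  rw [isLittleO_iff_tendsto']
  · refine ((tendsto_rpow_neg_atTop (sub_pos.mpr h)).comp tendsto_natCast_atTop_atTop).congr' ?_
    filter_upwards [eventually_gt_atTop 0] with n hn
    have hn' : (0 : ℝ) < n := by exact_mod_cast hn
    rw [Function.comp_apply, ← Real.rpow_sub hn']; ring_nf
  · filter_upwards [eventually_gt_atTop 0] with n hn h0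
    have hn' : (0 : ℝ) < n := by exact_mod_cast hn
    exact absurd h0 (Real.rpow_pos_of_pos hn' t).ne'

/-- The coefficients of the power series are `o(n ^ s)`. -/
def SmallO (s : ℝ) (a : ℂ⟦X⟧) : Prop :=
  (fun n : ℕ => coeff n a) =o[atTop] fun n : ℕ => (n : ℝ) ^ s

namespace SmallO

variable {s t u : ℝ} {a b : ℂ⟦X⟧}

lemma add (ha : SmallO s a) (hb : SmallO s b) : SmallO s (a + b) := by
  simpa [SmallO] using IsLittleO.add ha hb

lemma sub (ha : SmallO s a) (hb : SmallO s b) : SmallO s (a - b) := by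
  simpa [SmallO] using IsLittleO.sub ha hb

lemma smul (c : ℂ) (ha : SmallO s a) : SmallO s (c • a) := by
  simpa [SmallO] using IsLittleO.const_mul_left ha c

lemma zero : SmallO s 0 := by simp [SmallO]

lemma sum {ι : Type*} {I : Finset ι} {f : ι → ℂ⟦X⟧} (h : ∀ i ∈ I, SmallO s (f i)) :
    SmallO s (∑ i ∈ I, f i) :=
  Finset.sum_induction _ (SmallO s) (fun _ _ => add) zero h

/-- Weights satisfy the exact recurrence `succ_mul_weight` and an exact convolution formula, which
powers of n satisfy only asymptotically; the estimates are therefore carried out with weights. -/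
lemma iff_weight (hs : -1 < s) :
    SmallO s a ↔ (fun n : ℕ => coeff n a) =o[atTop] fun n : ℕ => weight (s + 1) n := by
  have h := weight_isTheta (σ := s + 1) (by linarith)
  rw [add_sub_cancel_right] at h
  exact h.symm.isLittleO_congr_right

end SmallO

lemma eventually_norm_add_natCast_le {ρ : ℂ} {σ : ℝ} (h0 : 0 < σ) (h : ρ.re < σ) :
    ∀ᶠ n : ℕ in atTop, ‖ρ + n‖ ≤ σ + n := by
  -- After squaring and dropping σ², it suffices that |ρ|² ≤ 2 n (σ - Re ρ).
  filter_upwards [eventually_ge_atTop ⌈(ρ.re ^ 2 + ρ.im ^ 2) / (2 * (σ - ρ.re))⌉₊] with n hn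
  have hn' := Nat.ceil_le.mp hn
  rw [div_le_iff₀ (by linarith)] at hn'
  have hn0 : (0 : ℝ) ≤ n := n.cast_nonneg
  refine abs_le_of_sq_le_sq' ?_ (by positivity) |>.2
  rw [Complex.sq_norm, Complex.normSq_apply]
  simp
  nlinarith

/-- Resolving a first-order factor: the solution is as small as the forcing term as long as the
homogeneous solution is smaller. -/
lemma smallO_of_eulerD_sub {s : ℝ} {ρ : ℂ} {a : ℂ⟦X⟧} (hs : -1 < s) (hρ : ρ.re < s + 1)
    (h : SmallO s (eulerD a - ρ • a)) : SmallO s a := by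
  -- The auxiliary exponent σ lies strictly above Re ρ, so that |ρ + n| ≤ σ + n eventually, and
  -- strictly below s + 1, so that its weight is negligible.
  obtain ⟨σ, h1, h2⟩ := exists_between (max_lt hρ (by linarith : (0 : ℝ) < s + 1))
  obtain ⟨h1, h0⟩ := max_lt_iff.mp h1
  rw [SmallO.iff_weight hs] at h ⊢
  have hw : (fun n : ℕ => weight σ n) =o[atTop] fun n : ℕ => weight (s + 1) n :=
    ((weight_isTheta h0).trans_isLittleO (isLittleO_natCast_rpow (by linarith))).trans_isTheta
      (weight_isTheta (by linarith)).symm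
  rw [isLittleO_iff]
  intro c hc
  set δ := s + 1 - σ with hδ
  have hδ0 : 0 < δ := by linarith
  have e1 := (isLittleO_iff.mp h) (show 0 < c / 2 * δ by positivity)
  have e2 := eventually_norm_add_natCast_le h0 h1
  obtain ⟨N, hN⟩ := eventually_atTop.mp (e1.and e2)
  have hwp : ∀ n, 0 < weight σ n := weight_pos h0
  have hwp' : ∀ n, 0 < weight (s + 1) n := weight_pos (by linarith)
  set C := ‖coeff N a‖ / weight σ N with hC
  have hC0 : 0 ≤ C := div_nonneg (norm_nonneg _) (hwp N).le
  -- A supersolution of the recurrence: the first term has a surplus δ over the factor σ + n, which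
  -- absorbs the forcing, and the second carries the value at N.
  have key : ∀ n, N ≤ n → ‖coeff n a‖ ≤ c / 2 * weight (s + 1) n + C * weight σ n := by
    intro n hn
    induction n, hn using Nat.le_induction with
    | base =>
      have : C * weight σ N = ‖coeff N a‖ := div_mul_cancel₀ _ (hwp N).ne'
      rw [this]
      have := hwp' N
      nlinarith
    | succ n hn ih =>
      obtain ⟨b1, b2⟩ := hN n hn
      rw [map_sub, coeff_eulerD, coeff_smul, smul_eq_mul, Real.norm_of_nonneg (hwp' n).le] at b1
      have hn1 : (0 : ℝ) < n + 1 := by positivity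
      have e : ((n : ℂ) + 1) * coeff (n + 1) a = (ρ + n) * coeff n a +
          (((n : ℂ) + 1) * coeff (n + 1) a - n * coeff n a - ρ * coeff n a) := by ring
      have e3 : ((n : ℝ) + 1) * ‖coeff (n + 1) a‖ = ‖((n : ℂ) + 1) * coeff (n + 1) a‖ := by
        rw [norm_mul]; congr 1
        exact_mod_cast (Complex.norm_natCast (n + 1)).symm
      have e4 : ((n : ℝ) + 1) * ‖coeff (n + 1) a‖ ≤
          (σ + n) * (c / 2 * weight (s + 1) n + C * weight σ n) +
            c / 2 * δ * weight (s + 1) n := by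
        rw [e3, e]
        refine (norm_add_le _ _).trans (add_le_add ?_ b1)
        rw [norm_mul]
        exact mul_le_mul b2 ih (norm_nonneg _) (by positivity)
      have e5 := succ_mul_weight σ n
      have e6 := succ_mul_weight (s + 1) n
      refine le_of_mul_le_mul_left (e4.trans (le_of_eq ?_)) hn1
      rw [hδ]
      linear_combination (-(c / 2)) * e6 - C * e5
  have e7 := (isLittleO_iff.mp hw) (show 0 < c / (2 * (C + 1)) by positivity)
  filter_upwards [eventually_ge_atTop N, e7] with n hn e8
  rw [Real.norm_of_nonneg (hwp n).le, Real.norm_of_nonneg (hwp' n).le] at e8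
  rw [Real.norm_of_nonneg (hwp' n).le]
  have e9 : C * weight σ n ≤ c / 2 * weight (s + 1) n := by
    calc C * weight σ n ≤ (C + 1) * (c / (2 * (C + 1)) * weight (s + 1) n) := by
          refine mul_le_mul (by linarith) e8 (hwp n).le (by linarith)
      _ = c / 2 * weight (s + 1) n := by field_simp
  linarith [key n hn]

lemma smallO_of_op_prod {s : ℝ} (hs : -1 < s) {R : Multiset ℂ} (hR : ∀ ρ ∈ R, ρ.re < s + 1)
    {a : ℂ⟦X⟧} (h : SmallO s (op (R.map fun ρ => Polynomial.X - Polynomial.C ρ).prod a)) :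
    SmallO s a := by
  induction R using Multiset.induction_on generalizing a with
  | empty => simpa [op_one] using h
  | cons ρ R ih =>
    rw [Multiset.map_cons, Multiset.prod_cons, op_mul, op_X_sub_C] at h
    exact ih (fun x hx => hR x (Multiset.mem_cons_of_mem hx))
      (smallO_of_eulerD_sub hs (hR ρ (Multiset.mem_cons_self ρ R)) h)

/-- If all roots of `p` have real part less than `s + 1`, then `p(D)⁻¹` preserves `o(n ^ s)`. -/
lemma smallO_of_op {s : ℝ} (hs : -1 < s) {p : Polynomial ℂ} (hp : p ≠ 0)
    (hR : ∀ ρ, p.eval ρ = 0 → ρ.re < s + 1) {a : ℂ⟦X⟧} (h : SmallO s (op p a)) : SmallO s a := by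
  have hsplit := IsAlgClosed.splits p
  have e := hsplit.eq_prod_roots
  rw [e, op_mul, op_C] at h
  have hl : p.leadingCoeff ≠ 0 := Polynomial.leadingCoeff_ne_zero.mpr hp
  have h2 := h.smul p.leadingCoeff⁻¹
  rw [smul_smul, inv_mul_cancel₀ hl, one_smul] at h2
  exact smallO_of_op_prod hs (fun ρ hρ => hR ρ (Polynomial.isRoot_of_mem_roots hρ)) h2

lemma smallO_negPow {s : ℂ} {t : ℝ} (ht : -1 < t) (h : s.re < t + 1) : SmallO t (negPow s) := by
  refine smallO_of_eulerD_sub ht h ?_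
  rw [eulerD_negPow, sub_self]
  exact SmallO.zero

lemma SmallO.exists_bound {s : ℝ} (hs : -1 < s) {a : ℂ⟦X⟧} (h : SmallO s a) :
    ∃ C : ℝ, 0 ≤ C ∧ ∀ n, ‖coeff n a‖ ≤ C * weight (s + 1) n := by
  have hw : ∀ n, 0 < weight (s + 1) n := weight_pos (by linarith)
  have h1 := ((SmallO.iff_weight hs).mp h).isBigO
  rw [isBigO_nat_atTop_iff (fun n hn => absurd hn (hw n).ne')] at h1
  obtain ⟨C, hC⟩ := h1
  refine ⟨max C 0, le_max_right _ _, fun n => ?_⟩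
  have := hC n
  rw [Real.norm_of_nonneg (hw n).le] at this
  exact this.trans (mul_le_mul_of_nonneg_right (le_max_left _ _) (hw n).le)

/-- The convolution of the two weights is the weight of exponent s + t + 2, of order n^(s + t + 1);
the strict inequality turns O into o. -/
lemma SmallO.mul {s t u : ℝ} (hs : -1 < s) (ht : -1 < t) (hu : s + t + 1 < u) {a b : ℂ⟦X⟧}
    (ha : SmallO s a) (hb : SmallO t b) : SmallO u (a * b) := by
  obtain ⟨A, hA0, hA⟩ := ha.exists_bound hs
  obtain ⟨B, hB0, hB⟩ := hb.exists_bound ht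
  have hwa : ∀ n, 0 < weight (s + 1) n := weight_pos (by linarith)
  have hwb : ∀ n, 0 < weight (t + 1) n := weight_pos (by linarith)
  have hst : 0 < s + 1 + (t + 1) := by linarith
  have h1 : (fun n : ℕ => coeff n (a * b)) =O[atTop] fun n : ℕ => weight (s + 1 + (t + 1)) n := by
    refine IsBigO.of_bound (A * B) (Eventually.of_forall fun n => ?_)
    rw [coeff_mul, Real.norm_of_nonneg (weight_pos hst n).le, ← sum_weight_mul_weight,
      Finset.mul_sum]
    refine (norm_sum_le _ _).trans (Finset.sum_le_sum fun p _ => ?_)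
    rw [norm_mul]
    calc ‖coeff p.1 a‖ * ‖coeff p.2 b‖
        ≤ (A * weight (s + 1) p.1) * (B * weight (t + 1) p.2) :=
          mul_le_mul (hA _) (hB _) (norm_nonneg _) (mul_nonneg hA0 (hwa _).le)
      _ = _ := by ring
  exact h1.trans_isLittleO ((weight_isTheta hst).trans_isLittleO
    (isLittleO_natCast_rpow (by linarith)))

end MarySearch

/-! ### The digamma function as a limit of harmonic-type sums -/

namespace MarySearch

open Topology

/-- Log-convexity of Γ bounds the real sequence by Γ, and |w + j| ≥ Re w + j reduces the complex
case to it. The bound is uniform in n and serves as the dominating function below. -/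
lemma norm_GammaSeq_le {w : ℂ} (hw : 0 < w.re) {n : ℕ} (hn : n ≠ 0) :
    ‖Complex.GammaSeq w n‖ ≤ Real.Gamma w.re := by
  have hpos : ∀ j : ℕ, 0 < w.re + j := fun j => by positivity
  have h1 := Real.BohrMollerup.ge_logGammaSeq (n := n) Real.convexOn_log_Gamma
    (fun {y} hy => by
      simp only [Function.comp_apply]
      rw [Real.Gamma_add_one hy.ne', Real.log_mul hy.ne' (Real.Gamma_pos_of_pos hy).ne', add_comm])
    hw hn
  simp only [Function.comp_apply, Real.Gamma_one, Real.log_one, zero_add] at h1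
  have hn' : (0 : ℝ) < n := by exact_mod_cast Nat.pos_of_ne_zero hn
  have h2 : Real.exp (Real.BohrMollerup.logGammaSeq w.re n) =
      (n : ℝ) ^ w.re * n.factorial / ∏ j ∈ Finset.range (n + 1), (w.re + j) := by
    have hf : (0 : ℝ) < n.factorial := by exact_mod_cast n.factorial_pos
    rw [Real.BohrMollerup.logGammaSeq, Real.exp_sub, Real.exp_add, Real.exp_log hf, Real.exp_sum,
      Real.rpow_def_of_pos hn', mul_comm (Real.log _)]
    congr 1
    exact Finset.prod_congr rfl fun j _ => Real.exp_log (hpos j)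
  have h3 := Real.exp_le_exp.mpr h1
  rw [h2, Real.exp_log (Real.Gamma_pos_of_pos hw)] at h3
  refine le_trans ?_ h3
  rw [Complex.GammaSeq, norm_div, norm_mul, norm_prod,
    Complex.norm_natCast_cpow_of_pos (Nat.pos_of_ne_zero hn), Complex.norm_natCast]
  refine div_le_div_of_nonneg_left (by positivity) (Finset.prod_pos fun j _ => hpos j) ?_
  refine Finset.prod_le_prod (fun j _ => (hpos j).le) fun j _ => ?_
  have := Complex.re_le_norm (w + j)
  simpa using this

lemma GammaSeq_differentiableAt {w : ℂ} (hw : 0 < w.re) {n : ℕ} (hn : n ≠ 0) :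
    DifferentiableAt ℂ (fun z => Complex.GammaSeq z n) w := by
  have hn' : (n : ℂ) ≠ 0 := by exact_mod_cast hn
  unfold Complex.GammaSeq
  refine DifferentiableAt.div ?_ ?_ ?_
  · refine DifferentiableAt.mul ?_ (differentiableAt_const _)
    exact differentiableAt_id.const_cpow (Or.inl hn')
  · fun_prop
  · refine Finset.prod_ne_zero_iff.mpr fun j _ h => ?_
    have := congrArg Complex.re h
    simp at this
    have : (0 : ℝ) ≤ j := j.cast_nonneg
    linarith

lemma logDeriv_GammaSeq {w : ℂ} (hw : 0 < w.re) {n : ℕ} (hn : n ≠ 0) :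
    logDeriv (fun z => Complex.GammaSeq z n) w =
      Complex.log n - ∑ j ∈ Finset.range (n + 1), 1 / (w + j) := by
  have hn' : (n : ℂ) ≠ 0 := by exact_mod_cast hn
  have hne : ∀ j : ℕ, w + j ≠ 0 := fun j h => by
    have := congrArg Complex.re h
    simp at this
    have : (0 : ℝ) ≤ j := j.cast_nonneg
    linarith
  have hf : (n.factorial : ℂ) ≠ 0 := by exact_mod_cast n.factorial_ne_zero
  have hc : (n : ℂ) ^ w ≠ 0 := by simp [Complex.cpow_eq_zero_iff, hn']
  have hd : DifferentiableAt ℂ (fun z : ℂ => (n : ℂ) ^ z) w :=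
    differentiableAt_id.const_cpow (Or.inl hn')
  unfold Complex.GammaSeq
  rw [logDeriv_div (f := fun z => (n : ℂ) ^ z * n.factorial)
    (g := fun z => ∏ j ∈ Finset.range (n + 1), (z + j)) w (mul_ne_zero hc hf)
    (Finset.prod_ne_zero_iff.mpr fun j _ => hne j) (hd.mul (differentiableAt_const _))
    (by fun_prop)]
  congr 1
  · rw [logDeriv_mul_const _ _ hf, logDeriv_apply]
    have : deriv (fun z : ℂ => (n : ℂ) ^ z) w = (n : ℂ) ^ w * Complex.log n := by
      have := (hasDerivAt_id w).const_cpow (c := (n : ℂ)) (Or.inl hn')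
      simpa using this.deriv
    rw [this]; field_simp
  · rw [logDeriv_prod (f := fun (j : ℕ) (z : ℂ) => z + (j : ℂ)) (fun j _ => hne j)
      (fun j _ => by fun_prop)]
    refine Finset.sum_congr rfl fun j _ => ?_
    simp [logDeriv_apply]

/-- Cauchy's formula on the circle of radius Re s / 2 expresses the derivative as an integral of the
function, so pointwise convergence and the domination by `norm_GammaSeq_le` suffice. -/
lemma tendsto_deriv_GammaSeq {s : ℂ} (hs : 0 < s.re) :
    Tendsto (fun n : ℕ => deriv (fun z => Complex.GammaSeq z n) s) atTop
      (𝓝 (deriv Complex.Gamma s)) := by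
  set r := s.re / 2 with hr
  have hr0 : 0 < r := by positivity
  have hball : ∀ w ∈ Metric.closedBall s r, r ≤ w.re := by
    intro w hw
    have h1 := (Complex.abs_re_le_norm (w - s)).trans (mem_closedBall_iff_norm.mp hw)
    rw [Complex.sub_re, abs_le] at h1
    linarith [h1.1]
  have hne : ∀ w ∈ Metric.closedBall s r, ∀ m : ℕ, w ≠ -m := by
    intro w hw m h
    have := hball w hw
    rw [h] at this
    simp at this
    have : (0 : ℝ) ≤ m := m.cast_nonneg
    linarith
  have hG : DifferentiableOn ℂ Complex.Gamma (Metric.closedBall s r) := fun w hw =>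
    (Complex.differentiableAt_Gamma w (hne w hw)).differentiableWithinAt
  have hGs : ∀ n : ℕ, n ≠ 0 →
      DifferentiableOn ℂ (fun z => Complex.GammaSeq z n) (Metric.closedBall s r) := fun n hn w hw =>
    (GammaSeq_differentiableAt (hr0.trans_le (hball w hw)) hn).differentiableWithinAt
  have e1 := DifferentiableOn.deriv_eq_smul_circleIntegral hr0 hG
  have h2 : ∀ᶠ n : ℕ in atTop, (2 * Real.pi * Complex.I : ℂ)⁻¹ •
      (∮ z in C(s, r), (1 / (z - s) ^ 2) • Complex.GammaSeq z n) =
        deriv (fun z => Complex.GammaSeq z n) s := by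
    filter_upwards [eventually_ne_atTop 0] with n hn
    rw [DifferentiableOn.deriv_eq_smul_circleIntegral hr0 (hGs n hn), smul_smul,
      inv_mul_cancel₀ Complex.two_pi_I_ne_zero, one_smul]
  have e1' : (2 * Real.pi * Complex.I : ℂ)⁻¹ •
      (∮ z in C(s, r), (1 / (z - s) ^ 2) • Complex.Gamma z) = deriv Complex.Gamma s := by
    rw [e1, smul_smul, inv_mul_cancel₀ Complex.two_pi_I_ne_zero, one_smul]
  rw [← e1']
  refine Tendsto.congr' h2 (Tendsto.const_smul ?_ _)
  have hmem : ∀ θ : ℝ, circleMap s r θ ∈ Metric.closedBall s r := fun θ =>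
    circleMap_mem_closedBall s hr0.le θ
  have hcont : Continuous fun θ : ℝ => Real.Gamma (circleMap s r θ).re := by
    rw [continuous_iff_continuousAt]
    intro θ
    have h := Real.differentiableAt_Gamma (s := (circleMap s r θ).re) (fun m h => by
      have := hball _ (hmem θ)
      rw [h] at this
      have : (0 : ℝ) ≤ m := m.cast_nonneg
      linarith)
    exact ContinuousAt.comp (f := fun θ : ℝ => (circleMap s r θ).re) h.continuousAt
      (Complex.continuous_re.comp (continuous_circleMap s r)).continuousAt
  simp only [circleIntegral]
  refine intervalIntegral.tendsto_integral_filter_of_dominated_convergence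
    (fun θ => r * (1 / r ^ 2) * Real.Gamma (circleMap s r θ).re) ?_ ?_ ?_ ?_
  · filter_upwards [eventually_ne_atTop 0] with n hn
    have hc : Continuous fun θ : ℝ => deriv (circleMap s r) θ •
        (1 / (circleMap s r θ - s) ^ 2) • Complex.GammaSeq (circleMap s r θ) n := by
      have c1 : Continuous fun θ : ℝ => Complex.GammaSeq (circleMap s r θ) n :=
        (hGs n hn).continuousOn.comp_continuous (continuous_circleMap s r) hmem
      have c2 : Continuous fun θ : ℝ => 1 / (circleMap s r θ - s) ^ 2 := by
        refine continuous_const.div (by fun_prop) fun θ => ?_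
        have : circleMap s r θ - s ≠ 0 := sub_ne_zero.mpr (circleMap_ne_center hr0.ne')
        positivity
      have c3 : Continuous fun θ : ℝ => deriv (circleMap s r) θ := by
        simp only [deriv_circleMap]; fun_prop
      exact c3.smul (c2.smul c1)
    exact hc.aestronglyMeasurable
  · filter_upwards [eventually_ne_atTop 0] with n hn
    refine Eventually.of_forall fun θ _ => ?_
    rw [norm_smul, norm_smul, deriv_circleMap]
    have h3 := norm_GammaSeq_le (hr0.trans_le (hball _ (hmem θ))) hn
    have h4 : ‖(1 : ℂ) / (circleMap s r θ - s) ^ 2‖ = 1 / r ^ 2 := by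
      rw [circleMap_sub_center]; simp
    have h5 : ‖circleMap 0 r θ * Complex.I‖ = r := by simp [abs_of_pos hr0]
    rw [h4, h5, mul_assoc]
    gcongr
  · exact (continuous_const.mul hcont).intervalIntegrable _ _
  · refine Eventually.of_forall fun θ _ => ?_
    exact ((Complex.GammaSeq_tendsto_Gamma _).const_smul _).const_smul _

/-- The digamma function as the limit of `log n - ∑_{j < n} 1 / (s + j)`. -/
lemma tendsto_sum_sub_log {s : ℂ} (hs : 0 < s.re) :
    Tendsto (fun n : ℕ => ∑ j ∈ Finset.range n, 1 / (s + j) - Complex.log n) atTop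
      (𝓝 (-Complex.digamma s)) := by
  have h1 := (tendsto_deriv_GammaSeq hs).div (Complex.GammaSeq_tendsto_Gamma s)
    (Complex.Gamma_ne_zero_of_re_pos hs)
  -- `GammaSeq` has n + 1 factors while the sum has n terms; the extra term tends to 0.
  have h2 : Tendsto (fun n : ℕ => 1 / ((n : ℂ) + s)) atTop (𝓝 0) := by
    have h3 := (tendsto_natCast_div_add_atTop (s : ℂ)).mul
      (tendsto_one_div_atTop_nhds_zero_nat (𝕜 := ℂ))
    rw [mul_zero] at h3
    refine h3.congr' ?_
    filter_upwards [eventually_ne_atTop 0] with n hn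
    have hn' : (n : ℂ) ≠ 0 := by exact_mod_cast hn
    field_simp
  have h3 := (h1.add h2).neg
  rw [add_zero] at h3
  rw [Complex.digamma_def, logDeriv_apply]
  refine h3.congr' ?_
  filter_upwards [eventually_ne_atTop 0] with n hn
  have h4 := logDeriv_GammaSeq hs hn
  rw [logDeriv_apply] at h4
  simp only [Pi.div_apply]
  rw [h4, Finset.sum_range_succ, add_comm (n : ℂ) s]; ring

end MarySearch

/-! ### Independence and uniformity of the subtrees of a random permutation -/

namespace MarySearch

open PowerSeries

section gaps

/-- The number of elements of `{0, …, n - 1} \ R` that exceed exactly `i` elements of `R`. -/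
def gapCard (n : ℕ) (R : Finset ℕ) (i : ℕ) : ℕ :=
  ((Finset.range n \ R).filter fun v => (R.filter (· < v)).card = i).card

/-- A new largest value outside R lies above all of R and so enlarges only the last gap. -/
lemma gapCard_succ_of_subset {n k : ℕ} {R : Finset ℕ} (hR : R ⊆ Finset.range n)
    (hk : R.card = k) (i : ℕ) :
    gapCard (n + 1) R i = gapCard n R i + if i = k then 1 else 0 := by
  have hn : n ∉ R := fun h => by simpa using hR h
  have h1 : R.filter (· < n) = R := Finset.filter_true_of_mem fun x hx => by simpa using hR hx
  rw [gapCard, Finset.range_add_one, Finset.insert_sdiff_of_notMem _ hn, Finset.filter_insert, h1,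
    hk]
  by_cases h : k = i
  · rw [if_pos h, if_pos h.symm, Finset.card_insert_of_notMem (by simp), gapCard]
  · rw [if_neg h, if_neg (Ne.symm h), add_zero, gapCard]

lemma gapCard_insert {n : ℕ} {R : Finset ℕ} (i : ℕ) :
    gapCard (n + 1) (insert n R) i = gapCard n R i := by
  have h1 : Finset.range (n + 1) \ insert n R = Finset.range n \ R := by
    ext v; simp only [Finset.mem_sdiff, Finset.mem_range, Finset.mem_insert]
    constructor
    · rintro ⟨h1, h2⟩; exact ⟨by omega, fun h => h2 (Or.inr h)⟩
    · rintro ⟨h1, h2⟩; exact ⟨by omega, fun h => h.elim (by omega) h2⟩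
  rw [gapCard, gapCard, h1]
  congr 1
  refine Finset.filter_congr fun v hv => ?_
  have hv' : v < n := by simp at hv; exact hv.1
  rw [Finset.filter_insert, if_neg (by omega)]

lemma gapCard_eq_zero {n k : ℕ} {R : Finset ℕ} (hk : R.card = k) {i : ℕ} (hi : k < i) :
    gapCard n R i = 0 := by
  rw [gapCard, Finset.card_eq_zero, Finset.filter_eq_empty_iff]
  intro v _
  have := Finset.card_filter_le R (· < v)
  omega

/-- Sums over `k`-subsets of products of functions of the gap lengths. -/
lemma sum_powersetCard_gapCard (n k : ℕ) (f : ℕ → ℕ → ℂ) (g : ℕ → ℂ) :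
    ∑ R ∈ (Finset.range n).powersetCard k,
        (∏ i ∈ Finset.range k, f i (gapCard n R i)) * g (gapCard n R k) =
      coeff n (X ^ k * (∏ i ∈ Finset.range k, PowerSeries.mk (f i)) * PowerSeries.mk g) := by
  induction n generalizing k g with
  | zero =>
    cases k with
    | zero => simp [gapCard]
    | succ k =>
      rw [Finset.powersetCard_eq_empty.mpr (by simp)]
      simp [pow_succ', mul_assoc]
  | succ n ih =>
    -- The split of g mirrors the two cases for the largest value: as an element of R it leaves the
    -- last gap empty, otherwise it lies in the last gap, which then shrinks by one.
    have hg : PowerSeries.mk g = C (g 0) + X * PowerSeries.mk (fun j => g (j + 1)) := by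
      ext j
      cases j with
      | zero => simp
      | succ j => rw [map_add, coeff_succ_X_mul]; simp
    cases k with
    | zero =>
      rw [Finset.powersetCard_zero, Finset.sum_singleton]
      have : gapCard (n + 1) ∅ 0 = n + 1 := by simp [gapCard]
      simp [this]
    | succ k =>
      rw [Finset.range_add_one, Finset.powersetCard_succ_insert (by simp), Finset.sum_union]
      · rw [Finset.sum_image]
        · have e1 : ∀ R ∈ (Finset.range n).powersetCard (k + 1),
              (∏ i ∈ Finset.range (k + 1), f i (gapCard (n + 1) R i)) *
                  g (gapCard (n + 1) R (k + 1)) =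
                (∏ i ∈ Finset.range (k + 1), f i (gapCard n R i)) *
                  (fun j => g (j + 1)) (gapCard n R (k + 1)) := by
            intro R hR
            obtain ⟨hR1, hR2⟩ := Finset.mem_powersetCard.mp hR
            rw [gapCard_succ_of_subset hR1 hR2, if_pos rfl]
            congr 1
            refine Finset.prod_congr rfl fun i hi => ?_
            rw [gapCard_succ_of_subset hR1 hR2, if_neg (by simp at hi; omega), add_zero]
          have e2 : ∀ R ∈ (Finset.range n).powersetCard k,
              (∏ i ∈ Finset.range (k + 1), f i (gapCard (n + 1) (insert n R) i)) *
                  g (gapCard (n + 1) (insert n R) (k + 1)) =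
                (∏ i ∈ Finset.range k, f i (gapCard n R i)) * f k (gapCard n R k) * g 0 := by
            intro R hR
            obtain ⟨hR1, hR2⟩ := Finset.mem_powersetCard.mp hR
            simp only [gapCard_insert]
            rw [gapCard_eq_zero hR2 (Nat.lt_succ_self k), Finset.prod_range_succ]
          rw [Finset.sum_congr rfl e1, Finset.sum_congr rfl e2, ← Finset.sum_mul, ih k,
            ih (k + 1) (fun j => g (j + 1)), hg,
            mul_add, map_add]
          rw [add_comm]
          congr 1
          · rw [coeff_mul_C, Finset.prod_range_succ, pow_succ', mul_assoc X,
              coeff_succ_X_mul, mul_assoc (X ^ k)]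
          · rw [mul_left_comm, coeff_succ_X_mul]
        · intro R hR R' hR' h
          have h1 := (Finset.mem_powersetCard.mp hR).1
          have h2 := (Finset.mem_powersetCard.mp hR').1
          have n1 : n ∉ R := fun h => by simpa using h1 h
          have n2 : n ∉ R' := fun h => by simpa using h2 h
          rw [← Finset.erase_insert n1, h, Finset.erase_insert n2]
      · rw [Finset.disjoint_left]
        intro R hR hR'
        obtain ⟨R', _, rfl⟩ := Finset.mem_image.mp hR'
        have := (Finset.mem_powersetCard.mp hR).1 (Finset.mem_insert_self n R')
        simp at this

end gaps

section blocks

/-- The keys after the first `k` that exceed exactly `i` of the first `k` keys. -/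
def block {α : Type*} [LinearOrder α] (k i : ℕ) (l : List α) : List α :=
  (l.drop k).filter fun x => (l.take k).countP (fun y => decide (y < x)) = i

lemma block_map {α β : Type*} [LinearOrder α] [LinearOrder β] (k i : ℕ) (l : List α) (f : α → β)
    (hf : ∀ x ∈ l, ∀ y ∈ l, f x < f y ↔ x < y) : block k i (l.map f) = (block k i l).map f := by
  rw [block, block, ← List.map_drop, ← List.map_take, List.filter_map]
  congr 1
  refine List.filter_congr fun x hx => ?_
  simp only [Function.comp_apply, List.countP_map]
  congr 2
  refine List.countP_congr fun y hy => ?_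
  simp [hf y (List.mem_of_mem_take hy) x (List.mem_of_mem_drop hx)]

/-- A function of sequences of keys that only depends on their relative order. -/
def OrderInvariant (G : List ℕ → ℂ) : Prop :=
  ∀ (l : List ℕ) (f : ℕ → ℕ), (∀ x ∈ l, ∀ y ∈ l, f x < f y ↔ x < y) → G (l.map f) = G l

/-- The sequence `σ(1), …, σ(n)`. -/
def keys (n : ℕ) (σ : Equiv.Perm (Fin n)) : List ℕ := List.ofFn fun i => (σ i).val + 1

/-- The mean of a function of the keys under the uniform distribution on permutations. -/
noncomputable def mean (n : ℕ) (G : List ℕ → ℂ) : ℂ :=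
  (∑ σ : Equiv.Perm (Fin n), G (keys n σ)) / (n.factorial : ℂ)

lemma keys_eq_map (n : ℕ) (σ : Equiv.Perm (Fin n)) :
    keys n σ = (List.ofFn σ).map fun v => v.val + 1 := by
  rw [keys, List.map_ofFn]; rfl

/-- Enumerating B in the order of l on one side and increasingly on the other turns permutations of
B into permutations of an initial segment; the increasing relabelling does not affect G. -/
lemma sum_perm_subtype {n : ℕ} {G : List ℕ → ℂ} (hG : OrderInvariant G) {l : List (Fin n)}
    (hl : l.Nodup) {B : Finset (Fin n)} (hB : l.toFinset = B) :
    ∑ ρ : Equiv.Perm B, G ((l.map (Equiv.Perm.ofSubtype ρ)).map fun v => v.val + 1) =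
      B.card.factorial * mean B.card G := by
  have hlen : l.length = B.card := by rw [← hB, List.toFinset_card_of_nodup hl]
  have hmem : ∀ i : Fin B.card, l.get (i.cast hlen.symm) ∈ B := fun i => by
    have h := List.get_mem l (i.cast hlen.symm)
    rwa [← List.mem_toFinset, hB] at h
  let e0 : Fin B.card → B := fun i => ⟨l.get (i.cast hlen.symm), hmem i⟩
  have he0 : Function.Bijective e0 := by
    rw [Fintype.bijective_iff_injective_and_card]
    refine ⟨fun i j h => ?_, by simp⟩
    have h1 := congrArg Subtype.val h
    have h2 := List.nodup_iff_injective_get.mp hl h1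
    simpa using h2
  let e : Fin B.card ≃ B := Equiv.ofBijective e0 he0
  let o : Fin B.card ≃o B := B.orderIsoOfFin rfl
  have hlist : l = List.ofFn fun i => (e i : Fin n) := by
    refine List.ext_get (by simp [hlen]) fun i h1 h2 => ?_
    simp [e, e0]
  have hpos : (B.card.factorial : ℂ) ≠ 0 := by exact_mod_cast B.card.factorial_ne_zero
  rw [mean, mul_div_cancel₀ _ hpos]
  refine Fintype.sum_equiv ((Equiv.equivCongr e o.toEquiv).symm) _ _ fun ρ => ?_
  -- The value 0 is never taken: the keys are 1, …, |B|.
  have hmap : (l.map (Equiv.Perm.ofSubtype ρ)).map (fun v => v.val + 1) =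
      (keys B.card ((Equiv.equivCongr e o.toEquiv).symm ρ)).map fun x =>
        if h : x - 1 < B.card then (o ⟨x - 1, h⟩ : Fin n).val + 1 else 0 := by
    rw [hlist, keys, List.map_ofFn, List.map_ofFn, List.map_ofFn]
    congr 1
    funext i
    have hi : ((Equiv.equivCongr e o.toEquiv).symm ρ) i = o.symm (ρ (e i)) := rfl
    simp only [Function.comp_apply, Equiv.Perm.ofSubtype_apply_coe, hi, Nat.add_sub_cancel,
      Fin.is_lt, dif_pos, Fin.eta, OrderIso.apply_symm_apply]
  rw [hmap]
  refine hG _ _ fun x hx y hy => ?_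
  rw [keys, List.mem_ofFn] at hx hy
  obtain ⟨i, rfl⟩ := hx
  obtain ⟨j, rfl⟩ := hy
  simp only [Nat.add_sub_cancel, Fin.is_lt, dif_pos, Fin.eta]
  rw [Nat.add_lt_add_iff_right, Nat.add_lt_add_iff_right, ← Fin.lt_def, ← Fin.lt_def,
    Subtype.coe_lt_coe, OrderIso.lt_iff_lt]

variable {n : ℕ}

/-- The set of the first `k` keys. -/
def rootSet (k : ℕ) (σ : Equiv.Perm (Fin n)) : Finset (Fin n) := ((List.ofFn σ).take k).toFinset

/-- The set of the keys outside `R` that exceed exactly `i` elements of `R`. -/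
def gapSet (R : Finset (Fin n)) (i : ℕ) : Finset (Fin n) :=
  (Finset.univ \ R).filter fun v => (R.filter (· < v)).card = i

lemma nodup_ofFn_perm (σ : Equiv.Perm (Fin n)) : (List.ofFn σ).Nodup :=
  List.nodup_ofFn_ofInjective σ.injective

lemma countP_take {k : ℕ} (σ : Equiv.Perm (Fin n)) (x : Fin n) :
    ((List.ofFn σ).take k).countP (fun y => decide (y < x)) =
      ((rootSet k σ).filter (· < x)).card := by
  rw [List.countP_eq_length_filter, ← List.toFinset_card_of_nodup
    (((nodup_ofFn_perm σ).sublist (List.take_sublist k _)).filter _)]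
  congr 1
  ext y
  simp [rootSet]

lemma mem_drop_iff {k : ℕ} (σ : Equiv.Perm (Fin n)) (x : Fin n) :
    x ∈ (List.ofFn σ).drop k ↔ x ∉ rootSet k σ := by
  have h := nodup_ofFn_perm σ
  rw [← List.take_append_drop k (List.ofFn σ), List.nodup_append] at h
  have hx : x ∈ List.ofFn σ := List.mem_ofFn.mpr ⟨σ.symm x, by simp⟩
  rw [← List.take_append_drop k (List.ofFn σ), List.mem_append] at hx
  rw [rootSet, List.mem_toFinset]
  constructor
  · intro h1 h2; exact h.2.2 _ h2 _ h1 rfl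
  · intro h1; exact hx.resolve_left h1

lemma block_ofFn {k : ℕ} (i : ℕ) (σ : Equiv.Perm (Fin n)) :
    block k i (List.ofFn σ) =
      ((List.ofFn σ).drop k).filter fun x => ((rootSet k σ).filter (· < x)).card = i := by
  rw [block]
  refine List.filter_congr fun x _ => ?_
  rw [countP_take]

lemma nodup_block {k : ℕ} (i : ℕ) (σ : Equiv.Perm (Fin n)) : (block k i (List.ofFn σ)).Nodup :=
  ((nodup_ofFn_perm σ).sublist (List.drop_sublist _ _)).filter _

lemma toFinset_block {k : ℕ} (i : ℕ) (σ : Equiv.Perm (Fin n)) :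
    (block k i (List.ofFn σ)).toFinset = gapSet (rootSet k σ) i := by
  ext x
  rw [block_ofFn, List.mem_toFinset, List.mem_filter, mem_drop_iff, gapSet, Finset.mem_filter]
  simp

lemma ofSubtype_mem_iff {B : Finset (Fin n)} (ρ : Equiv.Perm B) (x : Fin n) :
    Equiv.Perm.ofSubtype ρ x ∈ B ↔ x ∈ B := by
  by_cases hx : x ∈ B
  · simp [Equiv.Perm.ofSubtype_apply_of_mem ρ hx, hx]
  · simp [Equiv.Perm.ofSubtype_apply_of_not_mem ρ hx, hx]

lemma rootSet_mul {k i : ℕ} {σ : Equiv.Perm (Fin n)} (ρ : Equiv.Perm (gapSet (rootSet k σ) i)) :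
    (List.ofFn (Equiv.Perm.ofSubtype ρ * σ)).take k = (List.ofFn σ).take k := by
  have h : List.ofFn (Equiv.Perm.ofSubtype ρ * σ) = (List.ofFn σ).map (Equiv.Perm.ofSubtype ρ) := by
    rw [List.map_ofFn]; rfl
  rw [h, ← List.map_take]
  conv_rhs => rw [← List.map_id ((List.ofFn σ).take k)]
  refine List.map_congr_left fun x hx => ?_
  rw [Equiv.Perm.ofSubtype_apply_of_not_mem, id]
  intro hx'
  simp only [gapSet, Finset.mem_filter, Finset.mem_sdiff, Finset.mem_univ, true_and] at hx'
  exact hx'.1 (List.mem_toFinset.mpr hx)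

/-- A permutation of one gap preserves membership in every gap, hence it does not change which
positions belong to which block. -/
lemma block_mul {k i : ℕ} {σ : Equiv.Perm (Fin n)} (ρ : Equiv.Perm (gapSet (rootSet k σ) i))
    (j : ℕ) : block k j (List.ofFn (Equiv.Perm.ofSubtype ρ * σ)) =
      (block k j (List.ofFn σ)).map (Equiv.Perm.ofSubtype ρ) := by
  have h : List.ofFn (Equiv.Perm.ofSubtype ρ * σ) = (List.ofFn σ).map (Equiv.Perm.ofSubtype ρ) := by
    rw [List.map_ofFn]; rfl
  have hr : rootSet k (Equiv.Perm.ofSubtype ρ * σ) = rootSet k σ := by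
    rw [rootSet, rootSet_mul, rootSet]
  rw [block_ofFn, block_ofFn, hr, h, ← List.map_drop, List.filter_map]
  congr 1
  refine List.filter_congr fun x hx => ?_
  rw [mem_drop_iff] at hx
  simp only [Function.comp_apply]
  by_cases hxi : x ∈ gapSet (rootSet k σ) i
  · have h2 := (ofSubtype_mem_iff ρ x).mpr hxi
    simp only [gapSet, Finset.mem_filter] at hxi h2
    have e := h2.2.trans hxi.2.symm
    exact decide_eq_decide.mpr ⟨fun h => e.symm.trans h, fun h => e.trans h⟩
  · rw [Equiv.Perm.ofSubtype_apply_of_not_mem ρ hxi]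

lemma block_mul_of_ne {k i j : ℕ} (hij : j ≠ i) {σ : Equiv.Perm (Fin n)}
    (ρ : Equiv.Perm (gapSet (rootSet k σ) i)) :
    block k j (List.ofFn (Equiv.Perm.ofSubtype ρ * σ)) = block k j (List.ofFn σ) := by
  rw [block_mul]
  conv_rhs => rw [← List.map_id (block k j (List.ofFn σ))]
  refine List.map_congr_left fun x hx => ?_
  rw [← List.mem_toFinset, toFinset_block, gapSet, Finset.mem_filter] at hx
  refine Equiv.Perm.ofSubtype_apply_of_not_mem ρ fun h => hij ?_
  rw [gapSet, Finset.mem_filter] at h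
  rw [← hx.2, h.2]

/-- Given the set of root keys, the subtrees are independent and built from uniformly random
permutations. -/
lemma sum_prod_block (k : ℕ) (R : Finset (Fin n)) (G : ℕ → List ℕ → ℂ)
    (hG : ∀ i, OrderInvariant (G i)) (T : Finset ℕ) :
    ∑ σ : Equiv.Perm (Fin n) with rootSet k σ = R,
        ∏ i ∈ T, G i ((block k i (List.ofFn σ)).map fun v => v.val + 1) =
      (∏ i ∈ T, mean (gapSet R i).card (G i)) *
        (Finset.univ.filter fun σ : Equiv.Perm (Fin n) => rootSet k σ = R).card := by
  induction T using Finset.induction_on with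
  | empty => simp
  | insert i T hi ih =>
    set B := gapSet R i with hB
    set A := Finset.univ.filter fun σ : Equiv.Perm (Fin n) => rootSet k σ = R with hA
    set H : Equiv.Perm (Fin n) → ℂ := fun σ =>
      ∏ j ∈ T, G j ((block k j (List.ofFn σ)).map fun v => v.val + 1) with hH
    have hpos : (B.card.factorial : ℂ) ≠ 0 := by exact_mod_cast B.card.factorial_ne_zero
    -- Left multiplication by ρ permutes the orderings with root set R and touches only block i.
    -- Averaging over all ρ then replaces the factor i by its mean.
    have key : ∀ ρ : Equiv.Perm B,
        ∑ σ ∈ A, G i ((block k i (List.ofFn σ)).map fun v => v.val + 1) * H σ =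
          ∑ σ ∈ A, G i (((block k i (List.ofFn σ)).map (Equiv.Perm.ofSubtype ρ)).map
            fun v => v.val + 1) * H σ := by
      intro ρ
      symm
      refine Finset.sum_bij (fun σ _ => Equiv.Perm.ofSubtype ρ * σ) ?_ ?_ ?_ ?_
      · intro σ hσ
        simp only [hA, Finset.mem_filter, Finset.mem_univ, true_and] at hσ ⊢
        subst hσ
        rw [rootSet, rootSet_mul, rootSet]
      · intro σ _ τ _ h; exact mul_left_cancel h
      · intro σ hσ
        refine ⟨(Equiv.Perm.ofSubtype ρ)⁻¹ * σ, ?_, by simp⟩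
        simp only [hA, Finset.mem_filter, Finset.mem_univ, true_and] at hσ ⊢
        subst hσ
        rw [← map_inv, rootSet, rootSet_mul, rootSet]
      · intro σ hσ
        simp only [hA, Finset.mem_filter, Finset.mem_univ, true_and] at hσ
        subst hσ
        rw [block_mul]
        congr 1
        refine Finset.prod_congr rfl fun j hj => ?_
        rw [block_mul_of_ne (by rintro rfl; exact hi hj)]
    have h1 : (B.card.factorial : ℂ) *
        ∑ σ ∈ A, G i ((block k i (List.ofFn σ)).map fun v => v.val + 1) * H σ =
          (B.card.factorial : ℂ) * (mean B.card (G i) * ∑ σ ∈ A, H σ) := by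
      have h2 := Finset.sum_congr (rfl : (Finset.univ : Finset (Equiv.Perm B)) = Finset.univ)
        fun ρ _ => key ρ
      rw [Finset.sum_const, Finset.card_univ, Fintype.card_perm, Fintype.card_coe,
        nsmul_eq_mul, Finset.sum_comm] at h2
      rw [h2, ← mul_assoc, Finset.mul_sum]
      refine Finset.sum_congr rfl fun σ hσ => ?_
      simp only [hA, Finset.mem_filter, Finset.mem_univ, true_and] at hσ
      rw [← Finset.sum_mul, sum_perm_subtype (hG i) (nodup_block i σ)
        ((toFinset_block i σ).trans (by rw [hσ]))]
    have h2 := mul_left_cancel₀ hpos h1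
    rw [Finset.prod_insert hi]
    rw [hH] at h2
    simp only [Finset.prod_insert hi]
    rw [h2, ih]; ring

lemma rootSet_eq_image {k : ℕ} (σ : Equiv.Perm (Fin n)) :
    rootSet k σ = (Finset.univ.filter fun i : Fin n => i.val < k).image σ := by
  ext x
  rw [rootSet, List.mem_toFinset, List.mem_take_iff_getElem]
  simp only [List.length_ofFn, List.getElem_ofFn, Finset.mem_image, Finset.mem_filter,
    Finset.mem_univ, true_and]
  constructor
  · rintro ⟨i, hi, rfl⟩
    exact ⟨⟨i, by omega⟩, by simp; omega, rfl⟩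
  · rintro ⟨i, hi, rfl⟩
    exact ⟨i.val, by have := i.isLt; omega, rfl⟩

lemma card_rootSet {k : ℕ} (hk : k ≤ n) (σ : Equiv.Perm (Fin n)) : (rootSet k σ).card = k := by
  rw [rootSet, List.toFinset_card_of_nodup
    ((nodup_ofFn_perm σ).sublist (List.take_sublist _ _))]
  simp [hk]

lemma rootSet_perm_mul {k : ℕ} (π σ : Equiv.Perm (Fin n)) :
    rootSet k (π * σ) = (rootSet k σ).map π.toEmbedding := by
  rw [rootSet_eq_image, rootSet_eq_image, Finset.map_eq_image, Finset.image_image]; rfl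

/-- Left multiplication by a permutation that carries R to R' is a bijection between the two fibres.
-/
lemma card_rootSet_eq_congr {k : ℕ} {R R' : Finset (Fin n)} (h : R.card = R'.card) :
    (Finset.univ.filter fun σ : Equiv.Perm (Fin n) => rootSet k σ = R).card =
      (Finset.univ.filter fun σ : Equiv.Perm (Fin n) => rootSet k σ = R').card := by
  let e : {x // x ∈ R} ≃ {x // x ∈ R'} := Finset.equivOfCardEq h
  let π : Equiv.Perm (Fin n) := e.extendSubtype
  have hπ : R.map π.toEmbedding = R' := by
    refine Finset.eq_of_subset_of_card_le ?_ (by rw [Finset.card_map, h])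
    intro x hx
    obtain ⟨y, hy, rfl⟩ := Finset.mem_map.mp hx
    exact e.extendSubtype_mem y hy
  refine Finset.card_bij (fun σ _ => π * σ) ?_ ?_ ?_
  · intro σ hσ
    simp only [Finset.mem_filter, Finset.mem_univ, true_and] at hσ ⊢
    rw [rootSet_perm_mul, hσ, hπ]
  · intro σ _ τ _ h; exact mul_left_cancel h
  · intro σ hσ
    refine ⟨π⁻¹ * σ, ?_, by simp⟩
    simp only [Finset.mem_filter, Finset.mem_univ, true_and] at hσ ⊢
    rw [rootSet_perm_mul, hσ, ← hπ, Finset.map_map]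
    ext x; simp

lemma choose_mul_card_rootSet {k : ℕ} (hk : k ≤ n) {R : Finset (Fin n)} (hR : R.card = k) :
    n.choose k * (Finset.univ.filter fun σ : Equiv.Perm (Fin n) => rootSet k σ = R).card =
      n.factorial := by
  have h1 : (Finset.univ : Finset (Equiv.Perm (Fin n))).card =
      ∑ R' ∈ (Finset.univ : Finset (Fin n)).powersetCard k,
        (Finset.univ.filter fun σ : Equiv.Perm (Fin n) => rootSet k σ = R').card :=
    Finset.card_eq_sum_card_fiberwise fun σ _ => by
      simpa using card_rootSet hk σ
  rw [Finset.sum_congr rfl fun R' hR' => card_rootSet_eq_congr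
    (R' := R) ((Finset.mem_powersetCard.mp hR').2.trans hR.symm)] at h1
  rw [Finset.sum_const, Finset.card_powersetCard, Finset.card_univ, Finset.card_univ,
    Fintype.card_perm, Fintype.card_fin, smul_eq_mul] at h1
  exact h1.symm

lemma card_gapSet (R : Finset (Fin n)) (i : ℕ) :
    (gapSet R i).card = gapCard n (R.map Fin.valEmbedding) i := by
  rw [gapCard, ← Finset.card_map Fin.valEmbedding]
  congr 1
  ext x
  simp only [gapSet, Finset.mem_map, Finset.mem_filter, Finset.mem_sdiff, Finset.mem_univ,
    true_and, Fin.valEmbedding_apply, Finset.mem_range, Finset.filter_map, Finset.card_map]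
  constructor
  · rintro ⟨v, ⟨h1, h2⟩, rfl⟩
    refine ⟨⟨v.isLt, ?_⟩, h2⟩
    rintro ⟨w, hw, h⟩
    exact h1 (Fin.ext h ▸ hw)
  · rintro ⟨⟨h1, h2⟩, h3⟩
    exact ⟨⟨x, h1⟩, ⟨fun h => h2 ⟨_, h, rfl⟩, h3⟩, rfl⟩

/-- The product formula for the subtrees of the root, in terms of generating functions. -/
theorem choose_mul_mean_prod_block {k : ℕ} (hk : k ≤ n) (G : ℕ → List ℕ → ℂ)
    (hG : ∀ i, OrderInvariant (G i)) :
    (n.choose k : ℂ) * mean n (fun l => ∏ i ∈ Finset.range (k + 1), G i (block k i l)) =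
      coeff (n - k) (∏ i ∈ Finset.range (k + 1), PowerSeries.mk fun j => mean j (G i)) := by
  have hn : (n.factorial : ℂ) ≠ 0 := by exact_mod_cast n.factorial_ne_zero
  have e1 : ∀ σ : Equiv.Perm (Fin n), ∏ i ∈ Finset.range (k + 1), G i (block k i (keys n σ)) =
      ∏ i ∈ Finset.range (k + 1),
        G i ((block k i (List.ofFn σ)).map fun v => v.val + 1) := fun σ => by
    refine Finset.prod_congr rfl fun i _ => ?_
    rw [keys_eq_map, block_map]
    intro x _ y _
    rw [Nat.add_lt_add_iff_right, Fin.lt_def]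
  have e2 : ∑ σ : Equiv.Perm (Fin n), ∏ i ∈ Finset.range (k + 1), G i (block k i (keys n σ)) =
      ∑ R ∈ (Finset.univ : Finset (Fin n)).powersetCard k,
        (∏ i ∈ Finset.range (k + 1), mean (gapSet R i).card (G i)) *
        (Finset.univ.filter fun σ : Equiv.Perm (Fin n) => rootSet k σ = R).card := by
    rw [Finset.sum_congr rfl fun σ _ => e1 σ,
      ← Finset.sum_fiberwise_of_maps_to (s := Finset.univ) (g := rootSet k)
      (t := (Finset.univ : Finset (Fin n)).powersetCard k)
      (fun σ _ => by simpa using card_rootSet hk σ)]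
    exact Finset.sum_congr rfl fun R _ => sum_prod_block k R G hG _
  have e3 : (n.choose k : ℂ) *
      mean n (fun l => ∏ i ∈ Finset.range (k + 1), G i (block k i l)) =
      ∑ R ∈ (Finset.univ : Finset (Fin n)).powersetCard k,
        ∏ i ∈ Finset.range (k + 1), mean (gapSet R i).card (G i) := by
    rw [mean, e2, mul_div_assoc', div_eq_iff hn, Finset.mul_sum, Finset.sum_mul]
    refine Finset.sum_congr rfl fun R hR => ?_
    rw [mul_left_comm]
    congr 1
    exact_mod_cast choose_mul_card_rootSet hk (Finset.mem_powersetCard.mp hR).2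
  have e4 := sum_powersetCard_gapCard n k (fun i j => mean j (G i)) (fun j => mean j (G k))
  rw [mul_assoc, ← Finset.prod_range_succ (fun i => PowerSeries.mk fun j => mean j (G i)) k,
    coeff_X_pow_mul', if_pos hk] at e4
  have hu : (Finset.univ : Finset (Fin n)).map Fin.valEmbedding = Finset.range n := by
    ext x; simp
  rw [e3, ← e4, ← hu, Finset.powersetCard_map, Finset.sum_map]
  refine Finset.sum_congr rfl fun R _ => ?_
  rw [Finset.prod_range_succ]
  simp only [card_gapSet]
  rfl

end blocks

end MarySearch

/-! ### Recurrences for the trees and for means over permutations -/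

namespace MarySearch

open PowerSeries

section trees

variable {m : ℕ}

lemma searchTree_nil : searchTree m [] = .empty := by rw [searchTree]; simp

lemma searchTree_of_lt {l : List ℕ} (h0 : l ≠ []) (h : l.length < m) :
    searchTree m l = .node (l.insertionSort (· ≤ ·)) fun _ => .empty := by
  rw [searchTree, if_neg h0, if_pos (Or.inl h)]

lemma searchTree_of_le (hm : 2 ≤ m) {l : List ℕ} (h : m ≤ l.length) :
    searchTree m l = .node ((l.take (m - 1)).insertionSort (· ≤ ·)) fun i =>
      searchTree m (block (m - 1) i.val l) := by
  have h0 : l ≠ [] := by rintro rfl; simp at h; omega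
  rw [searchTree, if_neg h0, if_neg (by omega)]
  rfl

lemma sum_length_filter {α : Type*} (l : List α) (f : α → ℕ) {k : ℕ} (hf : ∀ x ∈ l, f x < k) :
    ∑ i ∈ Finset.range k, (l.filter fun x => f x = i).length = l.length := by
  induction l with
  | nil => simp
  | cons x l ih =>
    have h1 : ∀ i, ((x :: l).filter fun x => f x = i).length =
        (l.filter fun x => f x = i).length + if f x = i then 1 else 0 := by
      intro i
      by_cases h : f x = i <;> simp [h]
    rw [Finset.sum_congr rfl fun i _ => h1 i, Finset.sum_add_distrib,
      ih fun y hy => hf y (List.mem_cons_of_mem x hy), Finset.sum_ite_eq,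
      if_pos (Finset.mem_range.mpr (hf x List.mem_cons_self)), List.length_cons]

lemma sum_length_block (k : ℕ) (l : List ℕ) :
    ∑ i ∈ Finset.range (k + 1), (block k i l).length = l.length - k := by
  rw [← List.length_drop]
  refine sum_length_filter (l.drop k) _ fun x _ => Nat.lt_succ_of_le ?_
  exact List.countP_le_length.trans (by simp)

lemma length_block_lt {k i : ℕ} (hk : 0 < k) {l : List ℕ} (hl : l ≠ []) :
    (block k i l).length < l.length := by
  have h1 := List.length_pos_of_ne_nil hl
  have h2 : (block k i l).length ≤ (l.drop k).length := List.length_filter_le _ _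
  rw [List.length_drop] at h2
  omega

lemma block_of_length_eq {k i : ℕ} {l : List ℕ} (h : l.length = k) : block k i l = [] := by
  rw [block, List.drop_eq_nil_of_le h.le]; rfl

/-- The recursion is valid already from m - 1 keys: the root is then full and all blocks are empty.
This matches the order m - 1 of the differential equation. -/
lemma space_rec (hm : 2 ≤ m) {l : List ℕ} (h : m - 1 ≤ l.length) :
    (searchTree m l).space =
      1 + ∑ i ∈ Finset.range m, (searchTree m (block (m - 1) i l)).space := by
  rcases h.eq_or_lt with h | h
  · have h0 : l ≠ [] := by rintro rfl; simp at h; omega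
    rw [searchTree_of_lt h0 (by omega)]
    simp [block_of_length_eq h.symm, searchTree_nil, MaryTree.space]
  · rw [searchTree_of_le hm (by omega), MaryTree.space, Finset.sum_range]

lemma keyPathLengthFrom_eq (hm : 2 ≤ m) (l : List ℕ) (d : ℕ) :
    (searchTree m l).keyPathLengthFrom d =
      d * l.length + (searchTree m l).keyPathLength := by
  induction hn : l.length using Nat.strong_induction_on generalizing l d with
  | _ n ih =>
    subst hn
    by_cases h0 : l = []
    · subst h0; simp [searchTree_nil, MaryTree.keyPathLengthFrom, MaryTree.keyPathLength]
    by_cases h : l.length < m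
    · rw [searchTree_of_lt h0 h]
      simp [MaryTree.keyPathLengthFrom, MaryTree.keyPathLength]
    · rw [searchTree_of_le hm (by omega)]
      have e : ∀ d', ∑ i : Fin m,
          (searchTree m (block (m - 1) i.val l)).keyPathLengthFrom (d' + 1) =
          (d' + 1) * (l.length - (m - 1)) +
            ∑ i : Fin m, (searchTree m (block (m - 1) i.val l)).keyPathLength := by
        intro d'
        rw [Finset.sum_congr rfl fun i _ => ih _ (length_block_lt (by omega) h0) _ (d' + 1) rfl,
          Finset.sum_add_distrib, ← Finset.mul_sum,
          ← Finset.sum_range (fun i => (block (m - 1) i l).length)]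
        have := sum_length_block (m - 1) l
        rw [Nat.sub_add_cancel (by omega)] at this
        rw [this]
      have hl : ((l.take (m - 1)).insertionSort (· ≤ ·)).length = m - 1 := by
        rw [List.length_insertionSort, List.length_take]; omega
      simp only [MaryTree.keyPathLength, MaryTree.keyPathLengthFrom] at e ⊢
      rw [e, e, hl]
      have : l.length = (m - 1) + (l.length - (m - 1)) := by omega
      generalize l.length - (m - 1) = q at this ⊢
      rw [this]; ring

lemma keyPathLength_of_lt {l : List ℕ} (h : l.length < m) :
    (searchTree m l).keyPathLength = 0 := by
  by_cases h0 : l = []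
  · subst h0; simp [searchTree_nil, MaryTree.keyPathLengthFrom, MaryTree.keyPathLength]
  · rw [searchTree_of_lt h0 h]
    simp [MaryTree.keyPathLengthFrom, MaryTree.keyPathLength]

/-- Each key outside the root is one level deeper than in its own subtree. -/
lemma keyPathLength_rec (hm : 2 ≤ m) {l : List ℕ} (h : m - 1 ≤ l.length) :
    (searchTree m l).keyPathLength = (l.length - (m - 1)) +
      ∑ i ∈ Finset.range m, (searchTree m (block (m - 1) i l)).keyPathLength := by
  rcases h.eq_or_lt with h | h
  · rw [keyPathLength_of_lt (by omega), ← h, Nat.sub_self, zero_add]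
    refine (Finset.sum_eq_zero fun i _ => ?_).symm
    rw [block_of_length_eq h.symm, keyPathLength_of_lt (by simp; omega)]
  · have h1 := sum_length_block (m - 1) l
    rw [Nat.sub_add_cancel (by omega)] at h1
    rw [← h1, ← Finset.sum_add_distrib, searchTree_of_le hm (by omega), MaryTree.keyPathLength,
      MaryTree.keyPathLengthFrom, zero_mul, zero_add, Finset.sum_range]
    refine Finset.sum_congr rfl fun i _ => ?_
    rw [keyPathLengthFrom_eq hm]; ring

lemma stats_map (hm : 2 ≤ m) (l : List ℕ) (f : ℕ → ℕ)
    (hf : ∀ x ∈ l, ∀ y ∈ l, f x < f y ↔ x < y) :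
    (searchTree m (l.map f)).space = (searchTree m l).space ∧
      (searchTree m (l.map f)).keyPathLength = (searchTree m l).keyPathLength := by
  induction hn : l.length using Nat.strong_induction_on generalizing l with
  | _ n ih =>
    subst hn
    by_cases h0 : l = []
    · subst h0; simp
    have h0' : l.map f ≠ [] := by simpa using h0
    by_cases h : l.length < m
    · rw [searchTree_of_lt h0 h, searchTree_of_lt h0' (by simpa using h)]
      simp [MaryTree.space, MaryTree.keyPathLengthFrom, MaryTree.keyPathLength]
    · have h1 : m - 1 ≤ l.length := by omega
      have h2 : m - 1 ≤ (l.map f).length := by simpa using h1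
      have h3 : ∀ i x, x ∈ block (m - 1) i l → x ∈ l := fun i x hx =>
        List.mem_of_mem_drop (List.mem_of_mem_filter hx)
      have h4 : ∀ i, _ := fun i => ih _ (length_block_lt (i := i) (by omega : 0 < m - 1) h0)
        (block (m - 1) i l) (fun x hx y hy => hf x (h3 i x hx) y (h3 i y hy)) rfl
      rw [space_rec hm h1, space_rec hm h2, keyPathLength_rec hm h1, keyPathLength_rec hm h2]
      simp only [block_map _ _ l f hf, List.length_map]
      exact ⟨by rw [Finset.sum_congr rfl fun i _ => (h4 i).1],
        by rw [Finset.sum_congr rfl fun i _ => (h4 i).2]⟩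

end trees

section mean

lemma mean_congr {n : ℕ} {G H : List ℕ → ℂ} (h : ∀ l : List ℕ, l.length = n → G l = H l) :
    mean n G = mean n H := by
  rw [mean, mean]
  congr 1
  exact Finset.sum_congr rfl fun σ _ => h _ (by simp [keys])

lemma mean_const (n : ℕ) (c : ℂ) : mean n (fun _ => c) = c := by
  have hn : (n.factorial : ℂ) ≠ 0 := by exact_mod_cast n.factorial_ne_zero
  rw [mean, Finset.sum_const, Finset.card_univ, Fintype.card_perm, Fintype.card_fin, nsmul_eq_mul,
    mul_div_cancel_left₀ _ hn]

lemma mean_add (n : ℕ) (G H : List ℕ → ℂ) :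
    mean n (fun l => G l + H l) = mean n G + mean n H := by
  simp only [mean, Finset.sum_add_distrib, add_div]

lemma mean_const_mul (n : ℕ) (c : ℂ) (G : List ℕ → ℂ) :
    mean n (fun l => c * G l) = c * mean n G := by
  simp only [mean, ← Finset.mul_sum, mul_div_assoc]

lemma mean_sum {ι : Type*} (s : Finset ι) (n : ℕ) (G : ι → List ℕ → ℂ) :
    mean n (fun l => ∑ i ∈ s, G i l) = ∑ i ∈ s, mean n (G i) := by
  simp only [mean]
  rw [Finset.sum_comm, Finset.sum_div]

/-- The generating function of the means. -/
noncomputable def gf (G : List ℕ → ℂ) : ℂ⟦X⟧ := PowerSeries.mk fun n => mean n G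

lemma coeff_gf (G : List ℕ → ℂ) (n : ℕ) : coeff n (gf G) = mean n G := by simp [gf]

lemma gf_one : gf (fun _ => 1) = negPow 1 := by
  ext n; rw [coeff_gf, mean_const, coeff_negPow_one]

lemma OrderInvariant.const (c : ℂ) : OrderInvariant fun _ => c := fun _ _ _ => rfl

lemma OrderInvariant.mul {G H : List ℕ → ℂ} (hG : OrderInvariant G) (hH : OrderInvariant H) :
    OrderInvariant fun l => G l * H l := fun l f h => by simp only [hG l f h, hH l f h]

/-- The blocks not involved carry the constant function 1, whose generating function is (1 -
X)^(-1); there are k of them. -/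
lemma choose_mul_mean_block {n k : ℕ} (hk : k ≤ n) {G : List ℕ → ℂ} (hG : OrderInvariant G)
    {i : ℕ} (hi : i ∈ Finset.range (k + 1)) :
    (n.choose k : ℂ) * mean n (fun l => G (block k i l)) =
      coeff (n - k) (gf G * negPow k) := by
  have h := choose_mul_mean_prod_block hk (fun j => if j = i then G else fun _ => 1)
    (fun j => by split_ifs; exacts [hG, OrderInvariant.const 1])
  have e1 : ∀ l : List ℕ, ∏ j ∈ Finset.range (k + 1),
      (if j = i then G else fun _ => 1) (block k j l) = G (block k i l) := fun l => by
    rw [← Finset.mul_prod_erase _ _ hi, Finset.prod_eq_one]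
    · simp
    · intro j hj; simp [(Finset.mem_erase.mp hj).1]
  simp only [e1] at h
  rw [h, ← Finset.mul_prod_erase _ _ hi, Finset.prod_congr rfl (g := fun _ => negPow 1)]
  · rw [Finset.prod_const, Finset.card_erase_of_mem hi, Finset.card_range, Nat.add_sub_cancel,
      negPow_natCast]
    simp [gf]
  · intro j hj
    simp only [if_neg (Finset.mem_erase.mp hj).1]
    exact gf_one

lemma choose_mul_mean_block_mul_block {n k : ℕ} (hk : k ≤ n) {G H : List ℕ → ℂ}
    (hG : OrderInvariant G) (hH : OrderInvariant H) {i j : ℕ} (hi : i ∈ Finset.range (k + 1))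
    (hj : j ∈ Finset.range (k + 1)) (hij : j ≠ i) :
    (n.choose k : ℂ) * mean n (fun l => G (block k i l) * H (block k j l)) =
      coeff (n - k) (gf G * gf H * negPow (k - 1)) := by
  have h := choose_mul_mean_prod_block hk
    (fun a => if a = i then G else if a = j then H else fun _ => 1)
    (fun a => by split_ifs; exacts [hG, hH, OrderInvariant.const 1])
  have hj' : j ∈ (Finset.range (k + 1)).erase i := Finset.mem_erase.mpr ⟨hij, hj⟩
  have e1 : ∀ l : List ℕ, ∏ a ∈ Finset.range (k + 1),
      (if a = i then G else if a = j then H else fun _ => 1) (block k a l) =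
        G (block k i l) * H (block k j l) := fun l => by
    rw [← Finset.mul_prod_erase _ _ hi, ← Finset.mul_prod_erase _ _ hj', Finset.prod_eq_one]
    · simp [hij]
    · intro a ha
      obtain ⟨h1, h2⟩ := Finset.mem_erase.mp ha
      simp [h1, (Finset.mem_erase.mp h2).1]
  simp only [e1] at h
  have hcard : (((Finset.range (k + 1)).erase i).erase j).card = k - 1 := by
    rw [Finset.card_erase_of_mem hj', Finset.card_erase_of_mem hi, Finset.card_range,
      Nat.add_sub_cancel]
  have hk1 : 1 ≤ k := by
    simp only [Finset.mem_range] at hi hj; omega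
  have hc : ((k : ℂ) - 1) = ((k - 1 : ℕ) : ℂ) := by push_cast [hk1]; rfl
  rw [h, ← Finset.mul_prod_erase _ _ hi, ← Finset.mul_prod_erase _ _ hj',
    Finset.prod_congr rfl (g := fun _ => negPow 1)]
  · rw [Finset.prod_const, hcard, hc, negPow_natCast]
    simp [gf, hij, mul_assoc]
  · intro a ha
    obtain ⟨h1, h2⟩ := Finset.mem_erase.mp ha
    simp only [if_neg h1, if_neg (Finset.mem_erase.mp h2).1]
    exact gf_one

lemma choose_mul_mean_sum_block {n k : ℕ} (hk : k ≤ n) {G : List ℕ → ℂ} (hG : OrderInvariant G) :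
    (n.choose k : ℂ) * mean n (fun l => ∑ i ∈ Finset.range (k + 1), G (block k i l)) =
      (k + 1) * coeff (n - k) (gf G * negPow k) := by
  rw [mean_sum, Finset.mul_sum,
    Finset.sum_congr rfl fun i hi => choose_mul_mean_block hk hG hi]
  simp

/-- The k + 1 diagonal pairs involve a single block; the (k + 1) k others involve two independent
blocks, hence a product of generating functions. -/
lemma choose_mul_mean_sum_mul_sum {n k : ℕ} (hk : k ≤ n) {G H : List ℕ → ℂ}
    (hG : OrderInvariant G) (hH : OrderInvariant H) :
    (n.choose k : ℂ) * mean n (fun l => (∑ i ∈ Finset.range (k + 1), G (block k i l)) *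
        ∑ i ∈ Finset.range (k + 1), H (block k i l)) =
      (k + 1) * coeff (n - k) (gf (fun l => G l * H l) * negPow k) +
        (k + 1) * k * coeff (n - k) (gf G * gf H * negPow (k - 1)) := by
  have e : ∀ i ∈ Finset.range (k + 1), (n.choose k : ℂ) *
      mean n (fun l => ∑ j ∈ Finset.range (k + 1), G (block k i l) * H (block k j l)) =
        coeff (n - k) (gf (fun l => G l * H l) * negPow k) +
          k * coeff (n - k) (gf G * gf H * negPow (k - 1)) := by
    intro i hi
    rw [mean_sum, Finset.mul_sum, ← Finset.add_sum_erase _ _ hi,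
      Finset.sum_congr rfl fun j hj => choose_mul_mean_block_mul_block hk hG hH hi
        (Finset.mem_erase.mp hj).2 (Finset.mem_erase.mp hj).1,
      Finset.sum_const, Finset.card_erase_of_mem hi, Finset.card_range, Nat.add_sub_cancel,
      nsmul_eq_mul, ← choose_mul_mean_block hk (hG.mul hH) hi]
  simp only [Finset.sum_mul_sum]
  rw [mean_sum, Finset.mul_sum, Finset.sum_congr rfl e]
  rw [Finset.sum_const, Finset.card_range, nsmul_eq_mul]; push_cast; ring

end mean

end MarySearch

/-! ### Differential equations for the means and the covariance -/

namespace MarySearch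

open PowerSeries

/-- The indicial polynomial `Λ` for nodes with at most `k = m - 1` keys. -/
noncomputable def indicialPoly (k : ℕ) : Polynomial ℂ :=
  rising k - Polynomial.C ((k + 1).factorial : ℂ)

lemma eval_rising (k : ℕ) (z : ℂ) :
    (rising k).eval z = ∏ j ∈ Finset.range k, (z + j) := by
  simp [rising, Polynomial.eval_prod]

lemma eval_indicialPoly (k : ℕ) (z : ℂ) : (indicialPoly k).eval z = indicial (k + 1) z := by
  simp [indicialPoly, indicial, eval_rising]

lemma prod_range_add_eq (k n : ℕ) :
    ∏ j ∈ Finset.range k, ((n : ℂ) + j + 1) = k.factorial * (n + k).choose k := by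
  have h : ∏ j ∈ Finset.range k, (n + j + 1) = k.factorial * (n + k).choose k := by
    rw [← Nat.ascFactorial_eq_factorial_mul_choose, Nat.ascFactorial_eq_prod_range]
    exact Finset.prod_congr rfl fun j _ => by ring
  exact_mod_cast h

lemma mul_coeff_negPow_add_one (s : ℂ) (n : ℕ) :
    s * coeff n (negPow (s + 1)) = (s + n) * coeff n (negPow s) := by
  induction n with
  | zero => simp
  | succ n ih =>
    have hn : (n : ℂ) + 1 ≠ 0 := by exact_mod_cast n.succ_ne_zero
    have h1 := coeff_succ_negPow s n
    have h2 := coeff_succ_negPow (s + 1) n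
    apply mul_left_cancel₀ hn
    push_cast
    linear_combination s * h2 + (s + 1 + n) * ih - (s + n + 1) * h1

lemma coeff_negPow_natCast_add_one (k n : ℕ) :
    coeff n (negPow ((k : ℂ) + 1)) = (n + k).choose k := by
  have hk : (k.factorial : ℂ) ≠ 0 := by exact_mod_cast k.factorial_ne_zero
  have hn : (n.factorial : ℂ) ≠ 0 := by exact_mod_cast n.factorial_ne_zero
  have h1 := prod_range_add_eq n k
  have h2 : ∏ j ∈ Finset.range n, ((k : ℂ) + 1 + j) = ∏ j ∈ Finset.range n, ((k : ℂ) + j + 1) :=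
    Finset.prod_congr rfl fun j _ => by ring
  rw [coeff_negPow_eq_div, div_eq_iff hn, h2, h1, add_comm k n, mul_comm, Nat.choose_symm_add]

/-- From a mean-value recurrence to a differential equation. -/
lemma op_rising_of_choose {k : ℕ} {a b : ℂ⟦X⟧}
    (h : ∀ n : ℕ, ((n + k).choose k : ℂ) * coeff (n + k) a =
      (k + 1) * coeff n (b * negPow k)) :
    op (rising k) a = ((k + 1).factorial : ℂ) • b := by
  refine op_rising_eq fun n => ?_
  rw [prod_range_add_eq, smul_mul_assoc, coeff_smul, smul_eq_mul, mul_assoc, h,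
    Nat.factorial_succ]
  push_cast; ring

section stats

/-- The constant `φ` as a complex number, for nodes with at most `k` keys. -/
noncomputable def occ (k : ℕ) : ℂ := (occupancy (k + 1) : ℂ)

/-- The space requirement, corrected by an affine function of the number of keys so that it is the
sum of the corresponding quantities of the subtrees. -/
noncomputable def spaceStat (k : ℕ) (l : List ℕ) : ℂ :=
  (searchTree (k + 1) l).space - occ k * (l.length + 1) + 1 / k

/-- The key path length. -/
noncomputable def keyStat (k : ℕ) (l : List ℕ) : ℂ := (searchTree (k + 1) l).keyPathLength

variable {k : ℕ}

lemma spaceStat_orderInvariant (hk : 1 ≤ k) : OrderInvariant (spaceStat k) := fun l f h => by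
  simp only [spaceStat, (stats_map (m := k + 1) (by omega) l f h).1, List.length_map]

lemma keyStat_orderInvariant (hk : 1 ≤ k) : OrderInvariant (keyStat k) := fun l f h => by
  simp only [keyStat, (stats_map (m := k + 1) (by omega) l f h).2]

/-- The quantity n + 1 is additive over the blocks, and (k + 1)/k = 1 + 1/k absorbs the root node.
Any coefficient in place of `occ k` would do here; its value is used only in `spaceGf_eq`. -/
lemma spaceStat_rec (hk : 1 ≤ k) {l : List ℕ} (h : k ≤ l.length) :
    spaceStat k l = ∑ i ∈ Finset.range (k + 1), spaceStat k (block k i l) := by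
  have hk0 : (k : ℂ) ≠ 0 := by exact_mod_cast (by omega : k ≠ 0)
  have h1 := space_rec (m := k + 1) (by omega) (l := l) (by simpa using h)
  have h2 := sum_length_block k l
  rw [Nat.add_sub_cancel] at h1
  have h3 : ((∑ i ∈ Finset.range (k + 1), (block k i l).length : ℕ) : ℂ) = l.length - k := by
    rw [h2]; push_cast [h]; rfl
  push_cast at h3
  simp only [spaceStat, Finset.sum_add_distrib, Finset.sum_sub_distrib, ← Finset.mul_sum, h3, h1,
    Finset.sum_const, Finset.card_range, nsmul_eq_mul]
  push_cast
  field_simp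
  ring

lemma keyStat_rec (hk : 1 ≤ k) {l : List ℕ} (h : k ≤ l.length) :
    keyStat k l = (l.length - k : ℂ) + ∑ i ∈ Finset.range (k + 1), keyStat k (block k i l) := by
  have h1 := keyPathLength_rec (m := k + 1) (by omega) (l := l) (by simpa using h)
  rw [Nat.add_sub_cancel] at h1
  simp only [keyStat, h1]
  push_cast [h]; rfl

lemma keyStat_of_lt {l : List ℕ} (h : l.length ≤ k) : keyStat k l = 0 := by
  rw [keyStat, keyPathLength_of_lt (by omega)]; simp

lemma spaceStat_of_lt {l : List ℕ} (h0 : l ≠ []) (h : l.length ≤ k) :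
    spaceStat k l = 1 - occ k * (l.length + 1) + 1 / k := by
  rw [spaceStat, searchTree_of_lt h0 (by omega)]; simp [MaryTree.space]

lemma spaceStat_nil : spaceStat k [] = - occ k + 1 / k := by
  rw [spaceStat, searchTree_nil]; simp [MaryTree.space]

/-- The generating function of the means of the corrected space requirement. -/
noncomputable def spaceGf (k : ℕ) : ℂ⟦X⟧ := gf (spaceStat k)

/-- The generating function of the means of the key path length. -/
noncomputable def keyGf (k : ℕ) : ℂ⟦X⟧ := gf (keyStat k)

/-- The contribution of the root to the mean of the product of both statistics. -/
noncomputable def rootGf (k : ℕ) : ℂ⟦X⟧ :=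
  PowerSeries.mk fun n => if n < k then 0 else ((n : ℂ) - k) * coeff n (spaceGf k)

/-- The generating function of the means of the product, without the contribution of the root. -/
noncomputable def prodGf (k : ℕ) : ℂ⟦X⟧ := gf (fun l => spaceStat k l * keyStat k l) - rootGf k

lemma op_spaceGf (hk : 1 ≤ k) : op (indicialPoly k) (spaceGf k) = 0 := by
  rw [indicialPoly, sub_op, op_C, sub_eq_zero]
  refine op_rising_of_choose fun n => ?_
  rw [spaceGf, coeff_gf, mean_congr (H := fun l => ∑ i ∈ Finset.range (k + 1),
    spaceStat k (block k i l)) fun l hl => spaceStat_rec hk (by omega),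
    choose_mul_mean_sum_block (by omega) (spaceStat_orderInvariant hk), Nat.add_sub_cancel]

lemma op_keyGf (hk : 1 ≤ k) : op (indicialPoly k) (keyGf k) =
    ((k + 1).factorial : ℂ) • (negPow 2 - negPow 1) := by
  rw [indicialPoly, sub_op, op_C, sub_eq_iff_eq_add', ← smul_add]
  refine op_rising_of_choose fun n => ?_
  have hk1 : (k : ℂ) + 1 ≠ 0 := by exact_mod_cast k.succ_ne_zero
  have h1 := mul_coeff_negPow_add_one ((k : ℂ) + 1) n
  rw [coeff_negPow_natCast_add_one] at h1
  rw [keyGf, coeff_gf, mean_congr (H := fun l => (n : ℂ) + ∑ i ∈ Finset.range (k + 1),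
    keyStat k (block k i l)) fun l hl => by
      rw [keyStat_rec hk (by omega), hl]; push_cast; ring,
    mean_add, mean_const, mul_add, choose_mul_mean_sum_block (by omega) (keyStat_orderInvariant hk),
    Nat.add_sub_cancel, add_mul (gf _), sub_mul, negPow_mul, negPow_mul, map_add, map_sub,
    show (2 : ℂ) + k = k + 1 + 1 by ring, add_comm (1 : ℂ) k, coeff_negPow_natCast_add_one]
  linear_combination -h1

/-- Without `rootGf` only the product of two sums over subtrees is left. Its diagonal part gives
back the full mean of the product, which is `prodGf` plus `rootGf`; the other pairs of subtrees give
the convolution of the two means. -/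
lemma op_prodGf (hk : 1 ≤ k) : op (indicialPoly k) (prodGf k) =
    ((k + 1).factorial : ℂ) • (rootGf k + (k : ℂ) • ((1 - X) * (spaceGf k * keyGf k))) := by
  rw [indicialPoly, sub_op, op_C, sub_eq_iff_eq_add', ← smul_add]
  refine op_rising_of_choose fun n => ?_
  have hS := spaceStat_orderInvariant hk
  have hK := keyStat_orderInvariant hk
  have h1 : mean (n + k) (fun l => spaceStat k l * keyStat k l) =
      n * mean (n + k) (spaceStat k) + mean (n + k) (fun l =>
        (∑ i ∈ Finset.range (k + 1), spaceStat k (block k i l)) *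
          ∑ i ∈ Finset.range (k + 1), keyStat k (block k i l)) := by
    rw [← mean_const_mul, ← mean_add]
    refine mean_congr fun l hl => ?_
    rw [← spaceStat_rec hk (l := l) (by omega), keyStat_rec hk (l := l) (by omega), hl]
    push_cast; ring
  have h2 : coeff (n + k) (rootGf k) = n * mean (n + k) (spaceStat k) := by
    rw [rootGf, coeff_mk, if_neg (by omega), spaceGf, coeff_gf]; push_cast; ring
  have h3 := choose_mul_mean_sum_mul_sum (n := n + k) (k := k) (by omega) hS hK
  rw [Nat.add_sub_cancel] at h3
  have h4 : (1 - X) * (spaceGf k * keyGf k) * negPow k =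
      gf (spaceStat k) * gf (keyStat k) * negPow (k - 1) := by
    rw [← one_sub_X_mul_negPow, spaceGf, keyGf]; ring
  have h5 : coeff (n + k) (prodGf k) = mean (n + k) (fun l =>
        (∑ i ∈ Finset.range (k + 1), spaceStat k (block k i l)) *
          ∑ i ∈ Finset.range (k + 1), keyStat k (block k i l)) := by
    rw [prodGf, map_sub, coeff_gf, h1, h2, add_sub_cancel_left]
  rw [h5, h3, ← add_assoc, prodGf, sub_add_cancel, add_mul (gf _), smul_mul_assoc, h4, map_add,
    coeff_smul, smul_eq_mul]
  ring

lemma coeff_spaceGf_zero : coeff 0 (spaceGf k) = - occ k + 1 / k := by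
  rw [spaceGf, coeff_gf, mean_congr (H := fun _ => - occ k + 1 / k), mean_const]
  intro l hl
  rw [List.eq_nil_of_length_eq_zero hl, spaceStat_nil]

lemma coeff_spaceGf_of_le {n : ℕ} (h0 : n ≠ 0) (h : n ≤ k) :
    coeff n (spaceGf k) = 1 - occ k * (n + 1) + 1 / k := by
  rw [spaceGf, coeff_gf, mean_congr (H := fun _ => 1 - occ k * (n + 1) + 1 / k), mean_const]
  intro l hl
  rw [spaceStat_of_lt (by rintro rfl; simp at hl; omega) (by omega), hl]

lemma coeff_keyGf_of_le {n : ℕ} (h : n ≤ k) : coeff n (keyGf k) = 0 := by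
  rw [keyGf, coeff_gf, mean_congr (H := fun _ => 0), mean_const]
  intro l hl
  rw [keyStat_of_lt (by omega)]

lemma coeff_prodGf_of_lt {n : ℕ} (h : n < k) : coeff n (prodGf k) = 0 := by
  rw [prodGf, map_sub, coeff_gf, mean_congr (H := fun _ => 0), mean_const, rootGf, coeff_mk,
    if_pos h, sub_zero]
  intro l hl
  rw [keyStat_of_lt (by omega), mul_zero]

lemma integral_uniformPerm (n : ℕ) (f : Equiv.Perm (Fin n) → ℝ) :
    ∫ σ, f σ ∂(uniformPerm n) = (∑ σ, f σ) / n.factorial := by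
  rw [uniformPerm, PMF.integral_eq_sum]
  simp only [PMF.uniformOfFintype_apply, Fintype.card_perm, Fintype.card_fin, smul_eq_mul,
    ENNReal.toReal_inv, ENNReal.toReal_natCast]
  rw [← Finset.mul_sum]; ring

/-- The covariance in terms of the generating functions. -/
lemma covSK_eq (n : ℕ) : (covSK (k + 1) n : ℂ) =
    coeff n (prodGf k) + coeff n (rootGf k) - coeff n (spaceGf k) * coeff n (keyGf k) := by
  have e1 : (covSK (k + 1) n : ℂ) = mean n (fun l => ((searchTree (k + 1) l).space -
      mean n (fun l => ((searchTree (k + 1) l).space : ℂ))) *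
        (keyStat k l - mean n (keyStat k))) := by
    rw [covSK, covariance, integral_uniformPerm, integral_uniformPerm, integral_uniformPerm]
    simp only [mean, S, K, permTree, keyStat, keys]
    push_cast
    rfl
  -- The corrected statistic differs from the number of nodes by a function of n alone, so centring
  -- removes the correction.
  have e2 : mean n (spaceStat k) = mean n (fun l => ((searchTree (k + 1) l).space : ℂ)) +
      (- occ k * (n + 1) + 1 / k) := by
    rw [← mean_const n (- occ k * (n + 1) + 1 / k), ← mean_add]
    refine mean_congr fun l hl => ?_
    rw [spaceStat, hl]; ring
  have e3 : mean n (fun l => ((searchTree (k + 1) l).space -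
      mean n (fun l => ((searchTree (k + 1) l).space : ℂ))) * (keyStat k l - mean n (keyStat k))) =
      mean n (fun l => spaceStat k l * keyStat k l + (-mean n (keyStat k) * spaceStat k l +
        (-mean n (spaceStat k) * keyStat k l + mean n (spaceStat k) * mean n (keyStat k)))) := by
    refine mean_congr fun l hl => ?_
    have : spaceStat k l - mean n (spaceStat k) = (searchTree (k + 1) l).space -
        mean n (fun l => ((searchTree (k + 1) l).space : ℂ)) := by
      rw [e2, spaceStat, hl]; ring
    rw [← this]; ring
  rw [e1, e3, mean_add, mean_add, mean_add, mean_const_mul, mean_const_mul, mean_const, prodGf,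
    map_sub, coeff_gf, spaceGf, keyGf, coeff_gf, coeff_gf]
  ring

end stats

end MarySearch

/-! ### Zeros of the indicial polynomial: simplicity and location -/

namespace MarySearch

open Topology

section zeros

variable {k : ℕ}

lemma monic_rising (k : ℕ) : (rising k).Monic :=
  Polynomial.monic_prod_of_monic _ _ fun _ _ => Polynomial.monic_X_add_C _

lemma natDegree_rising (k : ℕ) : (rising k).natDegree = k := by
  rw [rising, Polynomial.natDegree_prod_of_monic _ _ fun j _ => Polynomial.monic_X_add_C _]
  simp only [Polynomial.natDegree_X_add_C, Finset.sum_const, Finset.card_range, smul_eq_mul,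
    mul_one]

lemma monic_indicialPoly (hk : 1 ≤ k) : (indicialPoly k).Monic :=
  (monic_rising k).sub_of_left (by
    refine Polynomial.degree_C_le.trans_lt ?_
    rw [← Polynomial.natDegree_pos_iff_degree_pos, natDegree_rising]; omega)

lemma natDegree_indicialPoly (k : ℕ) : (indicialPoly k).natDegree = k := by
  rw [indicialPoly, Polynomial.natDegree_sub_C, natDegree_rising]

lemma indicialPoly_ne_zero (hk : 1 ≤ k) : indicialPoly k ≠ 0 := (monic_indicialPoly hk).ne_zero

lemma eval_indicialPoly_eq (k : ℕ) (z : ℂ) :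
    (indicialPoly k).eval z = ∏ j ∈ Finset.range k, (z + j) - (k + 1).factorial := by
  simp [indicialPoly, eval_rising]

lemma eval_indicialPoly_eq_zero_iff {z : ℂ} :
    (indicialPoly k).eval z = 0 ↔ ∏ j ∈ Finset.range k, (z + j) = (k + 1).factorial := by
  rw [eval_indicialPoly_eq, sub_eq_zero]

lemma prod_range_two_add (k : ℕ) : ∏ j ∈ Finset.range k, (2 + j) = (k + 1).factorial := by
  induction k with
  | zero => simp
  | succ k ih => rw [Finset.prod_range_succ, ih, Nat.factorial_succ (k + 1)]; ring

lemma eval_indicialPoly_two (k : ℕ) : (indicialPoly k).eval 2 = 0 := by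
  rw [eval_indicialPoly_eq_zero_iff, ← prod_range_two_add]; push_cast; rfl

/-- The squared modulus of the product of the factors `z + j`. -/
lemma prod_sq_eq {z : ℂ} (h : (indicialPoly k).eval z = 0) :
    ∏ j ∈ Finset.range k, ((z.re + j) ^ 2 + z.im ^ 2) = ((k + 1).factorial : ℝ) ^ 2 := by
  rw [eval_indicialPoly_eq_zero_iff] at h
  have h1 := congrArg Complex.normSq h
  rw [map_prod, Complex.normSq_natCast] at h1
  rw [pow_two ((k + 1).factorial : ℝ), ← h1]
  refine Finset.prod_congr rfl fun j _ => ?_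
  rw [Complex.normSq_apply]; simp; ring

lemma prod_two_sq (k : ℕ) :
    ∏ j ∈ Finset.range k, ((2 : ℝ) + j) ^ 2 = ((k + 1).factorial : ℝ) ^ 2 := by
  rw [Finset.prod_pow, ← prod_range_two_add]; push_cast; rfl

/-- The product of the squared moduli is strictly increasing. -/
lemma prod_lt_prod (hk : 1 ≤ k) {x x' w w' : ℝ} (hx : 0 < x) (hxx : x ≤ x') (hw : 0 ≤ w)
    (hww : w ≤ w') (h : x < x' ∨ w < w') :
    ∏ j ∈ Finset.range k, ((x + j) ^ 2 + w) < ∏ j ∈ Finset.range k, ((x' + j) ^ 2 + w') := by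
  refine Finset.prod_lt_prod_of_nonempty (fun j _ => by positivity) (fun j _ => ?_)
    (Finset.nonempty_range_iff.mpr (by omega))
  have : (0 : ℝ) ≤ j := j.cast_nonneg
  rcases h with h | h <;> nlinarith

/-- Every zero other than `2` has real part less than `2`. -/
lemma re_lt_two (hk : 1 ≤ k) {z : ℂ} (h : (indicialPoly k).eval z = 0) (hz : z ≠ 2) :
    z.re < 2 := by
  by_contra! hre
  have h1 := prod_sq_eq h
  rw [← prod_two_sq] at h1
  have h2 := prod_lt_prod hk (x := 2) (x' := z.re) (w := 0) (w' := z.im ^ 2) (by norm_num)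
    hre le_rfl
    (sq_nonneg _) (by
      by_contra! hc
      have him : z.im = 0 := by nlinarith [hc.2]
      exact hz (Complex.ext (by simpa using le_antisymm hc.1 hre) (by simpa using him)))
  simp only [add_zero] at h2
  exact h2.ne' h1

/-- Two zeros with the same positive real part are equal or conjugate. -/
lemma eq_or_eq_conj (hk : 1 ≤ k) {z w : ℂ} (hz : (indicialPoly k).eval z = 0)
    (hw : (indicialPoly k).eval w = 0) (h : z.re = w.re) (h0 : 0 < w.re) :
    z = w ∨ z = (starRingEnd ℂ) w := by
  have h1 := prod_sq_eq hz
  rw [← prod_sq_eq hw, h] at h1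
  have h2 : z.im ^ 2 = w.im ^ 2 := by
    rcases lt_trichotomy (z.im ^ 2) (w.im ^ 2) with h3 | h3 | h3
    · exact absurd h1 (prod_lt_prod hk h0 le_rfl (sq_nonneg _) h3.le (Or.inr h3)).ne
    · exact h3
    · exact absurd h1 (prod_lt_prod hk h0 le_rfl (sq_nonneg _) h3.le (Or.inr h3)).ne'
  rcases sq_eq_sq_iff_eq_or_eq_neg.mp h2 with h3 | h3
  · exact Or.inl (Complex.ext h h3)
  · exact Or.inr (Complex.ext (by simpa using h) (by simpa using h3))

lemma eval_conj {z : ℂ} (h : (indicialPoly k).eval z = 0) :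
    (indicialPoly k).eval ((starRingEnd ℂ) z) = 0 := by
  rw [eval_indicialPoly_eq_zero_iff] at h ⊢
  have := congrArg (starRingEnd ℂ) h
  rw [map_prod] at this
  simpa using this

/-- Since k! < (k + 1)!, this excludes real zeros in [-k, 0], the range where the terms of the
logarithmic derivative can have different signs. -/
lemma prod_abs_le (k : ℕ) {x : ℝ} (h1 : -k ≤ x) (h2 : x ≤ 0) :
    ∏ j ∈ Finset.range k, |x + j| ≤ k.factorial := by
  induction k with
  | zero => simp
  | succ k ih =>
    by_cases h : -(k : ℝ) ≤ x
    · rw [Finset.prod_range_succ, Nat.factorial_succ, mul_comm]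
      push_cast
      have : |x + k| ≤ k + 1 := by rw [abs_le]; constructor <;> linarith
      exact mul_le_mul this (ih h) (Finset.prod_nonneg fun j _ => abs_nonneg _) (by positivity)
    -- Here -(k + 1) ≤ x < -k, so |x + j| ≤ k + 1 - j.
    · push Not at h
      have e : ((k + 1).factorial : ℝ) = ∏ j ∈ Finset.range (k + 1), ((k + 1 - j : ℕ) : ℝ) := by
        have : (k + 1).factorial = ∏ j ∈ Finset.range (k + 1), (k + 1 - j) := by
          rw [← Finset.prod_range_reflect, ← Finset.prod_range_add_one_eq_factorial]
          refine Finset.prod_congr rfl fun j hj => ?_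
          have := Finset.mem_range.mp hj
          omega
        rw [this]; push_cast; rfl
      rw [e]
      refine Finset.prod_le_prod (fun j _ => abs_nonneg _) fun j hj => ?_
      have hj' : j < k + 1 := Finset.mem_range.mp hj
      have hj2 : (j : ℝ) ≤ k := by exact_mod_cast (by omega : j ≤ k)
      rw [Nat.cast_sub hj'.le, abs_le]
      push_cast at h1 ⊢
      constructor <;> linarith

/-- The logarithmic derivative of the rising product does not vanish at a zero. -/
lemma sum_inv_ne_zero (hk : 1 ≤ k) {z : ℂ} (h : (indicialPoly k).eval z = 0) :
    ∑ j ∈ Finset.range k, 1 / (z + j) ≠ 0 := by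
  have hne : (Finset.range k).Nonempty := Finset.nonempty_range_iff.mpr (by omega)
  intro h0
  -- For real z all terms have the same sign when z > 0 or z < -k, and no zero lies in between. For
  -- nonreal z all imaginary parts of the terms have the sign opposite to that of Im z.
  by_cases him : z.im = 0
  · have hz : z = (z.re : ℂ) := Complex.ext rfl (by simpa using him)
    have e : (∑ j ∈ Finset.range k, 1 / (z + j)) =
        ((∑ j ∈ Finset.range k, 1 / (z.re + j) : ℝ) : ℂ) := by
      rw [hz]; push_cast; simp
    rw [e] at h0
    have h0' : ∑ j ∈ Finset.range k, 1 / (z.re + j) = 0 := by exact_mod_cast h0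
    rcases lt_or_ge 0 z.re with hpos | hneg
    · exact (Finset.sum_pos (fun j _ => by positivity) hne).ne' h0'
    · rcases lt_or_ge z.re (-k) with h1 | h1
      · refine (Finset.sum_neg (fun j hj => ?_) hne).ne h0'
        have : (j : ℝ) < k := by exact_mod_cast Finset.mem_range.mp hj
        exact one_div_neg.mpr (by linarith)
      · have h2 := prod_abs_le k h1 hneg
        rw [eval_indicialPoly_eq_zero_iff] at h
        have h3 := congrArg norm h
        rw [norm_prod, Complex.norm_natCast, hz] at h3
        have h4 : ∏ j ∈ Finset.range k, |z.re + j| = ((k + 1).factorial : ℝ) := by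
          rw [← h3]
          refine Finset.prod_congr rfl fun j _ => ?_
          rw [← Real.norm_eq_abs, ← Complex.norm_real]; push_cast; rfl
        rw [h4] at h2
        have h5 : (k + 1).factorial ≤ k.factorial := by exact_mod_cast h2
        have := Nat.factorial_lt_of_lt (n := k) (m := k + 1) (by omega) (by omega)
        omega
  · have h1 := congrArg Complex.im h0
    rw [Complex.im_sum, Complex.zero_im] at h1
    have h2 : ∀ j : ℕ, (1 / (z + j)).im = -z.im * (1 / Complex.normSq (z + j)) := fun j => by
      rw [one_div, Complex.inv_im]; simp; ring
    simp only [h2] at h1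
    rw [← Finset.mul_sum, mul_eq_zero, neg_eq_zero] at h1
    refine (Finset.sum_pos (fun j _ => ?_) hne).ne' (h1.resolve_left him)
    refine one_div_pos.mpr (Complex.normSq_pos.mpr fun h => him ?_)
    simpa using congrArg Complex.im h

lemma add_natCast_ne_zero_of_zero {z : ℂ} (h : (indicialPoly k).eval z = 0) {j : ℕ} (hj : j < k) :
    z + j ≠ 0 := by
  rw [eval_indicialPoly_eq_zero_iff] at h
  intro h0
  rw [Finset.prod_eq_zero (Finset.mem_range.mpr hj) h0] at h
  exact Nat.factorial_ne_zero (k + 1) (by exact_mod_cast h.symm)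

lemma eval_derivative_indicialPoly {z : ℂ} (hz : ∀ j < k, z + j ≠ 0) :
    (indicialPoly k).derivative.eval z =
      (∏ j ∈ Finset.range k, (z + j)) * ∑ j ∈ Finset.range k, 1 / (z + j) := by
  rw [indicialPoly, Polynomial.derivative_sub, Polynomial.derivative_C, sub_zero, rising,
    Polynomial.derivative_prod_finset, Polynomial.eval_finsetSum, Finset.mul_sum]
  refine Finset.sum_congr rfl fun j hj => ?_
  rw [← Finset.mul_prod_erase _ _ hj, Polynomial.derivative_X_add_C, mul_one,
    Polynomial.eval_prod]
  have := hz j (Finset.mem_range.mp hj)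
  simp only [Polynomial.eval_add, Polynomial.eval_X, Polynomial.eval_C]
  field_simp

lemma eval_derivative_of_zero {z : ℂ} (h : (indicialPoly k).eval z = 0) :
    (indicialPoly k).derivative.eval z =
      (k + 1).factorial * ∑ j ∈ Finset.range k, 1 / (z + j) := by
  rw [eval_derivative_indicialPoly fun j hj => add_natCast_ne_zero_of_zero h hj,
    eval_indicialPoly_eq_zero_iff.mp h]

lemma eval_derivative_ne_zero (hk : 1 ≤ k) {z : ℂ} (h : (indicialPoly k).eval z = 0) :
    (indicialPoly k).derivative.eval z ≠ 0 := by
  rw [eval_derivative_of_zero h]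
  exact mul_ne_zero (by exact_mod_cast (k + 1).factorial_ne_zero) (sum_inv_ne_zero hk h)

/-- The zeros of the indicial polynomial. -/
noncomputable def zeros (k : ℕ) : Finset ℂ := (indicialPoly k).roots.toFinset

lemma mem_zeros (hk : 1 ≤ k) {z : ℂ} : z ∈ zeros k ↔ (indicialPoly k).eval z = 0 := by
  rw [zeros, Multiset.mem_toFinset, Polynomial.mem_roots (indicialPoly_ne_zero hk),
    Polynomial.IsRoot.def]

lemma nodup_roots (hk : 1 ≤ k) : (indicialPoly k).roots.Nodup := by
  rw [Multiset.nodup_iff_count_le_one]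
  intro z
  rw [Polynomial.count_roots]
  by_contra! h
  have h1 := Polynomial.one_lt_rootMultiplicity_iff_isRoot (indicialPoly_ne_zero hk) |>.mp h
  exact eval_derivative_ne_zero hk h1.1 h1.2

lemma card_zeros (hk : 1 ≤ k) : (zeros k).card = k := by
  rw [zeros, Multiset.toFinset_card_of_nodup (nodup_roots hk),
    ← (IsAlgClosed.splits (indicialPoly k)).natDegree_eq_card_roots, natDegree_indicialPoly]

lemma indicialPoly_eq_prod (hk : 1 ≤ k) :
    indicialPoly k = ∏ z ∈ zeros k, (Polynomial.X - Polynomial.C z) := by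
  have h := (IsAlgClosed.splits (indicialPoly k)).eq_prod_roots
  rw [(monic_indicialPoly hk).leadingCoeff, map_one, one_mul] at h
  rw [h, zeros, Finset.prod_eq_multiset_prod, Multiset.toFinset_val, (nodup_roots hk).dedup, ← h]

end zeros

section location

variable {k : ℕ}

lemma arg_eq_arctan {z : ℂ} (hz : 0 < z.re) : z.arg = Real.arctan (z.im / z.re) := by
  rw [← Complex.tan_arg, Real.arctan_tan]
  · have := Complex.abs_arg_lt_pi_div_two_iff.mpr (Or.inl hz)
    exact (abs_lt.mp this).1
  · have := Complex.abs_arg_lt_pi_div_two_iff.mpr (Or.inl hz)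
    exact (abs_lt.mp this).2

/-- The product of the factors in polar coordinates. -/
lemma prod_eq_polar {x y : ℝ} (hx : 0 < x) (k : ℕ) :
    ∏ j ∈ Finset.range k, ((⟨x, y⟩ : ℂ) + j) =
      (∏ j ∈ Finset.range k, ‖(⟨x, y⟩ : ℂ) + j‖ : ℝ) *
        Complex.exp ((∑ j ∈ Finset.range k, Real.arctan (y / (x + j)) : ℝ) * Complex.I) := by
  rw [Complex.ofReal_sum, Finset.sum_mul, Complex.exp_sum, Complex.ofReal_prod,
    ← Finset.prod_mul_distrib]
  refine Finset.prod_congr rfl fun j _ => ?_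
  have h1 : ((⟨x, y⟩ : ℂ) + j).re = x + j := by simp
  have h2 : ((⟨x, y⟩ : ℂ) + j).im = y := by simp
  have h3 := arg_eq_arctan (z := (⟨x, y⟩ : ℂ) + j) (by rw [h1]; positivity)
  rw [h1, h2] at h3
  rw [← h3, Complex.norm_mul_exp_arg_mul_I]

lemma prod_norm_sq {x y : ℝ} (k : ℕ) :
    (∏ j ∈ Finset.range k, ‖(⟨x, y⟩ : ℂ) + j‖) ^ 2 =
      ∏ j ∈ Finset.range k, ((x + j) ^ 2 + y ^ 2) := by
  rw [← Finset.prod_pow]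
  refine Finset.prod_congr rfl fun j _ => ?_
  rw [Complex.sq_norm, Complex.normSq_apply]; simp; ring

/-- The product equals its own modulus (k + 1)!, so its total argument is a multiple of 2π, and it
is positive. -/
lemma sum_arctan_two_pi_le {x y : ℝ} (hk : 1 ≤ k) (hx : 0 < x) (hy : 0 < y)
    (h : (indicialPoly k).eval ⟨x, y⟩ = 0) :
    2 * Real.pi ≤ ∑ j ∈ Finset.range k, Real.arctan (y / (x + j)) := by
  have h1 := eval_indicialPoly_eq_zero_iff.mp h
  have h2 := prod_norm_sq (x := x) (y := y) k
  rw [prod_sq_eq (z := ⟨x, y⟩) h] at h2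
  have h3 := (sq_eq_sq₀ (Finset.prod_nonneg fun j _ => norm_nonneg _) (by positivity)).mp h2
  rw [prod_eq_polar hx, h3] at h1
  have hf : ((k + 1).factorial : ℂ) ≠ 0 := by exact_mod_cast (k + 1).factorial_ne_zero
  rw [Complex.ofReal_natCast] at h1
  have h4 := mul_left_cancel₀ hf (h1.trans (mul_one _).symm)
  rw [Complex.exp_eq_one_iff] at h4
  obtain ⟨n, hn⟩ := h4
  have hI := Complex.I_ne_zero
  have h5 : ((∑ j ∈ Finset.range k, Real.arctan (y / (x + j)) : ℝ) : ℂ) = n * (2 * Real.pi) :=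
    mul_right_cancel₀ hI (by rw [hn]; ring)
  have h6 : ∑ j ∈ Finset.range k, Real.arctan (y / (x + j)) = n * (2 * Real.pi) := by
    exact_mod_cast h5
  have h7 : 0 < ∑ j ∈ Finset.range k, Real.arctan (y / (x + j)) :=
    Finset.sum_pos (fun j _ => Real.arctan_pos.mpr (by positivity))
      (Finset.nonempty_range_iff.mpr (by omega))
  rw [h6] at h7 ⊢
  have hpi := Real.pi_pos
  have hn0 : 0 < n := by
    by_contra! hn0
    have : (n : ℝ) ≤ 0 := by exact_mod_cast hn0
    nlinarith
  have hn1 : (1 : ℝ) ≤ n := by exact_mod_cast hn0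
  nlinarith

lemma arctan_step {T c a b a' : ℝ} (ha : T = c + Real.arctan a) (hab : a * b < 1)
    (h : (a + b) / (1 - a * b) = a') : T + Real.arctan b = c + Real.arctan a' := by
  rw [ha, add_assoc, Real.arctan_add hab, h]

lemma arctan_step_pi {T c a b a' : ℝ} (ha : T = c + Real.arctan a) (h0 : 0 < a)
    (hab : 1 < a * b) (h : (a + b) / (1 - a * b) = a') :
    T + Real.arctan b = c + Real.pi + Real.arctan a' := by
  rw [ha, add_assoc, Real.arctan_add_eq_add_pi hab h0, h]; ring

/-- The tangent addition formula keeps each partial sum as a multiple of π plus the arctangent of a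
rational number; π is added when the product of the tangents exceeds 1, at the second and the
seventh term. With ordinate 11/4 the value 2π is passed exactly between 12 and 13 terms. -/
lemma sum_arctan_bounds :
    ∑ j ∈ Finset.range 12, Real.arctan (11 / 4 / (1 + j)) < 2 * Real.pi ∧
      2 * Real.pi < ∑ j ∈ Finset.range 13, Real.arctan (11 / 4 / (1 + j)) := by
  have t1 : ∑ j ∈ Finset.range 1, Real.arctan (11 / 4 / (1 + j)) =
      0 + Real.arctan (11 / 4) := by simp
  have t2 : ∑ j ∈ Finset.range 2, Real.arctan (11 / 4 / (1 + j)) =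
      0 + Real.pi + Real.arctan (-132/89) := by
    rw [Finset.sum_range_succ]
    exact arctan_step_pi t1 (by norm_num) (by norm_num) (by norm_num)
  have t3 : ∑ j ∈ Finset.range 3, Real.arctan (11 / 4 / (1 + j)) =
      0 + Real.pi + Real.arctan (-121/504) := by
    rw [Finset.sum_range_succ]
    exact arctan_step t2 (by norm_num) (by norm_num)
  have t4 : ∑ j ∈ Finset.range 4, Real.arctan (11 / 4 / (1 + j)) =
      0 + Real.pi + Real.arctan (3608/9395) := by
    rw [Finset.sum_range_succ]
    exact arctan_step t3 (by norm_num) (by norm_num)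
  have t5 : ∑ j ∈ Finset.range 5, Real.arctan (11 / 4 / (1 + j)) =
      0 + Real.pi + Real.arctan (175505/148212) := by
    rw [Finset.sum_range_succ]
    exact arctan_step t4 (by norm_num) (by norm_num)
  have t6 : ∑ j ∈ Finset.range 6, Real.arctan (11 / 4 / (1 + j)) =
      0 + Real.pi + Real.arctan (5842452/1626533) := by
    rw [Finset.sum_range_succ]
    exact arctan_step t5 (by norm_num) (by norm_num)
  have t7 : ∑ j ∈ Finset.range 7, Real.arctan (11 / 4 / (1 + j)) =
      0 + Real.pi + Real.pi + Real.arctan (-181480519/18724048) := by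
    rw [Finset.sum_range_succ]
    exact arctan_step_pi t6 (by norm_num) (by norm_num) (by norm_num)
  have t8 : ∑ j ∈ Finset.range 8, Real.arctan (11 / 4 / (1 + j)) =
      0 + Real.pi + Real.pi + Real.arctan (-1120282416/519091049) := by
    rw [Finset.sum_range_succ]
    exact arctan_step t7 (by norm_num) (by norm_num)
  have t9 : ∑ j ∈ Finset.range 9, Real.arctan (11 / 4 / (1 + j)) =
      0 + Real.pi + Real.pi + Real.arctan (-2663089649/2385414180) := by
    rw [Finset.sum_range_succ]
    exact arctan_step t8 (by norm_num) (by norm_num)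
  have t10 : ∑ j ∈ Finset.range 10, Real.arctan (11 / 4 / (1 + j)) =
      0 + Real.pi + Real.pi + Real.arctan (-80284029980/124710553339) := by
    rw [Finset.sum_range_succ]
    exact arctan_step t9 (by norm_num) (by norm_num)
  have t11 : ∑ j ∈ Finset.range 11, Real.arctan (11 / 4 / (1 + j)) =
      0 + Real.pi + Real.pi + Real.arctan (-11554445093/34066249608) := by
    rw [Finset.sum_range_succ]
    exact arctan_step t10 (by norm_num) (by norm_num)
  have t12 : ∑ j ∈ Finset.range 12, Real.arctan (11 / 4 / (1 + j)) =
      0 + Real.pi + Real.pi + Real.arctan (-179884618776/1762278877207) := by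
    rw [Finset.sum_range_succ]
    exact arctan_step t11 (by norm_num) (by norm_num)
  have t13 : ∑ j ∈ Finset.range 13, Real.arctan (11 / 4 / (1 + j)) =
      0 + Real.pi + Real.pi + Real.arctan (401242698917/3744689296852) := by
    rw [Finset.sum_range_succ]
    exact arctan_step t12 (by norm_num) (by norm_num)
  have h1 : Real.arctan (-179884618776/1762278877207) < 0 := Real.arctan_lt_zero.mpr (by norm_num)
  have h2 : 0 < Real.arctan (401242698917/3744689296852) := Real.arctan_pos.mpr (by norm_num)
  rw [t12, t13]
  constructor <;> linarith

/-- The product increases with y, and at y = 11/4 it already exceeds the bound for each of the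
finitely many k. -/
lemma sq_lt_of_prod_le {k : ℕ} {y : ℝ} (h2 : 2 ≤ k) (hk : k ≤ 12)
    (h : ∏ j ∈ Finset.range k, (((1 : ℝ) + j) ^ 2 + y ^ 2) ≤ ((k + 1).factorial : ℝ) ^ 2) :
    y < 11 / 4 := by
  by_contra! hy'
  have h3 : ∏ j ∈ Finset.range k, (((1 : ℝ) + j) ^ 2 + (11 / 4) ^ 2) ≤
      ∏ j ∈ Finset.range k, (((1 : ℝ) + j) ^ 2 + y ^ 2) :=
    Finset.prod_le_prod (fun j _ => by positivity) fun j _ => by gcongr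
  have h4 := h3.trans h
  interval_cases k <;> norm_num [Finset.prod_range_succ, Nat.factorial] at h4

/-- For at most `12` keys per node all zeros other than `2` have real part less than `1`. -/
lemma re_lt_one {k : ℕ} (h2 : 2 ≤ k) (hk : k ≤ 12) {z : ℂ} (h : (indicialPoly k).eval z = 0)
    (hz : z ≠ 2) : z.re < 1 := by
  -- If Re w ≥ 1, the modulus forces Im w < 11/4. Each arctangent grows with Im w and decreases with
  -- Re w, so the total argument stays below 2π, which a zero does not allow.
  have main : ∀ w : ℂ, (indicialPoly k).eval w = 0 → 0 < w.im → w.re < 1 := by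
    intro w hw him
    by_contra! hre
    have e1 := prod_sq_eq hw
    have e2 : ∏ j ∈ Finset.range k, (((1 : ℝ) + j) ^ 2 + w.im ^ 2) ≤
        ∏ j ∈ Finset.range k, ((w.re + j) ^ 2 + w.im ^ 2) :=
      Finset.prod_le_prod (fun j _ => by positivity) fun j _ => by gcongr
    have e3 := sq_lt_of_prod_le h2 hk (e2.trans e1.le)
    have e4 := sum_arctan_two_pi_le (by omega) (by linarith) him hw
    have e5 : ∑ j ∈ Finset.range k, Real.arctan (w.im / (w.re + j)) ≤
        ∑ j ∈ Finset.range k, Real.arctan (11 / 4 / (1 + j)) := by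
      refine Finset.sum_le_sum fun j _ => Real.arctan_mono ?_
      gcongr
    have e6 : ∑ j ∈ Finset.range k, Real.arctan (11 / 4 / (1 + j)) ≤
        ∑ j ∈ Finset.range 12, Real.arctan (11 / 4 / (1 + j)) := by
      refine Finset.sum_le_sum_of_subset_of_nonneg (by simpa using hk) fun j _ _ => ?_
      exact (Real.arctan_pos.mpr (by positivity)).le
    linarith [sum_arctan_bounds.1]
  rcases lt_trichotomy z.im 0 with him | him | him
  · have := main ((starRingEnd ℂ) z) (eval_conj h) (by simpa using him)
    simpa using this
  -- A real zero in [1, 2) is impossible, since the product is increasing there and reaches (k + 1)!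
  -- only at 2.
  · by_contra! hre
    have h0 := re_lt_two (by omega) h hz
    have h1 := prod_sq_eq h
    rw [← prod_two_sq, him] at h1
    have := prod_lt_prod (k := k) (x := z.re) (x' := 2) (w := 0) (w' := 0) (by omega) (by linarith)
      h0.le le_rfl le_rfl (Or.inl h0)
    simp only [add_zero] at this
    simp only [ne_eq, OfNat.ofNat_ne_zero, not_false_eq_true, zero_pow, add_zero] at h1
    exact this.ne h1
  · exact main z h him

end location

end MarySearch

/-! ### Existence of the second zero for at least 13 keys per node -/

namespace MarySearch

open Topology

variable {k : ℕ}

/-- The product of the squared moduli of the factors, as a function of the real part and of the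
squared imaginary part. -/
noncomputable def sqProd (k : ℕ) (x w : ℝ) : ℝ := ∏ j ∈ Finset.range k, ((x + j) ^ 2 + w)

lemma continuous_sqProd (k : ℕ) (w : ℝ) : Continuous fun x => sqProd k x w := by
  unfold sqProd; fun_prop

/-- At w = 0 the product is too small because x ≤ 2. At w = c the factor j = 0 alone reaches c and
the other factors are at least 1. -/
lemma exists_sqProd_eq (hk : 1 ≤ k) {x : ℝ} (h1 : 1 ≤ x) (h2 : x ≤ 2) :
    ∃ w, 0 ≤ w ∧ sqProd k x w = ((k + 1).factorial : ℝ) ^ 2 := by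
  set c := ((k + 1).factorial : ℝ) ^ 2 with hc
  have hc0 : 0 ≤ c := by positivity
  have e0 : sqProd k x 0 ≤ c := by
    rw [hc, ← prod_two_sq]
    refine Finset.prod_le_prod (fun j _ => by positivity) fun j _ => ?_
    rw [add_zero]; gcongr
  have e1 : c ≤ sqProd k x c := by
    have h0 : (0 : ℕ) ∈ Finset.range k := Finset.mem_range.mpr (by omega)
    rw [sqProd, ← Finset.mul_prod_erase _ _ h0]
    have h3 : (1 : ℝ) ≤ ∏ j ∈ (Finset.range k).erase 0, ((x + j) ^ 2 + c) := by
      refine Finset.one_le_prod fun j _ => ?_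
      have : (0 : ℝ) ≤ j := j.cast_nonneg
      nlinarith
    have h4 : c ≤ (x + (0 : ℕ)) ^ 2 + c := le_add_of_nonneg_left (sq_nonneg _)
    nlinarith
  have hcont : ContinuousOn (fun w => sqProd k x w) (Set.Icc 0 c) := by
    unfold sqProd; fun_prop
  obtain ⟨w, hw, h⟩ := intermediate_value_Icc hc0 hcont ⟨e0, e1⟩
  exact ⟨w, hw.1, h⟩

lemma sqProd_lt (hk : 1 ≤ k) {x w w' : ℝ} (hx : 0 < x) (hw : 0 ≤ w) (h : w < w') :
    sqProd k x w < sqProd k x w' := prod_lt_prod hk hx le_rfl hw h.le (Or.inr h)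

lemma lt_of_sqProd_lt (hk : 1 ≤ k) {x w w' : ℝ} (hx : 0 < x) (hw' : 0 ≤ w')
    (h : sqProd k x w < sqProd k x w') : w < w' := by
  by_contra! hc
  rcases hc.eq_or_lt with rfl | hc
  · exact lt_irrefl _ h
  · exact lt_asymm h (sqProd_lt hk hx hw' hc)

lemma sqProd_one_le (hk : 13 ≤ k) : sqProd k 1 ((11 / 4) ^ 2) ≤ ((k + 1).factorial : ℝ) ^ 2 := by
  induction k, hk using Nat.le_induction with
  | base => norm_num [sqProd, Finset.prod_range_succ, Nat.factorial]
  | succ k hk ih =>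
    rw [sqProd, Finset.prod_range_succ, ← sqProd, Nat.factorial_succ (k + 1)]
    push_cast
    rw [mul_pow, mul_comm]
    have hk' : (13 : ℝ) ≤ k := by exact_mod_cast hk
    refine mul_le_mul (by nlinarith) ih ?_ (by positivity)
    exact Finset.prod_nonneg fun j _ => by positivity

/-- For at least `13` keys per node there is a zero other than `2` with real part larger than
`1`. -/
lemma exists_zero_one_lt_re (hk : 13 ≤ k) :
    ∃ z : ℂ, (indicialPoly k).eval z = 0 ∧ 1 < z.re ∧ z ≠ 2 := by
  have hk1 : 1 ≤ k := by omega
  -- The function w parametrizes the curve on which the product has modulus (k + 1)!; outside [1, 2]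
  -- its value is irrelevant.
  have hex : ∀ x : ℝ, ∃ w, x ∈ Set.Icc (1 : ℝ) 2 →
      0 ≤ w ∧ sqProd k x w = ((k + 1).factorial : ℝ) ^ 2 := by
    intro x
    by_cases hx : x ∈ Set.Icc (1 : ℝ) 2
    · obtain ⟨w, hw⟩ := exists_sqProd_eq hk1 hx.1 hx.2
      exact ⟨w, fun _ => hw⟩
    · exact ⟨0, fun h => absurd h hx⟩
  choose w hw using hex
  -- Strict monotonicity in w makes the implicit function continuous: a strict inequality for the
  -- product at x persists nearby and yields the one for w.
  have hcont : ContinuousOn w (Set.Icc 1 2) := by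
    intro x hx
    have hx0 : ∀ y ∈ Set.Icc (1 : ℝ) 2, 0 < y := fun y hy => by linarith [hy.1]
    rw [ContinuousWithinAt, tendsto_order]
    constructor
    · intro a ha
      rcases lt_or_ge a 0 with ha0 | ha0
      · filter_upwards [self_mem_nhdsWithin] with y hy
        exact ha0.trans_le (hw y hy).1
      · have h1 := sqProd_lt hk1 (hx0 x hx) ha0 ha
        rw [(hw x hx).2] at h1
        have h2 := ((continuous_sqProd k a).tendsto x).eventually (gt_mem_nhds h1)
        filter_upwards [self_mem_nhdsWithin, nhdsWithin_le_nhds h2] with y hy h3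
        rw [← (hw y hy).2] at h3
        exact lt_of_sqProd_lt hk1 (hx0 y hy) (hw y hy).1 h3
    · intro a ha
      have ha0 : 0 ≤ a := (hw x hx).1.trans ha.le
      have h1 := sqProd_lt hk1 (hx0 x hx) (hw x hx).1 ha
      rw [(hw x hx).2] at h1
      have h2 := ((continuous_sqProd k a).tendsto x).eventually (lt_mem_nhds h1)
      filter_upwards [self_mem_nhdsWithin, nhdsWithin_le_nhds h2] with y hy h3
      rw [← (hw y hy).2] at h3
      exact lt_of_sqProd_lt hk1 (hx0 y hy) ha0 h3
  -- Along the curve the total argument passes from more than 2π at x = 1 to 0 at x = 2; where it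
  -- equals 2π there is a zero of Λ.
  have hθ : ContinuousOn (fun x => ∑ j ∈ Finset.range k, Real.arctan (√(w x) / (x + j)))
      (Set.Icc 1 2) := by
    refine continuousOn_finsetSum _ fun j _ => Real.continuous_arctan.comp_continuousOn ?_
    refine ContinuousOn.div (Real.continuous_sqrt.comp_continuousOn hcont) (by fun_prop) ?_
    intro x hx
    have : (0 : ℝ) ≤ j := j.cast_nonneg
    linarith [hx.1]
  have hm1 : (1 : ℝ) ∈ Set.Icc (1 : ℝ) 2 := by norm_num
  have hm2 : (2 : ℝ) ∈ Set.Icc (1 : ℝ) 2 := by norm_num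
  have hw2 : w 2 = 0 := by
    refine le_antisymm ?_ (hw 2 hm2).1
    by_contra! h
    have h1 := sqProd_lt hk1 (x := 2) two_pos le_rfl h
    rw [(hw 2 hm2).2, ← prod_two_sq, sqProd] at h1
    simp at h1
  have hw1 : (11 / 4) ^ 2 ≤ w 1 := by
    by_contra! h
    have h1 := sqProd_lt hk1 (x := 1) one_pos (hw 1 hm1).1 h
    rw [(hw 1 hm1).2] at h1
    linarith [sqProd_one_le hk]
  have hpi := Real.pi_pos
  have hθ2 : ∑ j ∈ Finset.range k, Real.arctan (√(w 2) / (2 + j)) ≤ 2 * Real.pi := by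
    rw [hw2]; simp; positivity
  have hθ1 : 2 * Real.pi < ∑ j ∈ Finset.range k, Real.arctan (√(w 1) / (1 + j)) := by
    refine sum_arctan_bounds.2.trans_le ?_
    refine le_trans (Finset.sum_le_sum_of_subset_of_nonneg
      (Finset.range_subset_range.mpr hk) fun j _ _ => ?_) (Finset.sum_le_sum fun j _ =>
        Real.arctan_mono ?_)
    · exact (Real.arctan_pos.mpr (by positivity)).le
    · have : 11 / 4 ≤ √(w 1) := Real.le_sqrt_of_sq_le hw1
      gcongr
  obtain ⟨x, hx, hθx⟩ := intermediate_value_Icc' (by norm_num : (1 : ℝ) ≤ 2) hθ ⟨hθ2, hθ1.le⟩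
  simp only at hθx
  have hx0 : 0 < x := by linarith [hx.1]
  have hx1 : x ≠ 1 := by rintro rfl; linarith
  have hx2 : x ≠ 2 := by
    rintro rfl
    rw [hw2] at hθx
    simp at hθx
  refine ⟨⟨x, √(w x)⟩, ?_, lt_of_le_of_ne hx.1 hx1.symm, fun h => hx2 ?_⟩
  · rw [eval_indicialPoly_eq_zero_iff, prod_eq_polar hx0, hθx]
    have h1 := prod_norm_sq (x := x) (y := √(w x)) k
    have h2 := (hw x hx).2
    rw [Real.sq_sqrt (hw x hx).1, ← sqProd, h2] at h1
    rw [(sq_eq_sq₀ (Finset.prod_nonneg fun j _ => norm_nonneg _) (by positivity)).mp h1]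
    have : ((2 * Real.pi : ℝ) : ℂ) * Complex.I = 2 * Real.pi * Complex.I := by push_cast; ring
    rw [this, Complex.exp_two_pi_mul_I, mul_one]; push_cast; rfl
  · simpa using congrArg Complex.re h

/-- Among the finitely many zeros other than 2, one of maximal real part is taken. That real part
lies in (1, 2), where no real zero exists, so conjugation makes the imaginary part positive if
necessary. -/
lemma exists_isSecondZero (hk : 13 ≤ k) :
    ∃ α β : ℝ, IsSecondZero (k + 1) ((α : ℂ) + (β : ℂ) * Complex.I) := by
  have hk1 : 1 ≤ k := by omega
  obtain ⟨z₀, hz₀, hre₀, hne₀⟩ := exists_zero_one_lt_re hk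
  obtain ⟨z, hz, hmax⟩ := Finset.exists_max_image ((zeros k).erase 2) Complex.re
    ⟨z₀, Finset.mem_erase.mpr ⟨hne₀, (mem_zeros hk1).mpr hz₀⟩⟩
  have hz0 : (indicialPoly k).eval z = 0 := (mem_zeros hk1).mp (Finset.mem_of_mem_erase hz)
  have hz2 : z ≠ 2 := Finset.ne_of_mem_erase hz
  have hre := hre₀.trans_le (hmax z₀ (Finset.mem_erase.mpr ⟨hne₀, (mem_zeros hk1).mpr hz₀⟩))
  have him : z.im ≠ 0 := by
    intro him
    have h0 := re_lt_two hk1 hz0 hz2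
    have h1 := prod_sq_eq hz0
    rw [← prod_two_sq, him] at h1
    have := prod_lt_prod (k := k) (x := z.re) (x' := 2) (w := 0) (w' := 0) hk1 (by linarith)
      h0.le le_rfl le_rfl (Or.inl h0)
    simp only [add_zero] at this
    simp only [ne_eq, OfNat.ofNat_ne_zero, not_false_eq_true, zero_pow, add_zero] at h1
    exact this.ne h1
  have main : ∀ w : ℂ, (indicialPoly k).eval w = 0 → w.re = z.re → 0 < w.im →
      IsSecondZero (k + 1) ((w.re : ℂ) + (w.im : ℂ) * Complex.I) := by
    intro w hw hwz hwim
    rw [Complex.re_add_im]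
    refine ⟨by rw [← eval_indicialPoly, hw], hwim, 2, by rw [← eval_indicialPoly,
      eval_indicialPoly_two], ?_, fun v hv hv2 => ?_⟩
    · rw [hwz]; simpa using re_lt_two hk1 hz0 hz2
    · rw [← eval_indicialPoly] at hv
      rw [hwz]
      exact hmax v (Finset.mem_erase.mpr ⟨hv2, (mem_zeros hk1).mpr hv⟩)
  rcases lt_or_gt_of_ne him with h | h
  · exact ⟨_, _, main ((starRingEnd ℂ) z) (eval_conj hz0) (by simp) (by simpa using h)⟩
  · exact ⟨_, _, main z hz0 rfl h⟩

/-- The properties of a zero with the second largest real part. -/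
lemma IsSecondZero.spec (hk : 13 ≤ k) {l : ℂ} (h : IsSecondZero (k + 1) l) :
    (indicialPoly k).eval l = 0 ∧ 0 < l.im ∧ 1 < l.re ∧ l.re < 2 ∧
      ∀ z : ℂ, (indicialPoly k).eval z = 0 → z ≠ 2 → z ≠ l → z ≠ (starRingEnd ℂ) l →
        z.re < l.re := by
  have hk1 : 1 ≤ k := by omega
  obtain ⟨h1, h2, r, hr, hlr, hmax⟩ := h
  simp only [← eval_indicialPoly] at h1 hr hmax
  have hr2 : r = 2 := by
    by_contra hne
    have h3 := hmax 2 (eval_indicialPoly_two k) (Ne.symm hne)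
    have h4 := re_lt_two hk1 hr hne
    simp at h3
    linarith
  subst hr2
  have hl2 : l ≠ 2 := by rintro rfl; simp at h2
  obtain ⟨z₀, hz₀, hre₀, hne₀⟩ := exists_zero_one_lt_re hk
  have hre := hre₀.trans_le (hmax z₀ hz₀ hne₀)
  refine ⟨h1, h2, hre, re_lt_two hk1 h1 hl2, fun z hz hz2 hzl hzl' => ?_⟩
  refine lt_of_le_of_ne (hmax z hz hz2) fun he => ?_
  rcases eq_or_eq_conj hk1 hz h1 he (by linarith) with h | h
  · exact hzl h
  · exact hzl' h

end MarySearch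

/-! ### Exact mean of the corrected space requirement -/

namespace MarySearch

open PowerSeries

variable {k : ℕ}

/-- The zeros of the indicial polynomial other than `2`. -/
noncomputable def others (k : ℕ) : Finset ℂ := (zeros k).erase 2

lemma mem_others (hk : 1 ≤ k) {z : ℂ} : z ∈ others k ↔ z ≠ 2 ∧ (indicialPoly k).eval z = 0 := by
  rw [others, Finset.mem_erase, mem_zeros hk]

lemma eval_indicialPoly_zero (hk : 1 ≤ k) :
    (indicialPoly k).eval 0 = -((k + 1).factorial : ℂ) := by
  rw [eval_indicialPoly_eq, Finset.prod_eq_zero (Finset.mem_range.mpr (by omega : 0 < k)) (by simp),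
    zero_sub]

lemma eval_rising_one (n : ℕ) : (rising n).eval 1 = (n.factorial : ℂ) := by
  rw [eval_rising, ← Finset.prod_range_add_one_eq_factorial]
  push_cast
  exact Finset.prod_congr rfl fun j _ => by ring

lemma eval_indicialPoly_one (k : ℕ) : (indicialPoly k).eval 1 = -((k : ℂ) * k.factorial) := by
  rw [indicialPoly, Polynomial.eval_sub, eval_rising_one, Polynomial.eval_C, Nat.factorial_succ]
  push_cast; ring

lemma ne_zero_of_zero (hk : 1 ≤ k) {z : ℂ} (h : (indicialPoly k).eval z = 0) : z ≠ 0 := by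
  rintro rfl
  rw [eval_indicialPoly_zero hk, neg_eq_zero] at h
  exact (k + 1).factorial_ne_zero (by exact_mod_cast h)

lemma ne_one_of_zero (hk : 1 ≤ k) {z : ℂ} (h : (indicialPoly k).eval z = 0) : z ≠ 1 := by
  rintro rfl
  rw [eval_indicialPoly_one, neg_eq_zero] at h
  have : k * k.factorial = 0 := by exact_mod_cast h
  rcases Nat.mul_eq_zero.mp this with h | h
  · omega
  · exact k.factorial_ne_zero h

lemma coeffA_eq {z : ℂ} (h : (indicialPoly k).eval z = 0) :
    coeffA (k + 1) z = (k + 1).factorial / (z * (z - 1) * (indicialPoly k).derivative.eval z) := by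
  have hf : ((k + 1).factorial : ℂ) ≠ 0 := by exact_mod_cast (k + 1).factorial_ne_zero
  rw [coeffA, eval_derivative_of_zero h, Nat.add_sub_cancel,
    Finset.sum_congr rfl fun (j : ℕ) _ => (show 1 / ((j : ℂ) + z) = 1 / (z + j) by rw [add_comm]),
    mul_left_comm, div_mul_cancel_left₀ hf, one_div]

lemma sum_one_div_two_add (k : ℕ) :
    ∑ j ∈ Finset.range k, 1 / ((2 : ℂ) + j) = (harmonic (k + 1) : ℂ) - 1 := by
  induction k with
  | zero => simp
  | succ k ih =>
    rw [Finset.sum_range_succ, ih, harmonic_succ (k + 1)]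
    push_cast
    ring

lemma coeffA_two (k : ℕ) : coeffA (k + 1) 2 = occ k := by
  rw [coeffA, occ, occupancy, Nat.add_sub_cancel,
    Finset.sum_congr rfl fun (j : ℕ) _ => (show 1 / ((j : ℂ) + 2) = 1 / (2 + j) by rw [add_comm]),
    sum_one_div_two_add]
  push_cast
  norm_num

lemma prod_X_sub_C_erase (hk : 1 ≤ k) {z : ℂ} (hz : z ∈ zeros k) :
    ∏ w ∈ (zeros k).erase z, (z - w) = (indicialPoly k).derivative.eval z := by
  have h := Lagrange.eval_nodal_derivative_eval_node_eq (v := id) (s := zeros k) hz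
  have h2 : Lagrange.nodal (zeros k) id = indicialPoly k := by
    rw [indicialPoly_eq_prod hk, Lagrange.nodal_eq]; rfl
  rw [h2, id] at h
  rw [h, Lagrange.eval_nodal]; rfl

lemma prod_sub_zeros (hk : 1 ≤ k) (z : ℂ) :
    ∏ w ∈ zeros k, (z - w) = (indicialPoly k).eval z := by
  conv_rhs => rw [indicialPoly_eq_prod hk]
  simp [Polynomial.eval_prod]

/-- The sum over all zeros, from the vanishing of the sum of all residues. -/
lemma sum_coeffA_mul_coeff (hk : 1 ≤ k) {n : ℕ} (hn : n ≤ k) :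
    ∑ z ∈ zeros k, coeffA (k + 1) z * coeff n (negPow z) =
      (k + 1) / k - if n = 0 then 1 else 0 := by
  have hf : ((k + 1).factorial : ℂ) ≠ 0 := by exact_mod_cast (k + 1).factorial_ne_zero
  have hfk : (k.factorial : ℂ) ≠ 0 := by exact_mod_cast k.factorial_ne_zero
  have hfn : (n.factorial : ℂ) ≠ 0 := by exact_mod_cast n.factorial_ne_zero
  have hk0 : (k : ℂ) ≠ 0 := by exact_mod_cast (by omega : k ≠ 0)
  have h0 : (0 : ℂ) ∉ zeros k := fun h => ne_zero_of_zero hk ((mem_zeros hk).mp h) rfl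
  have h1 : (1 : ℂ) ∉ zeros k := fun h => ne_one_of_zero hk ((mem_zeros hk).mp h) rfl
  have h01 : (0 : ℂ) ∉ insert (1 : ℂ) (zeros k) := by
    rw [Finset.mem_insert]; rintro (h | h); exacts [zero_ne_one h, h0 h]
  have hcard : (insert (0 : ℂ) (insert 1 (zeros k))).card = k + 2 := by
    rw [Finset.card_insert_of_notMem h01, Finset.card_insert_of_notMem h1, card_zeros hk]
  -- The residues of z(z + 1)⋯(z + n - 1) / (z (z - 1) Λ(z)) sum to 0: the nodes are the k + 2
  -- poles, and the coefficient of degree k + 1 vanishes because n ≤ k. The pole 1 gives (k + 1)/k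
  -- up to scaling, and the pole 0 contributes only for n = 0.
  have key := Lagrange.coeff_eq_sum (s := insert (0 : ℂ) (insert 1 (zeros k))) (v := id)
    (Function.injective_id.injOn) (P := rising n) (by
      rw [hcard, Polynomial.degree_eq_natDegree (monic_rising n).ne_zero, natDegree_rising]
      exact_mod_cast (by omega : n < k + 2))
  rw [hcard, Polynomial.coeff_eq_zero_of_natDegree_lt (by rw [natDegree_rising]; omega),
    Finset.sum_insert h01, Finset.sum_insert h1] at key
  simp only [id] at key
  rw [Finset.erase_insert h01, Finset.prod_insert h1, prod_sub_zeros hk,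
    Finset.erase_insert_of_ne (by norm_num), Finset.erase_insert h1,
    Finset.prod_insert (by exact h0), prod_sub_zeros hk, eval_indicialPoly_zero hk,
    eval_indicialPoly_one, eval_rising_one] at key
  have e1 : ∀ z ∈ zeros k, (rising n).eval z /
      ∏ j ∈ (insert (0 : ℂ) (insert 1 (zeros k))).erase z, (z - j) =
        (n.factorial / (k + 1).factorial : ℂ) * (coeffA (k + 1) z * coeff n (negPow z)) := by
    intro z hz
    have hz' := (mem_zeros hk).mp hz
    have z0 := ne_zero_of_zero hk hz'
    have z1 := ne_one_of_zero hk hz'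
    rw [Finset.erase_insert_of_ne z0.symm, Finset.erase_insert_of_ne z1.symm,
      Finset.prod_insert (by
        rw [Finset.mem_insert]; rintro (h | h)
        exacts [zero_ne_one h, h0 (Finset.mem_of_mem_erase h)]),
      Finset.prod_insert (fun h => h1 (Finset.mem_of_mem_erase h)), prod_X_sub_C_erase hk hz,
      coeffA_eq hz', coeff_negPow_eq_div, eval_rising]
    have := eval_derivative_ne_zero hk hz'
    have := sub_ne_zero.mpr z1
    field_simp
    simp [mul_comm]
  rw [Finset.sum_congr rfl e1, ← Finset.mul_sum] at key
  have e2 : (rising n).eval (0 : ℂ) = if n = 0 then (n.factorial : ℂ) else 0 := by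
    rw [eval_rising]
    split_ifs with h
    · subst h; simp
    · exact Finset.prod_eq_zero (Finset.mem_range.mpr (Nat.pos_of_ne_zero h)) (by simp)
  rw [e2, Nat.factorial_succ] at key
  rw [Nat.factorial_succ] at hf
  push_cast at key hf
  generalize ∑ z ∈ zeros k, coeffA (k + 1) z * coeff n (negPow z) = T at key ⊢
  have hk1 : (k : ℂ) + 1 ≠ 0 := left_ne_zero_of_mul hf
  split_ifs at key ⊢ with h
  · field_simp at key ⊢
    apply mul_left_cancel₀ hfn
    linear_combination key
  · field_simp at key ⊢
    apply mul_left_cancel₀ hfn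
    linear_combination key

/-- The exact solution for the mean of the space requirement. -/
lemma spaceGf_eq (hk : 1 ≤ k) :
    spaceGf k = ∑ z ∈ others k, coeffA (k + 1) z • negPow z := by
  rw [← sub_eq_zero]
  refine eq_zero_of_op_eq_zero (indicialPoly_ne_zero hk) (fun n hn => ?_) ?_
  · rw [natDegree_indicialPoly] at hn
    have h := sum_coeffA_mul_coeff hk hn.le
    -- The summand of the zero 2 is `occ k` * (n + 1), exactly the term subtracted in `spaceStat`;
    -- hence only the other zeros remain.
    rw [← Finset.add_sum_erase _ _ ((mem_zeros hk).mpr (eval_indicialPoly_two k)), coeffA_two,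
      coeff_negPow_two, ← others] at h
    have hk0 : (k : ℂ) ≠ 0 := by exact_mod_cast (by omega : k ≠ 0)
    rw [map_sub, map_sum]
    simp only [coeff_smul, smul_eq_mul]
    rw [add_div, div_self hk0] at h
    by_cases h0 : n = 0
    · subst h0
      rw [if_pos rfl] at h
      rw [coeff_spaceGf_zero]
      push_cast at h
      linear_combination -h
    · rw [if_neg h0] at h
      rw [coeff_spaceGf_of_le h0 hn.le]
      linear_combination -h
  · rw [op_sub, op_spaceGf hk, op_sum, zero_sub, neg_eq_zero]
    refine Finset.sum_eq_zero fun z hz => ?_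
    rw [op_smul, op_negPow, ((mem_others hk).mp hz).2, zero_smul, smul_zero]

end MarySearch

/-! ### The linear regime -/

namespace MarySearch

open PowerSeries Topology

variable {k : ℕ}

/-- The indicial polynomial without the factor belonging to the zero `2`. -/
noncomputable def reducedPoly (k : ℕ) : Polynomial ℂ :=
  ∏ z ∈ others k, (Polynomial.X - Polynomial.C z)

lemma indicialPoly_eq_mul (hk : 1 ≤ k) :
    indicialPoly k = (Polynomial.X - Polynomial.C 2) * reducedPoly k := by
  conv_lhs => rw [indicialPoly_eq_prod hk,
    ← Finset.mul_prod_erase _ _ ((mem_zeros hk).mpr (eval_indicialPoly_two k))]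
  rfl

lemma monic_reducedPoly (k : ℕ) : (reducedPoly k).Monic :=
  Polynomial.monic_prod_of_monic _ _ fun z _ => Polynomial.monic_X_sub_C z

lemma natDegree_reducedPoly (hk : 1 ≤ k) : (reducedPoly k).natDegree + 1 = k := by
  have h := natDegree_indicialPoly k
  rw [indicialPoly_eq_mul hk, Polynomial.natDegree_mul (Polynomial.X_sub_C_ne_zero _)
    (monic_reducedPoly k).ne_zero, Polynomial.natDegree_X_sub_C] at h
  omega

lemma eval_reducedPoly_eq_zero {z : ℂ} : (reducedPoly k).eval z = 0 ↔ z ∈ others k := by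
  rw [reducedPoly, Polynomial.eval_prod, Finset.prod_eq_zero_iff]
  simp [sub_eq_zero]

lemma eval_derivative_eq (hk : 1 ≤ k) (z : ℂ) :
    (indicialPoly k).derivative.eval z =
      (reducedPoly k).eval z + (z - 2) * (reducedPoly k).derivative.eval z := by
  rw [indicialPoly_eq_mul hk, Polynomial.derivative_mul]
  simp

lemma eval_reducedPoly_two (hk : 1 ≤ k) :
    (reducedPoly k).eval 2 = (indicialPoly k).derivative.eval 2 := by
  rw [eval_derivative_eq hk]; ring

lemma eval_reducedPoly_two_ne_zero (hk : 1 ≤ k) : (reducedPoly k).eval 2 ≠ 0 := by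
  rw [eval_reducedPoly_two hk]
  exact eval_derivative_ne_zero hk (eval_indicialPoly_two k)

lemma occ_eq (k : ℕ) :
    2 * occ k = (k + 1).factorial / (indicialPoly k).derivative.eval 2 := by
  rw [← coeffA_two, coeffA_eq (eval_indicialPoly_two k)]
  ring

lemma op_C_two_reducedPoly (hk : 1 ≤ k) (a : ℂ⟦X⟧) :
    op (indicialPoly k) a = eulerD (op (reducedPoly k) a) - (2 : ℂ) • op (reducedPoly k) a := by
  rw [indicialPoly_eq_mul hk, op_mul, op_X_sub_C]

lemma smallO_op_reducedPoly {s : ℝ} (hs : -1 < s) (h : ∀ z ∈ others k, z.re < s + 1)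
    {a : ℂ⟦X⟧} (ha : SmallO s (op (reducedPoly k) a)) : SmallO s a :=
  smallO_of_op hs (monic_reducedPoly k).ne_zero
    (fun _ hρ => h _ (eval_reducedPoly_eq_zero.mp hρ)) ha

/-- The operator after multiplication by `1 - X`. -/
lemma op_comp_one_sub_X_mul (p : Polynomial ℂ) (a : ℂ⟦X⟧) :
    op (p.comp (Polynomial.X + Polynomial.C 1)) ((1 - X) * a) = (1 - X) * op p a := by
  rw [← negPow_neg_one, op_negPow_mul, Polynomial.comp_assoc]
  congr 2
  simp [Polynomial.C_neg]

lemma comp_X_add_C_one_ne_zero {p : Polynomial ℂ} (hp : p ≠ 0) :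
    p.comp (Polynomial.X + Polynomial.C 1) ≠ 0 := by
  intro h
  apply hp
  have := congrArg (fun q => Polynomial.comp q (Polynomial.X - Polynomial.C 1)) h
  simpa [Polynomial.comp_assoc] using this

/-- The increments of the mean key path length, and of the series derived from it, are small. -/
lemma smallO_one_sub_X_mul_op_keyGf (hk : 1 ≤ k) (p : Polynomial ℂ) {ε : ℝ} (hε : 0 < ε) :
    SmallO ε ((1 - X) * op p (keyGf k)) := by
  have hΛ := indicialPoly_ne_zero hk
  -- Multiplication by 1 - X lowers the roots of Λ and the exponents of the forcing by one, so the
  -- dominant root 2 becomes 1.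
  refine smallO_of_op (by linarith) (comp_X_add_C_one_ne_zero hΛ) (fun ρ hρ => ?_) ?_
  · rw [Polynomial.eval_comp] at hρ
    simp only [Polynomial.eval_add, Polynomial.eval_X, Polynomial.eval_C] at hρ
    by_cases h2 : ρ + 1 = 2
    · have : ρ = 1 := by linear_combination h2
      rw [this]; simpa using hε
    · have := re_lt_two hk hρ h2
      simp at this
      linarith
  · rw [op_comp_one_sub_X_mul, ← op_mul, mul_comm (indicialPoly k) p, op_mul, op_keyGf hk,
      op_smul, op_sub, op_negPow,
      op_negPow, mul_smul_comm, mul_sub, mul_smul_comm, mul_smul_comm, one_sub_X_mul_negPow,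
      one_sub_X_mul_negPow]
    refine SmallO.smul _ (SmallO.sub (SmallO.smul _ (smallO_negPow (by linarith) ?_))
      (SmallO.smul _ (smallO_negPow (by linarith) ?_)))
    · norm_num; linarith
    · norm_num; linarith

lemma smallO_keyGf (hk : 1 ≤ k) {ε : ℝ} (hε : 0 < ε) : SmallO (1 + ε) (keyGf k) := by
  refine smallO_of_op (by linarith) (indicialPoly_ne_zero hk) (fun ρ hρ => ?_) ?_
  · by_cases h2 : ρ = 2
    · rw [h2]; norm_num; linarith
    · have := re_lt_two hk hρ h2; linarith
  · rw [op_keyGf hk]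
    refine SmallO.smul _ (SmallO.sub (smallO_negPow (by linarith) ?_)
      (smallO_negPow (by linarith) ?_)) <;> norm_num <;> linarith

lemma smallO_spaceGf (hk : 1 ≤ k) {s : ℝ} (hs : -1 < s) (h : ∀ z ∈ others k, z.re < s + 1) :
    SmallO s (spaceGf k) := by
  rw [spaceGf_eq hk]
  exact SmallO.sum fun z hz => SmallO.smul _ (smallO_negPow hs (h z hz))

lemma smallO_of_eventually_zero {s : ℝ} {a : ℂ⟦X⟧} (h : ∀ᶠ n : ℕ in atTop, coeff n a = 0) :
    SmallO s a :=
  (isLittleO_zero (fun n : ℕ => (n : ℝ) ^ s) atTop (E' := ℂ)).congr'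
    (h.mono fun _ h => h.symm) EventuallyEq.rfl

/-- The part of the contribution of the root that only concerns small trees. -/
noncomputable def rootCorrection (k : ℕ) : ℂ⟦X⟧ :=
  PowerSeries.mk fun n => if n < k then ((k : ℂ) - n) * coeff n (spaceGf k) else 0

lemma rootGf_eq (hk : 1 ≤ k) : rootGf k = (∑ z ∈ others k, coeffA (k + 1) z •
    (z • negPow (z + 1) - (z + k) • negPow z)) + rootCorrection k := by
  ext n
  have h1 : coeff n (∑ z ∈ others k, coeffA (k + 1) z •
      (z • negPow (z + 1) - (z + k) • negPow z)) = ((n : ℂ) - k) * coeff n (spaceGf k) := by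
    rw [spaceGf_eq hk, map_sum, map_sum, Finset.mul_sum]
    refine Finset.sum_congr rfl fun z _ => ?_
    rw [coeff_smul, map_sub, coeff_smul, coeff_smul, coeff_smul]
    simp only [smul_eq_mul]
    rw [mul_coeff_negPow_add_one]; ring
  rw [map_add, h1, rootGf, rootCorrection, coeff_mk, coeff_mk]
  split_ifs <;> ring

lemma smallO_rootCorrection (k : ℕ) (s : ℝ) : SmallO s (rootCorrection k) := by
  refine smallO_of_eventually_zero ?_
  filter_upwards [eventually_ge_atTop k] with n hn
  rw [rootCorrection, coeff_mk, if_neg (by omega)]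

/-- A particular solution of a first-order equation with a polynomial forcing term. -/
noncomputable def correctionSolution (k : ℕ) : ℂ⟦X⟧ :=
  PowerSeries.mk fun n => -((n : ℂ) + 1) * ∑ j ∈ Finset.Ico n k,
    coeff j (rootCorrection k) / ((j + 1) * (j + 2))

lemma eulerD_correctionSolution (k : ℕ) :
    eulerD (correctionSolution k) - (2 : ℂ) • correctionSolution k = rootCorrection k := by
  ext n
  have hn1 : (n : ℂ) + 1 ≠ 0 := by exact_mod_cast n.succ_ne_zero
  have hn2 : (n : ℂ) + 2 ≠ 0 := by exact_mod_cast (n + 1).succ_ne_zero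
  rw [map_sub, coeff_eulerD, coeff_smul, smul_eq_mul, correctionSolution, coeff_mk, coeff_mk]
  by_cases h : n < k
  · rw [← Finset.sum_Ioo_add_eq_sum_Ico h]
    have : Finset.Ioo n k = Finset.Ico (n + 1) k := by ext; simp
    rw [this]
    push_cast
    field_simp
    ring
  · rw [Finset.Ico_eq_empty (by omega), Finset.Ico_eq_empty (by omega), rootCorrection, coeff_mk,
      if_neg h]
    simp

lemma smallO_correctionSolution (k : ℕ) (s : ℝ) : SmallO s (correctionSolution k) := by
  refine smallO_of_eventually_zero ?_
  filter_upwards [eventually_ge_atTop k] with n hn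
  rw [correctionSolution, coeff_mk, Finset.Ico_eq_empty (by omega)]; simp

/-- A solution of `(D - s) G = N`, where `N` is the generating function of the mean key path
lengths. -/
noncomputable def keySolution (k : ℕ) (s : ℂ) : ℂ⟦X⟧ :=
  ((indicialPoly k).eval s)⁻¹ • (((k + 1).factorial : ℂ) •
    ((2 - s)⁻¹ • negPow 2 - (1 - s)⁻¹ • negPow 1) -
      op (indicialPoly k /ₘ (Polynomial.X - Polynomial.C s)) (keyGf k))

lemma eulerD_keySolution (hk : 1 ≤ k) {s : ℂ} (hs : (indicialPoly k).eval s ≠ 0) (h2 : s ≠ 2)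
    (h1 : s ≠ 1) : eulerD (keySolution k s) - s • keySolution k s = keyGf k := by
  -- Dividing Λ by X - s with remainder Λ(s) makes Λ(s) times the unknown right-hand side equal to
  -- known forcing terms minus an image of D - s.
  have e : indicialPoly k = (Polynomial.X - Polynomial.C s) *
      (indicialPoly k /ₘ (Polynomial.X - Polynomial.C s)) +
        Polynomial.C ((indicialPoly k).eval s) := by
    conv_lhs => rw [← Polynomial.modByMonic_add_div (indicialPoly k)
      (Polynomial.X - Polynomial.C s), Polynomial.modByMonic_X_sub_C_eq_C_eval]
    rw [add_comm]
  have h3 := op_keyGf hk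
  rw [e, add_op, op_mul, op_C, ← eq_sub_iff_add_eq] at h3
  have h2' : 2 - s ≠ 0 := sub_ne_zero.mpr h2.symm
  have h1' : 1 - s ≠ 0 := sub_ne_zero.mpr h1.symm
  rw [← op_X_sub_C, keySolution, op_smul, op_sub, h3, op_smul, op_sub, op_smul, op_smul,
    op_negPow, op_negPow]
  simp only [Polynomial.eval_sub, Polynomial.eval_X, Polynomial.eval_C, smul_smul,
    inv_mul_cancel₀ h2', inv_mul_cancel₀ h1', one_smul]
  rw [sub_sub_cancel, smul_smul, inv_mul_cancel₀ hs, one_smul]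

/-- The quotient term does not contribute: its degree is at most k, and the coefficients of `keyGf`
vanish up to index k. -/
lemma coeff_zero_keySolution (hk : 1 ≤ k) (s : ℂ) : coeff 0 (keySolution k s) =
    (k + 1).factorial / (indicialPoly k).eval s * (1 / (2 - s) - 1 / (1 - s)) := by
  have hdeg : (indicialPoly k /ₘ (Polynomial.X - Polynomial.C s)).natDegree ≤ k := by
    rw [Polynomial.natDegree_divByMonic _ (Polynomial.monic_X_sub_C s), natDegree_indicialPoly]
    omega
  rw [keySolution, coeff_smul, map_sub, coeff_smul, map_sub, coeff_smul, coeff_smul,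
    constCoeff_negPow, constCoeff_negPow,
    coeff_op_eq_zero (k := k + 1) (fun n hn => coeff_keyGf_of_le (by omega)) _ (by omega)]
  simp only [smul_eq_mul]
  ring

lemma smallO_one_sub_X_mul_keySolution (hk : 1 ≤ k) (s : ℂ) {ε : ℝ} (hε : 0 < ε) :
    SmallO ε ((1 - X) * keySolution k s) := by
  rw [keySolution, mul_smul_comm, mul_sub, mul_smul_comm, mul_sub, mul_smul_comm, mul_smul_comm,
    one_sub_X_mul_negPow, one_sub_X_mul_negPow]
  refine SmallO.smul _ (SmallO.sub (SmallO.smul _ (SmallO.sub (SmallO.smul _ ?_)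
    (SmallO.smul _ ?_))) (smallO_one_sub_X_mul_op_keyGf hk _ hε))
  · exact smallO_negPow (by linarith) (by norm_num; linarith)
  · exact smallO_negPow (by linarith) (by norm_num; linarith)

/-- A particular solution of `(D - 2) V = d`, where `d` is the forcing term in the differential
equation for the mean of the product. -/
noncomputable def forcingSolution (k : ℕ) : ℂ⟦X⟧ :=
  (∑ z ∈ others k, coeffA (k + 1) z • ((k : ℂ) • (negPow (z - 1) * keySolution k (3 - z)) +
    ((z / (z - 1)) • negPow (z + 1) - ((z + k) / (z - 2)) • negPow z))) + correctionSolution k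

lemma exists_bound_re_others (h2 : 2 ≤ k) (h12 : k ≤ 12) :
    ∃ A : ℝ, 0 < A ∧ A < 1 ∧ ∀ z ∈ others k, z.re < A := by
  have h : ∀ z ∈ others k, ∀ᶠ A : ℝ in 𝓝[<] 1, z.re < A := fun z hz => by
    have hz' := (mem_others (by omega)).mp hz
    exact nhdsWithin_le_nhds (lt_mem_nhds (re_lt_one h2 h12 hz'.2 hz'.1))
  have h0 : ∀ᶠ A : ℝ in 𝓝[<] 1, 0 < A := nhdsWithin_le_nhds (lt_mem_nhds one_pos)
  obtain ⟨A, hA⟩ := (h0.and (eventually_mem_nhdsWithin.and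
    ((others k).eventually_all.mpr h))).exists
  exact ⟨A, hA.1, hA.2.1, hA.2.2⟩

/-- By the exponential shift, D - 2 acts on the factor of (1 - X)^(1 - z) as D - (3 - z), which
explains the parameter of `keySolution`. The terms of `rootGf` are eigenvectors and are divided by
their eigenvalues z - 1 and z - 2. -/
lemma eulerD_forcingSolution (h2 : 2 ≤ k) (h12 : k ≤ 12) :
    eulerD (forcingSolution k) - (2 : ℂ) • forcingSolution k =
      rootGf k + (k : ℂ) • ((1 - X) * (spaceGf k * keyGf k)) := by
  have hk : 1 ≤ k := by omega
  have key : ∀ z ∈ others k, ∀ f : ℂ⟦X⟧ → ℂ⟦X⟧, (f = fun a => eulerD a - (2 : ℂ) • a) →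
      f ((k : ℂ) • (negPow (z - 1) * keySolution k (3 - z)) +
        ((z / (z - 1)) • negPow (z + 1) - ((z + k) / (z - 2)) • negPow z)) =
      (k : ℂ) • ((1 - X) * (negPow z * keyGf k)) +
        (z • negPow (z + 1) - (z + k) • negPow z) := by
    rintro z hz f rfl
    have hz' := (mem_others hk).mp hz
    have hre := re_lt_one h2 h12 hz'.2 hz'.1
    -- Since Re z < 1, the point 3 - z has real part above 2, where Λ has no zero.
    have hs : (indicialPoly k).eval (3 - z) ≠ 0 := fun h => by
      by_cases h3 : 3 - z = 2
      · have : z = 1 := by linear_combination -h3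
        rw [this] at hre; norm_num at hre
      · have := re_lt_two hk h h3
        norm_num at this; linarith
    have hs2 : (3 - z) ≠ 2 := fun h3 => by
      have : z = 1 := by linear_combination -h3
      rw [this] at hre; norm_num at hre
    have hs1 : (3 - z) ≠ 1 := fun h3 => hz'.1 (by linear_combination -h3)
    have h1' : z - 1 ≠ 0 := fun h3 => hs2 (by linear_combination -h3)
    have h2' : z - 2 ≠ 0 := sub_ne_zero.mpr hz'.1
    have hG := eq_add_of_sub_eq (eulerD_keySolution hk hs hs2 hs1)
    have e1 : eulerD (negPow (z - 1) * keySolution k (3 - z)) -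
        (2 : ℂ) • (negPow (z - 1) * keySolution k (3 - z)) =
        (1 - X) * (negPow z * keyGf k) := by
      rw [Derivation.leibniz, hG, eulerD_negPow, ← mul_assoc, one_sub_X_mul_negPow]
      simp only [smul_eq_mul, PowerSeries.smul_eq_C_mul, map_sub, map_ofNat, map_one]
      ring
    have e2 : z / (z - 1) * (z - 1) = z := div_mul_cancel₀ _ h1'
    have e3 : (z + k) / (z - 2) * (z - 2) = z + k := div_mul_cancel₀ _ h2'
    simp only [map_add, map_sub, Derivation.map_smul, eulerD_negPow]
    rw [← e1]
    have e2' : (z / (z - 1)) • (z + 1) • negPow (z + 1) - (2 : ℂ) • (z / (z - 1)) • negPow (z + 1) =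
        z • negPow (z + 1) := by
      conv_rhs => rw [show z • negPow (z + 1) = (z / (z - 1) * (z - 1)) • negPow (z + 1) by rw [e2]]
      module
    have e3' : ((z + k) / (z - 2)) • z • negPow z - (2 : ℂ) • ((z + k) / (z - 2)) • negPow z =
        (z + k) • negPow z := by
      conv_rhs => rw [← e3]
      module
    rw [← e2', ← e3']
    module
  have h := eulerD_correctionSolution k
  rw [rootGf_eq hk, ← h, forcingSolution, map_add, map_sum]
  have hsum : (∑ z ∈ others k, eulerD (coeffA (k + 1) z •
      ((k : ℂ) • (negPow (z - 1) * keySolution k (3 - z)) +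
        ((z / (z - 1)) • negPow (z + 1) - ((z + k) / (z - 2)) • negPow z)))) =
      (2 : ℂ) • (∑ z ∈ others k, coeffA (k + 1) z •
        ((k : ℂ) • (negPow (z - 1) * keySolution k (3 - z)) +
        ((z / (z - 1)) • negPow (z + 1) - ((z + k) / (z - 2)) • negPow z))) +
      (∑ z ∈ others k, coeffA (k + 1) z • (z • negPow (z + 1) - (z + k) • negPow z)) +
      (k : ℂ) • ((1 - X) * (spaceGf k * keyGf k)) := by
    rw [spaceGf_eq hk, Finset.sum_mul, Finset.mul_sum, Finset.smul_sum, Finset.smul_sum,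
      ← Finset.sum_add_distrib, ← Finset.sum_add_distrib]
    refine Finset.sum_congr rfl fun z hz => ?_
    have := key z hz _ rfl
    rw [Derivation.map_smul, eq_add_of_sub_eq this, smul_mul_assoc, mul_smul_comm]
    module
  rw [hsum]
  module

/-- Moving one factor 1 - X to `keySolution` leaves a series that is o(n^ε) for every ε > 0; the
other factor has order n^(Re z - 1), and Re z < 1 makes the convolution o(n). -/
lemma smallO_forcingSolution (h2 : 2 ≤ k) (h12 : k ≤ 12) : SmallO 1 (forcingSolution k) := by
  have hk : 1 ≤ k := by omega
  obtain ⟨A, h0, h1, hA⟩ := exists_bound_re_others h2 h12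
  refine SmallO.add (SmallO.sum fun z hz => SmallO.smul _ (SmallO.add (SmallO.smul _ ?_)
    (SmallO.sub (SmallO.smul _ ?_) (SmallO.smul _ ?_)))) (smallO_correctionSolution k 1)
  · have e : negPow (z - 1) * keySolution k (3 - z) =
        negPow z * ((1 - X) * keySolution k (3 - z)) := by
      rw [← mul_assoc, mul_comm (negPow z), one_sub_X_mul_negPow]
    rw [e]
    exact SmallO.mul (s := A - 1) (t := (1 - A) / 2) (by linarith) (by linarith) (by linarith)
      (smallO_negPow (by linarith) (by linarith [hA z hz]))
      (smallO_one_sub_X_mul_keySolution hk _ (by linarith))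
  · exact smallO_negPow (by norm_num) (by have := hA z hz; norm_num; linarith)
  · exact smallO_negPow (by norm_num) (by have := hA z hz; norm_num; linarith)

lemma smallO_rootGf (hk : 1 ≤ k) {s : ℝ} (hs : -1 < s) (h : ∀ z ∈ others k, z.re < s) :
    SmallO s (rootGf k) := by
  rw [rootGf_eq hk]
  refine SmallO.add (SmallO.sum fun z hz => SmallO.smul _ (SmallO.sub (SmallO.smul _ ?_)
    (SmallO.smul _ ?_))) (smallO_rootCorrection k s)
  · exact smallO_negPow hs (by have := h z hz; norm_num; linarith)
  · exact smallO_negPow hs (by have := h z hz; linarith)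

lemma SmallO.coeff_mul_coeff {s t u : ℝ} {a b : ℂ⟦X⟧} (ha : SmallO s a) (hb : SmallO t b)
    (h : s + t ≤ u) : (fun n => coeff n a * coeff n b) =o[atTop] fun n : ℕ => (n : ℝ) ^ u := by
  have h1 : (fun n => coeff n a * coeff n b) =o[atTop]
      fun n : ℕ => (n : ℝ) ^ s * (n : ℝ) ^ t := IsLittleO.mul ha hb
  refine h1.trans_isBigO (IsBigO.of_bound 1 ?_)
  filter_upwards [eventually_ge_atTop 1] with n hn
  have hn' : (1 : ℝ) ≤ n := by exact_mod_cast hn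
  rw [← Real.rpow_add (by linarith), one_mul, Real.norm_of_nonneg (by positivity),
    Real.norm_of_nonneg (by positivity)]
  exact Real.rpow_le_rpow_of_exponent_le hn' h

/-- Both sides solve the same equation for D - 2, so they differ by a multiple of (1 - X)^(-2). The
multiple is fixed at coefficient 0: `reducedPoly k` has degree k - 1 and `prodGf` vanishes below k.
-/
lemma op_reducedPoly_prodGf (h2 : 2 ≤ k) (h12 : k ≤ 12) :
    op (reducedPoly k) (prodGf k) = ((k + 1).factorial : ℂ) • forcingSolution k -
      (((k + 1).factorial : ℂ) * coeff 0 (forcingSolution k)) • negPow 2 := by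
  have hk : 1 ≤ k := by omega
  have h := op_prodGf hk
  rw [op_C_two_reducedPoly hk, ← eulerD_forcingSolution h2 h12] at h
  set a := op (reducedPoly k) (prodGf k) - ((k + 1).factorial : ℂ) • forcingSolution k with ha
  have h3 : eulerD a = (2 : ℂ) • a := by
    rw [ha, map_sub, Derivation.map_smul, eq_add_of_sub_eq h]
    module
  have h4 := eq_smul_negPow h3
  have h5 : coeff 0 (op (reducedPoly k) (prodGf k)) = 0 :=
    coeff_op_eq_zero (k := k) (fun n hn => coeff_prodGf_of_lt hn) _
      (by have := natDegree_reducedPoly hk; omega)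
  have h6 : coeff 0 a = -(((k + 1).factorial : ℂ) * coeff 0 (forcingSolution k)) := by
    rw [ha, map_sub, h5, coeff_smul, smul_eq_mul]; ring
  rw [h6] at h4
  rw [← sub_eq_iff_eq_add'.mpr (show op (reducedPoly k) (prodGf k) =
    ((k + 1).factorial : ℂ) • forcingSolution k + a by rw [ha]; abel), ] at h4
  rw [sub_eq_iff_eq_add.mp h4]
  module

/-- In the linear regime the covariance is asymptotically a multiple of `n`. -/
lemma covSK_sub_linear_isLittleO (h2 : 2 ≤ k) (h12 : k ≤ 12) :
    (fun n : ℕ => (covSK (k + 1) n : ℂ) - -(2 * occ k * coeff 0 (forcingSolution k)) * n) =o[atTop]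
      fun n : ℕ => (n : ℝ) := by
  have hk : 1 ≤ k := by omega
  obtain ⟨A, h0, h1, hA⟩ := exists_bound_re_others h2 h12
  set c : ℂ := -(2 * occ k * coeff 0 (forcingSolution k)) with hc
  have e1 : SmallO 1 (prodGf k - c • negPow 2) := by
    refine smallO_op_reducedPoly (by norm_num) (fun z hz => by linarith [hA z hz]) ?_
    have e : op (reducedPoly k) (prodGf k - c • negPow 2) =
        ((k + 1).factorial : ℂ) • forcingSolution k := by
      have hne := eval_reducedPoly_two_ne_zero hk
      rw [op_sub, op_reducedPoly_prodGf h2 h12, op_smul, op_negPow, hc, occ_eq,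
        ← eval_reducedPoly_two hk, smul_smul, sub_sub, ← add_smul]
      have : (((k + 1).factorial : ℂ) * coeff 0 (forcingSolution k)) +
        -((k + 1).factorial / (reducedPoly k).eval 2 * coeff 0 (forcingSolution k)) *
          (reducedPoly k).eval 2 = 0 := by
        field_simp; ring
      rw [this, zero_smul, sub_zero]
    rw [e]
    exact (smallO_forcingSolution h2 h12).smul _
  have e2 := smallO_rootGf hk (s := 1) (by norm_num) (fun z hz => by linarith [hA z hz])
  -- The product of the means is o(n): the factors are o(n^(A - 1)) and o(n^(2 - A)).
  have e3 := (smallO_spaceGf hk (s := A - 1) (by linarith) (fun z hz => by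
    linarith [hA z hz])).coeff_mul_coeff (smallO_keyGf hk (ε := 1 - A) (by linarith))
      (u := 1) (by linarith)
  have e4 : (fun n : ℕ => (c : ℂ)) =o[atTop] fun n : ℕ => (n : ℝ) :=
    isLittleO_const_left.mpr (Or.inr (tendsto_norm_atTop_atTop.comp
      tendsto_natCast_atTop_atTop))
  have e12 := e1.add e2
  rw [SmallO] at e12
  simp only [Real.rpow_one] at e12 e3
  refine ((e12.sub e3).add e4).congr_left fun n => ?_
  rw [covSK_eq, map_add, map_sub, coeff_smul, coeff_negPow_two, smul_eq_mul]
  ring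

end MarySearch

/-! ### Nonvanishing of the linear constant by exact arithmetic -/

namespace MarySearch

open PowerSeries Topology

variable {k : ℕ}

/-- The polynomial with the given list of coefficients. -/
noncomputable def ofCoeffs (l : List ℤ) : Polynomial ℂ :=
  l.foldr (fun a p => Polynomial.C (a : ℂ) + Polynomial.X * p) 0

@[simp] lemma ofCoeffs_nil : ofCoeffs [] = 0 := rfl

@[simp] lemma ofCoeffs_cons (a : ℤ) (l : List ℤ) :
    ofCoeffs (a :: l) = Polynomial.C (a : ℂ) + Polynomial.X * ofCoeffs l := rfl

lemma degree_ofCoeffs_lt (l : List ℤ) : (ofCoeffs l).degree < l.length := by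
  rw [Polynomial.degree_lt_iff_coeff_zero]
  induction l with
  | nil => simp
  | cons a l ih =>
    intro n hn
    obtain ⟨n, rfl⟩ : ∃ i, n = i + 1 := ⟨n - 1, by simp at hn; omega⟩
    rw [ofCoeffs_cons, Polynomial.coeff_add, Polynomial.coeff_C_succ, Polynomial.coeff_X_mul,
      ih n (by simpa using hn), zero_add]

lemma coeff_ofCoeffs (l : List ℤ) (n : ℕ) : (ofCoeffs l).coeff n = (l.getD n 0 : ℤ) := by
  induction l generalizing n with
  | nil => simp
  | cons a l ih =>
    rw [ofCoeffs_cons, Polynomial.coeff_add]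
    cases n with
    | zero => simp
    | succ n => rw [Polynomial.coeff_C_succ, Polynomial.coeff_X_mul, ih]; simp

/-- Lagrange interpolation at the zeros other than 2: the sum is the top coefficient of the
interpolating polynomial. -/
lemma sum_others_eval_div (hk : 2 ≤ k) {U : Polynomial ℂ} (hU : U.degree < (k - 1 : ℕ)) :
    ∑ z ∈ others k, U.eval z / (reducedPoly k).derivative.eval z = U.coeff (k - 2) := by
  have hcard : (others k).card = k - 1 := by
    have h := natDegree_reducedPoly (k := k) (by omega)
    rw [reducedPoly, Polynomial.natDegree_prod_of_monic _ _
      fun z _ => Polynomial.monic_X_sub_C z] at h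
    simp at h; omega
  have h := Lagrange.coeff_eq_sum (s := others k) (v := id) Function.injective_id.injOn
    (P := U) (by rwa [hcard])
  rw [hcard, Nat.sub_sub] at h
  rw [h]
  refine Finset.sum_congr rfl fun z hz => ?_
  have e : reducedPoly k = Lagrange.nodal (others k) id := rfl
  have e2 := Lagrange.eval_nodal_derivative_eval_node_eq (v := id) hz
  rw [Lagrange.eval_nodal] at e2
  rw [e]
  exact congrArg _ e2

/-- The contribution of the small trees to the constant in the linear regime. -/
noncomputable def smallTreeTerm (k : ℕ) : ℂ :=
  ∑ j ∈ Finset.range k, ((k : ℂ) - j) * ((if j = 0 then 0 else 1) - occ k * (j + 1) + 1 / k) /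
    ((j + 1) * (j + 2))

lemma coeff_zero_correctionSolution : coeff 0 (correctionSolution k) = - smallTreeTerm k := by
  rw [correctionSolution, coeff_mk, ← Finset.range_eq_Ico, smallTreeTerm, Nat.cast_zero, zero_add,
    neg_one_mul]
  congr 1
  refine Finset.sum_congr rfl fun j hj => ?_
  rw [rootCorrection, coeff_mk, if_pos (Finset.mem_range.mp hj)]
  by_cases h0 : j = 0
  · rw [if_pos h0, h0, coeff_spaceGf_zero]; push_cast; ring
  · rw [if_neg h0, coeff_spaceGf_of_le h0 (Finset.mem_range.mp hj).le]

/-- The constant is expressed by rational arithmetic from a polynomial `U` which on the zeros of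
`Λ` other than `2` takes the values of the rational function that has to be summed. -/
lemma coeff_zero_forcingSolution (h2 : 2 ≤ k) (h12 : k ≤ 12) {U : Polynomial ℂ}
    (hU : U.degree < (k - 1 : ℕ)) {c : ℂ} (hc : c ≠ 0)
    (V : ℂ → ℂ) (h : ∀ z : ℂ, (z - 2) * (U.eval z * (z * (z - 1) ^ 2 * (z - 2) ^ 2 *
        (∏ j ∈ Finset.range k, (3 - z + j) - (k + 1).factorial)) -
      c * (k * (k + 1).factorial + ((k + 1) * z - k) *
        (∏ j ∈ Finset.range k, (3 - z + j) - (k + 1).factorial))) =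
      V z * (∏ j ∈ Finset.range k, (z + j) - (k + 1).factorial)) :
    coeff 0 (forcingSolution k) =
      -((k + 1).factorial * (U.coeff (k - 2) / c) + smallTreeTerm k) := by
  have hk : 1 ≤ k := by omega
  rw [forcingSolution, map_add, map_sum, coeff_zero_correctionSolution, neg_add,
    ← sum_others_eval_div h2 hU, Finset.sum_div, Finset.mul_sum, ← Finset.sum_neg_distrib]
  congr 1
  refine Finset.sum_congr rfl fun z hz => ?_
  have hz' := (mem_others hk).mp hz
  have hre := re_lt_one h2 h12 hz'.2 hz'.1
  have z1 : z - 1 ≠ 0 := sub_ne_zero.mpr (ne_one_of_zero hk hz'.2)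
  have z0 : z ≠ 0 := ne_zero_of_zero hk hz'.2
  have z2 : z - 2 ≠ 0 := sub_ne_zero.mpr hz'.1
  have hs : (indicialPoly k).eval (3 - z) ≠ 0 := fun h => by
    by_cases h3 : 3 - z = 2
    · exact z1 (by linear_combination -h3)
    · have := re_lt_two hk h h3
      norm_num at this; linarith
  -- At z the reduced polynomial vanishes, so Λ'(z) = (z - 2) Q'(z) with Q = `reducedPoly k`. This
  -- converts the denominators of `coeffA` into those of the interpolation formula.
  have hd := eval_derivative_eq hk z
  rw [eval_reducedPoly_eq_zero.mpr hz, zero_add] at hd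
  have hQ : (reducedPoly k).derivative.eval z ≠ 0 := fun h0 => by
    rw [h0, mul_zero] at hd
    exact eval_derivative_ne_zero hk hz'.2 hd
  specialize h z
  have e := hz'.2
  rw [eval_indicialPoly_eq] at e hs
  set L := ∏ j ∈ Finset.range k, (3 - z + j) - ((k + 1).factorial : ℂ) with hL
  -- The factor z - 2 in the certificate makes divisibility by Λ express divisibility by Q; at a
  -- zero z ≠ 2 it can be cancelled.
  rw [e, mul_zero, mul_eq_zero, or_iff_right z2] at h
  rw [coeff_smul, map_add, coeff_smul, map_sub, coeff_smul, coeff_smul,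
    show coeff 0 (negPow (z - 1) * keySolution k (3 - z)) =
      coeff 0 (negPow (z - 1)) * coeff 0 (keySolution k (3 - z)) by
        rw [coeff_zero_eq_constantCoeff, map_mul],
    constCoeff_negPow, constCoeff_negPow, constCoeff_negPow, one_mul,
    coeff_zero_keySolution hk, eval_indicialPoly_eq, ← hL, coeffA_eq hz'.2, hd, smul_eq_mul,
    smul_eq_mul, smul_eq_mul, smul_eq_mul]
  have hU' : U.eval z / c = (k * (k + 1).factorial + ((k + 1) * z - k) * L) /
      (z * (z - 1) ^ 2 * (z - 2) ^ 2 * L) := by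
    rw [div_eq_div_iff hc (mul_ne_zero (mul_ne_zero
      (mul_ne_zero z0 (pow_ne_zero 2 z1)) (pow_ne_zero 2 z2)) hs)]
    linear_combination h
  have h3 : (2 : ℂ) - (3 - z) = z - 1 := by ring
  have h4 : (1 : ℂ) - (3 - z) = z - 2 := by ring
  rw [div_right_comm, hU', h3, h4]
  field_simp
  ring

lemma occ_eq_inv (k : ℕ) :
    occ k = 1 / (2 * ((∑ j ∈ Finset.range (k + 1), ((j : ℂ) + 1)⁻¹) - 1)) := by
  rw [occ, occupancy, harmonic]; push_cast; rfl

lemma occ_ne_zero (hk : 1 ≤ k) : occ k ≠ 0 := by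
  have h := occ_eq k
  intro h0
  rw [h0, mul_zero, eq_comm, div_eq_zero_iff] at h
  rcases h with h | h
  · exact (k + 1).factorial_ne_zero (by exact_mod_cast h)
  · exact eval_derivative_ne_zero hk (eval_indicialPoly_two k) h

/-- A certificate, as in the following lemmas: `U` divided by `c` represents the rational function
to be summed modulo Q = Λ / (z - 2), and the third datum is the cofactor of Λ. The congruence is a
polynomial identity checked by `ring`; what remains is that an explicit rational number is not 0. -/
lemma coeff_zero_forcingSolution_2_ne_zero : coeff 0 (forcingSolution 2) ≠ 0 := by
  rw [coeff_zero_forcingSolution (by norm_num) (by norm_num)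
    (U := ofCoeffs
      [2])
    (degree_ofCoeffs_lt _) (c := 225) (by norm_num)
    (fun z =>
      0 + z * ((-2384) + z * (2453 + z * ((-932) + z * (218 + z * ((-32) + z * (2)))))))
    (fun z => by
      simp [Finset.prod_range_succ, Nat.factorial]
      ring), coeff_ofCoeffs, smallTreeTerm, occ_eq_inv]
  norm_num [Finset.sum_range_succ, Nat.factorial]

lemma coeff_zero_forcingSolution_3_ne_zero : coeff 0 (forcingSolution 3) ≠ 0 := by
  rw [coeff_zero_forcingSolution (by norm_num) (by norm_num)
    (U := ofCoeffs
      [138, 367])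
    (degree_ofCoeffs_lt _) (c := 117624) (by norm_num)
    (fun z =>
      352872 + z * ((-2938944) + z * (3388076 + z * ((-1673230) + z * (475865 + z * ((-83071) + z
      * (8303 + z * ((-367)))))))))
    (fun z => by
      simp [Finset.prod_range_succ, Nat.factorial]
      ring), coeff_ofCoeffs, smallTreeTerm, occ_eq_inv]
  norm_num [Finset.sum_range_succ, Nat.factorial]

lemma coeff_zero_forcingSolution_4_ne_zero : coeff 0 (forcingSolution 4) ≠ 0 := by
  rw [coeff_zero_forcingSolution (by norm_num) (by norm_num)
    (U := ofCoeffs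
      [-1898444, 66839, 113583])
    (degree_ofCoeffs_lt _) (c := 184984800) (by norm_num)
    (fun z =>
      1479878400 + z * ((-8613669824) + z * (10553926440 + z * ((-5928405108) + z * (1928197242 +
      z * ((-390630051) + z * (49233135 + z * ((-3567817) + z * (113583)))))))))
    (fun z => by
      simp [Finset.prod_range_succ, Nat.factorial]
      ring), coeff_ofCoeffs, smallTreeTerm, occ_eq_inv]
  norm_num [Finset.sum_range_succ, Nat.factorial]

lemma coeff_zero_forcingSolution_5_ne_zero : coeff 0 (forcingSolution 5) ≠ 0 := by
  rw [coeff_zero_forcingSolution (by norm_num) (by norm_num)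
    (U := ofCoeffs
      [-862576200, -236949321, -3652024, 3225817])
    (degree_ofCoeffs_lt _) (c := 40449028320) (by norm_num)
    (fun z =>
      606735424800 + z * ((-3061040905080) + z * (3919175048772 + z * ((-2402386928434) + z *
      (866306722475 + z * ((-198206411813) + z * (29294162438 + z * ((-2710419416) + z *
      (142362155 + z * ((-3225817)))))))))))
    (fun z => by
      simp [Finset.prod_range_succ, Nat.factorial]
      ring), coeff_ofCoeffs, smallTreeTerm, occ_eq_inv]
  norm_num [Finset.sum_range_succ, Nat.factorial]

lemma coeff_zero_forcingSolution_6_ne_zero : coeff 0 (forcingSolution 6) ≠ 0 := by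
  rw [coeff_zero_forcingSolution (by norm_num) (by norm_num)
    (U := ofCoeffs
      [-33136112070, -14556388221, -2350271364, -93800551, 6604846])
    (degree_ofCoeffs_lt _) (c := 1073716741440) (by norm_num)
    (fun z =>
      25769201794560 + z * ((-120928831246224) + z * (160477185665376 + z * ((-105219740727768) +
      z * (41257739510936 + z * ((-10440443768601) + z * (1746687370680 + z * ((-190095897144) +
      z * (12737175186 + z * ((-463671927) + z * (6604846)))))))))))
    (fun z => by
      simp [Finset.prod_range_succ, Nat.factorial]
      ring), coeff_ofCoeffs, smallTreeTerm, occ_eq_inv]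
  norm_num [Finset.sum_range_succ, Nat.factorial]

lemma coeff_zero_forcingSolution_7_ne_zero : coeff 0 (forcingSolution 7) ≠ 0 := by
  rw [coeff_zero_forcingSolution (by norm_num) (by norm_num)
    (U := ofCoeffs
      [-694439156475736560, -388264345553023362, -95606498326923711, -11474936165255045,
      -551342748693257, -1037967256481])
    (degree_ofCoeffs_lt _) (c := 17955200946424734720) (by norm_num)
    (fun z =>
      628432033124865715200 + z * ((-2831228764591434080832) + z * (3874824351791911213560 + z *
      ((-2685051363498153482988) + z * (1129522374755503306394 + z * ((-311244666865377419525) +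
      z * (57687007037809665054 + z * ((-7117186965393287433) + z * (559288510028291886 + z *
      ((-25159556198538663) + z * (477647073483106 + z * (1037967256481))))))))))))
    (fun z => by
      simp [Finset.prod_range_succ, Nat.factorial]
      ring), coeff_ofCoeffs, smallTreeTerm, occ_eq_inv]
  norm_num [Finset.sum_range_succ, Nat.factorial]

lemma coeff_zero_forcingSolution_8_ne_zero : coeff 0 (forcingSolution 8) ≠ 0 := by
  rw [coeff_zero_forcingSolution (by norm_num) (by norm_num)
    (U := ofCoeffs
      [-5432393416108859105472, -3567779751143005616520, -1104814302364359097718,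
      -191411076934676057223, -18433274076654769067, -871389501987338457, -13437883849681223])
    (degree_ofCoeffs_lt _) (c := 120973279684677455185920) (by norm_num)
    (fun z =>
      5806717424864517848924160 + z * ((-25535980685747544254797824) + z *
      (35917258782682371636189504 + z * ((-26090152962333786212590960) + z *
      (11658895217538873812451040 + z * ((-3457159877398761835719968) + z *
      (699391452269311787579792 + z * ((-95831696166568578958137) + z * (8534029017378979548753 +
      z * ((-439423721364389062598) + z * (7924127081174835014 + z * (311144276784609167 + z *
      ((-13437883849681223))))))))))))))
    (fun z => by
      simp [Finset.prod_range_succ, Nat.factorial]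
      ring), coeff_ofCoeffs, smallTreeTerm, occ_eq_inv]
  norm_num [Finset.sum_range_succ, Nat.factorial]

lemma coeff_zero_forcingSolution_9_ne_zero : coeff 0 (forcingSolution 9) ≠ 0 := by
  rw [coeff_zero_forcingSolution (by norm_num) (by norm_num)
    (U := ofCoeffs
      [-619894224685389940603827269760, -459383400617829494009687644536,
      -165942113095512864533079922086, -35695497593066872438642229951,
      -4739671892362698931010196045, -376919098952398792712415671, -16169856524462957937446157,
      -278629157981248670051090])
    (degree_ofCoeffs_lt _) (c := 12447504288479967104644874611200) (by norm_num)
    (fun z =>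
      784192770174237927592627100505600 + z * ((-3398924007201159400123528678474560) + z *
      (4900138836418106978838155726684976 + z * ((-3709054056238560740967170016161808) + z *
      (1747439089059326834705604824054912 + z * ((-552511560082498462690627850465680) + z *
      (120665878732313052362347479817993 + z * ((-18118342820243756403705234707474) + z *
      (1798565438769086602387496643861 + z * ((-104081361527194060815417881850) + z *
      (1679931038592211539991644331 + z * (198430231632436136920197082 + z *
      ((-13643463379530649758020473) + z * (278629157981248670051090))))))))))))))
    (fun z => by
      simp [Finset.prod_range_succ, Nat.factorial]
      ring), coeff_ofCoeffs, smallTreeTerm, occ_eq_inv]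
  norm_num [Finset.sum_range_succ, Nat.factorial]

lemma coeff_zero_forcingSolution_10_ne_zero : coeff 0 (forcingSolution 10) ≠ 0 := by
  rw [coeff_zero_forcingSolution (by norm_num) (by norm_num)
    (U := ofCoeffs
      [-10292547487446578864605939200, -8400048862017703133975257440,
      -3400557926107011944454330624, -849920953655082370491272966, -138462061493536070282485307,
      -14706596999961286228303550, -978608153499761385065756, -36846311443254946775084,
      -594548899781185541753])
    (degree_ofCoeffs_lt _) (c := 191836610812420066781608320000) (by norm_num)
    (fun z =>
      15346928864993605342528665600000 + z * ((-65954216337370715668025248128000) + z *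
      (97252630346383673405739291982080 + z * ((-76357231425690212123063903650368) + z *
      (37702799533696558738385675008816 + z * ((-12619866673476981480239317503760) + z *
      (2950157833123745381740756126272 + z * ((-480726808488357063811111006424) + z *
      (52682164525547038841873689253 + z * ((-3427911363942573628474592940) + z *
      (57887975045833523831523101 + z * (10789738245115973111992192 + z *
      ((-1021644231511518459587769) + z * (39255947728736802569300 + z *
      ((-594548899781185541753))))))))))))))))
    (fun z => by
      simp [Finset.prod_range_succ, Nat.factorial]
      ring), coeff_ofCoeffs, smallTreeTerm, occ_eq_inv]
  norm_num [Finset.sum_range_succ, Nat.factorial]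

lemma coeff_zero_forcingSolution_11_ne_zero : coeff 0 (forcingSolution 11) ≠ 0 := by
  rw [coeff_zero_forcingSolution (by norm_num) (by norm_num)
    (U := ofCoeffs
      [-772918432341163353999263102008932861206400, -683053158598957208299684368118757913990000,
      -302185013372734742963209638186449920029180, -84521438706147044005068544482190958699636,
      -15944956754222128504395106500623191218739, -2058795758187541034565043405962428298703,
      -179386793575436299140184828368183397390, -10076026474442299809116442362915125774,
      -328948697976639451243020390743553091, -4733842612674767710268487116877887])
    (degree_ofCoeffs_lt _) (c := 13614465406683596942011468449906925975296000) (by norm_num)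
    (fun z =>
      1347832075261676097259135376540785671554304000 + z *
      ((-5765822606246469675849171295396965968515488000) + z *
      (8680636457465364829162258026485578715846880000 + z *
      ((-7044038674420446391356897843992555885008904976) + z *
      (3628038371706067319747558587294365362137425904 + z *
      ((-1278169708387825545601490702263779828141713504) + z *
      (317687642909507080584659964699165869481264364 + z *
      ((-55756538890648437022658213582592452589903371) + z *
      (6698629896428719687460003588355748063708402 + z *
      ((-491608181721849787042326375047614123032302) + z *
      (10660479272371032985137037237118848127282 + z * (1941295688965014090901753132407588837260
      + z * ((-240710368599311420436401090420273434906) + z *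
      (13324399647060970904511780840216507806 + z * ((-385861536537250473007521163905007846) + z
      * (4733842612674767710268487116877887))))))))))))))))
    (fun z => by
      simp [Finset.prod_range_succ, Nat.factorial]
      ring), coeff_ofCoeffs, smallTreeTerm, occ_eq_inv]
  norm_num [Finset.sum_range_succ, Nat.factorial]

lemma coeff_zero_forcingSolution_12_ne_zero : coeff 0 (forcingSolution 12) ≠ 0 := by
  rw [coeff_zero_forcingSolution (by norm_num) (by norm_num)
    (U := ofCoeffs
      [-4454941716828584431982328611803000953600, -4206135833955372172003496794470571740000,
      -1997757404236340864314619085469191094200, -610249507152696358025752620819838860228,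
      -128767940040667922551368569373968759090, -19202062717129866920837639859756389631,
      -2021257868948646304142735899066700409, -146968191141556319459068355755781262,
      -7022793016047292001542708947817440, -198365854045676852046744678047919,
      -2508526028854773657226536937501])
    (degree_ofCoeffs_lt _) (c := 74888288744303663636876366608917975168000) (by norm_num)
    (fun z =>
      8986594649316439636425163993070157020160000 + z *
      ((-38368914079781168208067373983773035932032000) + z *
      (58893137174954590811074480256378766418152960 + z *
      ((-49247646891140075414696813033275442991521472) + z *
      (26357003160755029310316463193061011356452096 + z *
      ((-9728067083089232738710425787850751863257520) + z *
      (2556890547668038149960501199126508815872880 + z *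
      ((-480424890909671817633862097738374079493524) + z *
      (62913942728036943005746690592061230071432 + z *
      ((-5209962538723417527731865768543752161085) + z * (157801212339145951833958175418118517485
      + z * (21051941976830016370115044574166957239 + z *
      ((-3410698306561194117049901707232403727) + z * (245976899100233977176194102394072905 + z *
      ((-10312745597437514067218576632586425) + z * (243134727032763311625125822952257 + z *
      ((-2508526028854773657226536937501))))))))))))))))))
    (fun z => by
      simp [Finset.prod_range_succ, Nat.factorial]
      ring), coeff_ofCoeffs, smallTreeTerm, occ_eq_inv]
  norm_num [Finset.sum_range_succ, Nat.factorial]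

lemma coeff_zero_forcingSolution_ne_zero (h2 : 2 ≤ k) (h12 : k ≤ 12) :
    coeff 0 (forcingSolution k) ≠ 0 := by
  interval_cases k
  · exact coeff_zero_forcingSolution_2_ne_zero
  · exact coeff_zero_forcingSolution_3_ne_zero
  · exact coeff_zero_forcingSolution_4_ne_zero
  · exact coeff_zero_forcingSolution_5_ne_zero
  · exact coeff_zero_forcingSolution_6_ne_zero
  · exact coeff_zero_forcingSolution_7_ne_zero
  · exact coeff_zero_forcingSolution_8_ne_zero
  · exact coeff_zero_forcingSolution_9_ne_zero
  · exact coeff_zero_forcingSolution_10_ne_zero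
  · exact coeff_zero_forcingSolution_11_ne_zero
  · exact coeff_zero_forcingSolution_12_ne_zero

/-- The constant arises as a complex number; it is real because the covariances are, since an
imaginary part would contribute a term of order n. -/
lemma isEquivalent_covSK (h2 : 2 ≤ k) (h12 : k ≤ 12) : ∃ C : ℝ, C ≠ 0 ∧
    (fun n : ℕ => covSK (k + 1) n) ~[atTop] fun n : ℕ => C * (n : ℝ) := by
  set c : ℂ := -(2 * occ k * coeff 0 (forcingSolution k)) with hc
  have hc0 : c ≠ 0 := neg_ne_zero.mpr (mul_ne_zero (mul_ne_zero two_ne_zero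
    (occ_ne_zero (by omega))) (coeff_zero_forcingSolution_ne_zero h2 h12))
  have h := covSK_sub_linear_isLittleO h2 h12
  rw [← hc] at h
  have him : c.im = 0 := by
    have h1 : (fun n : ℕ => c.im * (n : ℝ)) =o[atTop] fun n : ℕ => (n : ℝ) := by
      refine IsBigO.trans_isLittleO (IsBigO.of_bound 1 (Eventually.of_forall fun n => ?_)) h
      have := Complex.abs_im_le_norm ((covSK (k + 1) n : ℂ) - c * n)
      simpa [abs_mul] using this
    by_contra h0
    have h2 := (isLittleO_const_mul_left_iff h0).mp h1
    have h3 := h2.tendsto_div_nhds_zero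
    have h4 : Tendsto (fun n : ℕ => (n : ℝ) / n) atTop (𝓝 1) :=
      tendsto_const_nhds.congr' (by
        filter_upwards [eventually_gt_atTop 0] with n hn
        rw [div_self (by exact_mod_cast hn.ne')])
    exact one_ne_zero (tendsto_nhds_unique h4 h3)
  have hre : (c.re : ℂ) = c := by
    apply Complex.ext <;> simp [him]
  refine ⟨c.re, fun h0 => hc0 (by rw [← hre, h0, Complex.ofReal_zero]), ?_⟩
  have hre0 : c.re ≠ 0 := fun h0 => hc0 (by rw [← hre, h0, Complex.ofReal_zero])
  rw [IsEquivalent]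
  refine ((isLittleO_const_mul_right_iff hre0).mpr ?_)
  refine IsBigO.trans_isLittleO (IsBigO.of_bound 1 (Eventually.of_forall fun n => ?_)) h
  rw [one_mul, ← Complex.norm_real]
  refine le_of_eq (congrArg _ ?_)
  simp [hre]

end MarySearch

/-! ### The oscillating regime: dominant forcing terms -/

namespace MarySearch

open PowerSeries Topology

variable {k : ℕ}

/-- The mean key path length: the terms of order `n log n` and `n`, and a remainder. -/
lemma exists_keyGf_eq (hk : 1 ≤ k) : ∃ (c : ℂ) (N : ℂ⟦X⟧), op (reducedPoly k) N = 0 ∧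
    keyGf k = (2 * occ k) • (logSeries * negPow 2) + (((k : ℂ) + 1) / k) • negPow 1 +
      c • negPow 2 + N := by
  have hk0 : (k : ℂ) ≠ 0 := by exact_mod_cast (by omega : k ≠ 0)
  have hf : (k.factorial : ℂ) ≠ 0 := by exact_mod_cast k.factorial_ne_zero
  have hd := eval_derivative_ne_zero hk (eval_indicialPoly_two k)
  -- The forcing exponent 2 is itself a simple zero of Λ, which produces the logarithm with
  -- coefficient (k + 1)!/Λ'(2) = 2φ. The multiple c of (1 - X)^(-2) that remains may stay
  -- unspecified, because it cancels in the covariance.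
  set N₁ := keyGf k - (2 * occ k) • (logSeries * negPow 2) - (((k : ℂ) + 1) / k) • negPow 1 with hN₁
  have h1 : op (indicialPoly k) N₁ = 0 := by
    have e1 : 2 * occ k * (indicialPoly k).derivative.eval 2 = (k + 1).factorial := by
      rw [occ_eq, div_mul_cancel₀ _ hd]
    have e2 : ((k : ℂ) + 1) / k * (indicialPoly k).eval 1 = -(k + 1).factorial := by
      rw [eval_indicialPoly_one, Nat.factorial_succ]; push_cast; field_simp
    rw [hN₁, op_sub, op_sub, op_smul, op_smul, op_logSeries_mul_negPow, op_negPow, op_keyGf hk,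
      eval_indicialPoly_two, zero_smul, zero_add, smul_smul, smul_smul, e1, e2]
    module
  rw [op_C_two_reducedPoly hk, sub_eq_zero] at h1
  have h2 := eq_smul_negPow h1
  set c := coeff 0 (op (reducedPoly k) N₁) / (reducedPoly k).eval 2 with hc
  refine ⟨c, N₁ - c • negPow 2, ?_, by rw [hN₁]; abel⟩
  rw [op_sub, op_smul, op_negPow, smul_smul, hc,
    div_mul_cancel₀ _ (eval_reducedPoly_two_ne_zero hk),
    ← h2, sub_self]

lemma smallO_one_sub_X_mul {s : ℝ} (hs : -1 < s) (h : ∀ z ∈ others k, z.re < s + 2) {N : ℂ⟦X⟧}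
    (hN : op (reducedPoly k) N = 0) : SmallO s ((1 - X) * N) := by
  refine smallO_of_op hs (comp_X_add_C_one_ne_zero (monic_reducedPoly k).ne_zero)
    (fun ρ hρ => ?_) ?_
  · rw [Polynomial.eval_comp] at hρ
    simp only [Polynomial.eval_add, Polynomial.eval_X, Polynomial.eval_C] at hρ
    have := h _ (eval_reducedPoly_eq_zero.mp hρ)
    simp at this; linarith
  · rw [op_comp_one_sub_X_mul, hN, mul_zero]
    exact SmallO.zero

lemma sum_others_eq {M : Type*} [AddCommMonoid M] {P : Finset ℂ} (hP : P ⊆ others k) (f : ℂ → M) :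
    ∑ z ∈ others k, f z = ∑ z ∈ P, f z + ∑ z ∈ others k \ P, f z := by
  rw [add_comm, Finset.sum_sdiff hP]

/-- The part of the forcing term in the equation for the product which is due to the zero `z`. -/
noncomputable def forcingMain (k : ℕ) (c z : ℂ) : ℂ⟦X⟧ :=
  (2 * occ k * k) • (logSeries * negPow (z + 1)) + (c * k + z) • negPow (z + 1)

/-- Only the terms with exponent z + 1 for dominant z reach order n^α. Here and below P stands for
the set of zeros with real part α. -/
lemma smallO_rootGf_sub (hk : 1 ≤ k) {P : Finset ℂ} (hP : P ⊆ others k) {α : ℝ} (hα : 1 < α)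
    (h1 : ∀ z ∈ P, z.re = α) (h2 : ∀ z ∈ others k \ P, z.re < α) :
    SmallO α (rootGf k - ∑ z ∈ P, (coeffA (k + 1) z * z) • negPow (z + 1)) := by
  have e : rootGf k - ∑ z ∈ P, (coeffA (k + 1) z * z) • negPow (z + 1) =
      ∑ z ∈ others k \ P, coeffA (k + 1) z • (z • negPow (z + 1) - (z + k) • negPow z) +
        rootCorrection k - ∑ z ∈ P, (coeffA (k + 1) z * (z + k)) • negPow z := by
    rw [rootGf_eq hk, sum_others_eq hP]
    have : ∑ z ∈ P, coeffA (k + 1) z • (z • negPow (z + 1) - (z + k) • negPow z) =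
        ∑ z ∈ P, (coeffA (k + 1) z * z) • negPow (z + 1) -
          ∑ z ∈ P, (coeffA (k + 1) z * (z + k)) • negPow z := by
      rw [← Finset.sum_sub_distrib]
      exact Finset.sum_congr rfl fun z _ => by module
    rw [this]; abel
  rw [e]
  refine SmallO.sub (SmallO.add (SmallO.sum fun z hz => SmallO.smul _ (SmallO.sub
    (SmallO.smul _ (smallO_negPow (by linarith) ?_))
    (SmallO.smul _ (smallO_negPow (by linarith) ?_)))) (smallO_rootCorrection k α))
    (SmallO.sum fun z hz => SmallO.smul _ (smallO_negPow (by linarith) ?_))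
  · have := h2 z hz; simp; linarith
  · have := h2 z hz; linarith
  · rw [h1 z hz]; linarith

/-- The series (1 - X) `keyGf` is a logarithmic term plus a constant multiple of (1 - X)^(-1) and
smaller terms. Multiplied by (1 - X)^(-z) with z in P, its leading terms form `forcingMain`. The
remainder N gives order about 2α - 2, which is below α as α < 2, and for z outside P the loss in Re
z outweighs the logarithm. -/
lemma smallO_forcing_sub (hk : 1 ≤ k) {P : Finset ℂ} (hP : P ⊆ others k) {α : ℝ} (hα : 1 < α)
    (hα2 : α < 2) (h1 : ∀ z ∈ P, z.re = α) (h2 : ∀ z ∈ others k \ P, z.re < α) {c : ℂ} {N : ℂ⟦X⟧}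
    (hN : op (reducedPoly k) N = 0)
    (hkey : keyGf k = (2 * occ k) • (logSeries * negPow 2) + (((k : ℂ) + 1) / k) • negPow 1 +
      c • negPow 2 + N) :
    SmallO α (rootGf k + (k : ℂ) • ((1 - X) * (spaceGf k * keyGf k)) -
      ∑ z ∈ P, coeffA (k + 1) z • forcingMain k c z) := by
  have hle : ∀ z ∈ others k, z.re ≤ α := fun z hz => by
    by_cases h : z ∈ P
    · exact (h1 z h).le
    · exact (h2 z (Finset.mem_sdiff.mpr ⟨hz, h⟩)).le
  have hkeyX : (1 - X) * keyGf k = (2 * occ k) • (logSeries * negPow 1) +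
      (((k : ℂ) + 1) / k) • negPow 0 + c • negPow 1 + (1 - X) * N := by
    have e2 : (1 - X) * negPow 2 = negPow 1 := by rw [one_sub_X_mul_negPow]; norm_num
    have e1 : (1 - X) * negPow 1 = negPow 0 := by rw [one_sub_X_mul_negPow]; norm_num
    rw [hkey, mul_add, mul_add, mul_add, mul_smul_comm, mul_smul_comm, mul_smul_comm,
      mul_left_comm, e1, e2]
  have e : rootGf k + (k : ℂ) • ((1 - X) * (spaceGf k * keyGf k)) -
      ∑ z ∈ P, coeffA (k + 1) z • forcingMain k c z =
      (rootGf k - ∑ z ∈ P, (coeffA (k + 1) z * z) • negPow (z + 1)) +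
      (k : ℂ) • ((∑ z ∈ others k \ P, coeffA (k + 1) z • (negPow z * ((1 - X) * keyGf k))) +
        ∑ z ∈ P, coeffA (k + 1) z • ((((k : ℂ) + 1) / k) • negPow z +
          negPow z * ((1 - X) * N))) := by
    have e3 : (1 - X) * (spaceGf k * keyGf k) =
        (∑ z ∈ P, coeffA (k + 1) z • (negPow z * ((1 - X) * keyGf k))) +
          ∑ z ∈ others k \ P, coeffA (k + 1) z • (negPow z * ((1 - X) * keyGf k)) := by
      rw [← sum_others_eq hP, spaceGf_eq hk, ← mul_assoc, mul_comm (1 - X), mul_assoc,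
        Finset.sum_mul]
      exact Finset.sum_congr rfl fun z _ => smul_mul_assoc _ _ _
    have e4 : ∑ z ∈ P, coeffA (k + 1) z • forcingMain k c z =
        ∑ z ∈ P, (coeffA (k + 1) z * z) • negPow (z + 1) +
        (k : ℂ) • ((∑ z ∈ P, coeffA (k + 1) z • (negPow z * ((1 - X) * keyGf k))) -
          ∑ z ∈ P, coeffA (k + 1) z • ((((k : ℂ) + 1) / k) • negPow z +
            negPow z * ((1 - X) * N))) := by
      rw [← Finset.sum_sub_distrib, Finset.smul_sum, ← Finset.sum_add_distrib]
      refine Finset.sum_congr rfl fun z _ => ?_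
      have e5 : negPow z * ((1 - X) * keyGf k) = (2 * occ k) • (logSeries * negPow (z + 1)) +
          (((k : ℂ) + 1) / k) • negPow z + c • negPow (z + 1) + negPow z * ((1 - X) * N) := by
        rw [hkeyX, mul_add, mul_add, mul_add, mul_smul_comm, mul_smul_comm, mul_smul_comm,
          mul_left_comm, negPow_mul, negPow_mul, add_zero]
      rw [e5, forcingMain]
      module
    rw [e3, e4]
    module
  rw [e]
  refine SmallO.add (smallO_rootGf_sub hk hP hα h1 h2) (SmallO.smul _ (SmallO.add
    (SmallO.sum fun z hz => SmallO.smul _ ?_) (SmallO.sum fun z hz => SmallO.smul _ (SmallO.add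
      (SmallO.smul _ (smallO_negPow (by linarith) ?_)) ?_))))
  · have hz' := h2 z hz
    have hε : 0 < min ((α - z.re) / 4) (1 / 4) := lt_min (by linarith) (by norm_num)
    have hε1 := min_le_left ((α - z.re) / 4) (1 / 4)
    have hε2 := min_le_right ((α - z.re) / 4) (1 / 4)
    have h3 := smallO_one_sub_X_mul_op_keyGf hk 1 hε
    rw [op_one] at h3
    -- The lower bound -1/2 keeps the exponent above -1, as `SmallO.mul` requires, however negative
    -- Re z is.
    have hs : (-1 : ℝ) < max (z.re - 1 + (α - z.re) / 4) (-1 / 2) :=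
      lt_max_of_lt_right (by norm_num)
    refine SmallO.mul hs (by linarith) ?_ (smallO_negPow hs ?_) h3
    · rcases max_cases (z.re - 1 + (α - z.re) / 4) (-1 / 2) with h | h <;> rw [h.1] <;> linarith
    · have := le_max_left (z.re - 1 + (α - z.re) / 4) (-1 / 2 : ℝ)
      linarith
  · rw [h1 z hz]; linarith
  · refine SmallO.mul (s := α - 1 + (2 - α) / 8) (t := α - 2 + (2 - α) / 8) (by linarith)
      (by linarith) (by linarith) (smallO_negPow (by linarith) (by rw [h1 z hz]; linarith))
      (smallO_one_sub_X_mul (by linarith) (fun w hw => by have := hle w hw; linarith) hN)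

end MarySearch

/-! ### The oscillating regime: constant of the main term -/

namespace MarySearch

open PowerSeries Topology

variable {k : ℕ}

/-- The logarithmic derivative of `Λ` at `z + 1`. -/
noncomputable def shiftedLogDeriv (k : ℕ) (z : ℂ) : ℂ :=
  (indicialPoly k).derivative.eval (z + 1) / (indicialPoly k).eval (z + 1)

lemma prod_range_add_one_add {z : ℂ} (hz : z ≠ 0) :
    ∏ j ∈ Finset.range k, (z + 1 + j) = (∏ j ∈ Finset.range k, (z + j)) * (z + k) / z := by
  have h1 := Finset.prod_range_succ (fun j : ℕ => z + j) k
  rw [Finset.prod_range_succ'] at h1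
  rw [eq_div_iff hz, ← h1]
  simp only [Nat.cast_zero, add_zero]
  congr 1
  exact Finset.prod_congr rfl fun j _ => by push_cast; ring

/-- Shifting z by one multiplies the rising product by (z + k)/z, and at a zero the product is (k +
1)!. -/
lemma eval_indicialPoly_add_one {z : ℂ} (h : (indicialPoly k).eval z = 0) (h0 : z ≠ 0) :
    (indicialPoly k).eval (z + 1) = (k + 1).factorial * k / z := by
  rw [eval_indicialPoly_eq, prod_range_add_one_add h0, eval_indicialPoly_eq_zero_iff.mp h]
  field_simp
  ring

/-- The particular solution belonging to the forcing term of a zero `z`. -/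
noncomputable def prodMain (k : ℕ) (c z : ℂ) : ℂ⟦X⟧ :=
  (z / k) • ((2 * occ k * k) • (logSeries * negPow (z + 1) - shiftedLogDeriv k z • negPow (z + 1)) +
    (c * k + z) • negPow (z + 1))

/-- Undetermined coefficients: on the logarithmic term Λ(D) also produces Λ'(z + 1), which
`shiftedLogDeriv` removes; the prefactor z/k is (k + 1)!/Λ(z + 1). -/
lemma op_prodMain (hk : 1 ≤ k) (c : ℂ) {z : ℂ} (h : (indicialPoly k).eval z = 0) :
    op (indicialPoly k) (prodMain k c z) = ((k + 1).factorial : ℂ) • forcingMain k c z := by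
  have hk0 : (k : ℂ) ≠ 0 := by exact_mod_cast (by omega : k ≠ 0)
  have hf : ((k + 1).factorial : ℂ) ≠ 0 := by exact_mod_cast (k + 1).factorial_ne_zero
  have h0 := ne_zero_of_zero hk h
  have h1 := eval_indicialPoly_add_one h h0
  have h2 : (indicialPoly k).eval (z + 1) ≠ 0 := by
    rw [h1]; exact div_ne_zero (mul_ne_zero hf hk0) h0
  have h3 : shiftedLogDeriv k z * (indicialPoly k).eval (z + 1) =
      (indicialPoly k).derivative.eval (z + 1) := div_mul_cancel₀ _ h2
  have h4 : (z / k) * (indicialPoly k).eval (z + 1) = (k + 1).factorial := by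
    rw [h1]; field_simp
  rw [prodMain, op_smul, op_add, op_smul, op_sub, op_smul, op_smul, op_logSeries_mul_negPow,
    op_negPow, smul_smul (shiftedLogDeriv k z), h3, add_sub_cancel_right, ← h4, forcingMain]
  module

/-- Since α > 1, every homogeneous solution, including the one of order n from the zero 2, is
o(n^α). In contrast to the linear regime, initial values do not matter. -/
lemma smallO_prodGf_sub (hk : 1 ≤ k) {P : Finset ℂ} (hP : P ⊆ others k) {α : ℝ} (hα : 1 < α)
    (hα2 : α < 2) (h1 : ∀ z ∈ P, z.re = α) (h2 : ∀ z ∈ others k \ P, z.re < α) {c : ℂ} {N : ℂ⟦X⟧}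
    (hN : op (reducedPoly k) N = 0)
    (hkey : keyGf k = (2 * occ k) • (logSeries * negPow 2) + (((k : ℂ) + 1) / k) • negPow 1 +
      c • negPow 2 + N) :
    SmallO α (prodGf k - ∑ z ∈ P, coeffA (k + 1) z • prodMain k c z) := by
  refine smallO_of_op (by linarith) (indicialPoly_ne_zero hk) (fun z hz => ?_) ?_
  · by_cases h : z = 2
    · rw [h]; norm_num; linarith
    · have := re_lt_two hk hz h; linarith
  · have e : op (indicialPoly k) (prodGf k - ∑ z ∈ P, coeffA (k + 1) z • prodMain k c z) =
        ((k + 1).factorial : ℂ) • (rootGf k + (k : ℂ) • ((1 - X) * (spaceGf k * keyGf k)) -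
          ∑ z ∈ P, coeffA (k + 1) z • forcingMain k c z) := by
      rw [op_sub, op_prodGf hk, op_sum, smul_sub, Finset.smul_sum]
      congr 1
      refine Finset.sum_congr rfl fun z hz => ?_
      rw [op_smul, op_prodMain hk c ((mem_others hk).mp (hP hz)).2, smul_comm]
    rw [e]
    exact (smallO_forcing_sub hk hP hα hα2 h1 h2 hN hkey).smul _

/-- The contribution of a zero `z` to the covariance, up to the factor `coeffA`. -/
noncomputable def covMain (k : ℕ) (c z : ℂ) (n : ℕ) : ℂ :=
  coeff n (negPow z) * ((z + n) * (2 * occ k * (∑ i ∈ Finset.range n, 1 / (z + 1 + i) -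
    shiftedLogDeriv k z) + c + z / k + 1) -
      (n + 1) * (2 * occ k * ∑ i ∈ Finset.range n, 1 / (2 + (i : ℂ)) + c))

lemma coeff_logSeries_mul_negPow_two (n : ℕ) : coeff n (logSeries * negPow 2) =
    (n + 1) * ∑ i ∈ Finset.range n, 1 / (2 + (i : ℂ)) := by
  rw [coeff_logSeries_mul_negPow (add_natCast_ne_zero_of_re_pos (by norm_num)), coeff_negPow_two]

lemma covSK_sub_isLittleO (hk : 1 ≤ k) {P : Finset ℂ} (hP : P ⊆ others k) {α : ℝ} (hα : 1 < α)
    (hα2 : α < 2) (h1 : ∀ z ∈ P, z.re = α) (h2 : ∀ z ∈ others k \ P, z.re < α) {c : ℂ} {N : ℂ⟦X⟧}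
    (hN : op (reducedPoly k) N = 0)
    (hkey : keyGf k = (2 * occ k) • (logSeries * negPow 2) + (((k : ℂ) + 1) / k) • negPow 1 +
      c • negPow 2 + N) :
    (fun n : ℕ => (covSK (k + 1) n : ℂ) - ∑ z ∈ P, coeffA (k + 1) z * covMain k c z n)
      =o[atTop] fun n : ℕ => (n : ℝ) ^ α := by
  have hk0 : (k : ℂ) ≠ 0 := by exact_mod_cast (by omega : k ≠ 0)
  have hle : ∀ z ∈ others k, z.re ≤ α := fun z hz => by
    by_cases h : z ∈ P
    · exact (h1 z h).le
    · exact (h2 z (Finset.mem_sdiff.mpr ⟨hz, h⟩)).le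
  have e1 := smallO_prodGf_sub hk hP hα hα2 h1 h2 hN hkey
  have e2 := smallO_rootGf_sub hk hP hα h1 h2
  have e3 : (fun n => ∑ z ∈ others k \ P, coeffA (k + 1) z *
      (coeff n (negPow z) * coeff n (keyGf k))) =o[atTop] fun n : ℕ => (n : ℝ) ^ α := by
    refine IsLittleO.fun_sum fun z hz => IsLittleO.const_mul_left ?_ _
    have hz' := h2 z hz
    have hε : 0 < min ((α - z.re) / 4) (1 / 4) := lt_min (by linarith) (by norm_num)
    have hε1 := min_le_left ((α - z.re) / 4) (1 / 4)
    have hε2 := min_le_right ((α - z.re) / 4) (1 / 4)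
    have hs : (-1 : ℝ) < max (z.re - 1 + (α - z.re) / 4) (-1 / 2) :=
      lt_max_of_lt_right (by norm_num)
    refine (smallO_negPow hs ?_).coeff_mul_coeff (smallO_keyGf hk hε) ?_
    · have := le_max_left (z.re - 1 + (α - z.re) / 4) (-1 / 2 : ℝ)
      linarith
    · rcases max_cases (z.re - 1 + (α - z.re) / 4) (-1 / 2) with h | h <;> rw [h.1] <;> linarith
  -- The part of the mean key path length below order n is o(n^(α/2)); multiplied by a term of order
  -- n^(α - 1), which is also o(n^(α/2)), it is negligible.
  have e4 : (fun n => ∑ z ∈ P, coeffA (k + 1) z * (coeff n (negPow z) *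
      coeff n ((((k : ℂ) + 1) / k) • negPow 1 + N))) =o[atTop] fun n : ℕ => (n : ℝ) ^ α := by
    refine IsLittleO.fun_sum fun z hz => IsLittleO.const_mul_left ?_ _
    refine SmallO.coeff_mul_coeff (s := α - 1 + (2 - α) / 2) (t := α - 1 + (2 - α) / 2)
      (smallO_negPow (by linarith) (by rw [h1 z hz]; linarith)) (SmallO.add (SmallO.smul _
        (smallO_negPow (by linarith) (by norm_num; linarith)))
        (smallO_op_reducedPoly (by linarith) (fun w hw => by have := hle w hw; linarith)
          (by rw [hN]; exact SmallO.zero))) (by linarith)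
  have e12 := e1.add e2
  rw [SmallO] at e12
  refine ((e12.sub e3).sub e4).congr_left fun n => ?_
  have hM : coeff n (spaceGf k) = ∑ z ∈ P, coeffA (k + 1) z * coeff n (negPow z) +
      ∑ z ∈ others k \ P, coeffA (k + 1) z * coeff n (negPow z) := by
    rw [spaceGf_eq hk, map_sum, sum_others_eq hP]; rfl
  have hκ : coeff n (keyGf k) = 2 * occ k * ((n + 1) * ∑ i ∈ Finset.range n, 1 / (2 + (i : ℂ))) +
      c * (n + 1) + coeff n ((((k : ℂ) + 1) / k) • negPow 1 + N) := by
    rw [hkey, map_add, map_add, map_add, coeff_smul, coeff_smul _ _ c,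
      coeff_logSeries_mul_negPow_two, coeff_negPow_two, map_add]
    simp only [smul_eq_mul]; ring
  set κ := coeff n (keyGf k) with hκ'
  set B := coeff n ((((k : ℂ) + 1) / k) • negPow 1 + N) with hB
  rw [covSK_eq, hM, map_add, map_sub, map_sub, map_sum, map_sum, add_mul, Finset.sum_mul,
    Finset.sum_mul]
  have hmain : ∑ z ∈ P, coeffA (k + 1) z * covMain k c z n =
      ∑ z ∈ P, coeff n (coeffA (k + 1) z • prodMain k c z) +
      ∑ z ∈ P, coeff n ((coeffA (k + 1) z * z) • negPow (z + 1)) -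
      ∑ z ∈ P, coeffA (k + 1) z * coeff n (negPow z) * κ +
      ∑ z ∈ P, coeffA (k + 1) z * (coeff n (negPow z) * B) := by
    rw [← Finset.sum_add_distrib, ← Finset.sum_sub_distrib, ← Finset.sum_add_distrib]
    refine Finset.sum_congr rfl fun z hz => ?_
    have hre : 0 < (z + 1).re := by have := h1 z hz; simp; linarith
    rw [prodMain, coeff_smul, coeff_smul, coeff_smul, map_add, coeff_smul, coeff_smul, map_sub,
      coeff_smul, coeff_logSeries_mul_negPow (add_natCast_ne_zero_of_re_pos hre), hκ, covMain]
    simp only [smul_eq_mul]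
    have h3 := mul_coeff_negPow_add_one z n
    have h4 : coeffA (k + 1) z * (z / k * (2 * occ k * k * (coeff n (negPow (z + 1)) *
        ∑ i ∈ Finset.range n, 1 / (z + 1 + i) - shiftedLogDeriv k z * coeff n (negPow (z + 1))) +
        (c * k + z) * coeff n (negPow (z + 1)))) = coeffA (k + 1) z *
        (z * coeff n (negPow (z + 1))) * (2 * occ k * (∑ i ∈ Finset.range n, 1 / (z + 1 + i) -
          shiftedLogDeriv k z) + c + z / k) := by
      field_simp
      ring
    rw [h4, mul_assoc (coeffA (k + 1) z) z, h3]
    ring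
  rw [hmain]
  simp only [mul_assoc]
  ring

/-- The constant belonging to a zero `z` in the asymptotic expansion of the covariance. -/
noncomputable def covConst (k : ℕ) (z : ℂ) : ℂ :=
  (z + k) / k * (1 - 2 * occ k * (((z + k) * Complex.digamma (z + k + 1) -
    z * Complex.digamma (z + 1) - k * (1 - (Real.eulerMascheroniConstant : ℂ))) / (z + k)))

lemma ne_neg_natCast_of_re_pos {s : ℂ} (hs : 0 < s.re) (m : ℕ) : s ≠ -m := fun h =>
  add_natCast_ne_zero_of_re_pos hs m (by rw [h]; ring)

lemma digamma_add_natCast {s : ℂ} (hs : 0 < s.re) (k : ℕ) :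
    Complex.digamma (s + k) = Complex.digamma s + ∑ j ∈ Finset.range k, 1 / (s + j) := by
  induction k with
  | zero => simp
  | succ k ih =>
    have hre : 0 < (s + k).re := by
      have : (0 : ℝ) ≤ k := k.cast_nonneg
      simp; linarith
    rw [Nat.cast_succ, ← add_assoc, Complex.digamma_apply_add_one _ (ne_neg_natCast_of_re_pos hre),
      ih, Finset.sum_range_succ]
    ring

lemma digamma_two : Complex.digamma 2 = 1 - (Real.eulerMascheroniConstant : ℂ) := by
  rw [show (2 : ℂ) = 1 + 1 by norm_num,
    Complex.digamma_apply_add_one _ (ne_neg_natCast_of_re_pos (by simp)), Complex.digamma_one]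
  norm_num
  ring

/-- The sum of 1/(z + 1 + j) in `shiftedLogDeriv` is a difference of digamma values by the
functional equation; the factor (z + k)/k comes from the value of Λ at z + 1. -/
lemma covConst_eq (hk : 1 ≤ k) {z : ℂ} (h : (indicialPoly k).eval z = 0) (hz : 0 < z.re) :
    covConst k z = 2 * occ k * (-Complex.digamma (z + 1) - shiftedLogDeriv k z) -
      2 * occ k * (-Complex.digamma 2) + z / k + 1 := by
  have hk0 : (k : ℂ) ≠ 0 := by exact_mod_cast (by omega : k ≠ 0)
  have hf : ((k + 1).factorial : ℂ) ≠ 0 := by exact_mod_cast (k + 1).factorial_ne_zero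
  have h0 := ne_zero_of_zero hk h
  have hre : 0 < (z + 1).re := by simp; linarith
  have hzk := add_natCast_ne_zero_of_re_pos hz k
  have e : shiftedLogDeriv k z = (z + k) / k *
      (Complex.digamma (z + k + 1) - Complex.digamma (z + 1)) := by
    rw [shiftedLogDeriv, eval_derivative_indicialPoly
      fun j _ => add_natCast_ne_zero_of_re_pos hre j, eval_indicialPoly_add_one h h0,
      prod_range_add_one_add h0, eval_indicialPoly_eq_zero_iff.mp h, add_right_comm z,
      digamma_add_natCast hre]
    field_simp
    ring
  rw [covConst, e, digamma_two]
  field_simp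
  ring

lemma tendsto_log_div : Tendsto (fun n : ℕ => Complex.log n / n) atTop (𝓝 0) := by
  have h := (Real.isLittleO_log_id_atTop.tendsto_div_nhds_zero).comp
    (tendsto_natCast_atTop_atTop (R := ℝ))
  have h2 := (Complex.continuous_ofReal.tendsto _).comp h
  rw [Complex.ofReal_zero] at h2
  refine h2.congr fun n => ?_
  simp

lemma tendsto_add_div (z : ℂ) : Tendsto (fun n : ℕ => (z + n) / (n : ℂ)) atTop (𝓝 1) := by
  have h := (tendsto_natCast_div_add_atTop z).inv₀ one_ne_zero
  rw [inv_one] at h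
  refine h.congr fun n => ?_
  rw [inv_div, add_comm]

/-- Both harmonic-type sums are log n plus a convergent term. The n log n parts cancel, leaving a
multiple of (z - 1) log n that vanishes after division by n, and the unspecified c drops out as
well. -/
lemma tendsto_covMain_div (hk : 1 ≤ k) (c : ℂ) {z : ℂ} (h : (indicialPoly k).eval z = 0)
    (hz : 0 < z.re) : Tendsto (fun n : ℕ => covMain k c z n / (n : ℂ) ^ z) atTop
      (𝓝 (covConst k z / Complex.Gamma z)) := by
  have hre : 0 < (z + 1).re := by simp; linarith
  have t1 := tendsto_coeff_negPow_div hz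
  have t2 := ((((tendsto_sum_sub_log hre).sub_const (shiftedLogDeriv k z)).const_mul
    (2 * occ k)).add_const (c + z / k + 1))
  have t3 := ((tendsto_sum_sub_log (s := 2) (by norm_num)).const_mul (2 * occ k)).add_const c
  have t4 := (tendsto_log_div.const_mul (2 * occ k * (z - 1)))
  have t5 := t1.mul ((((tendsto_add_div z).mul t2).sub ((tendsto_add_div 1).mul t3)).add t4)
  have e : 1 / Complex.Gamma z * (1 * (2 * occ k * (-Complex.digamma (z + 1) -
      shiftedLogDeriv k z) + (c + z / k + 1)) - 1 * (2 * occ k * (-Complex.digamma 2) + c) +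
        2 * occ k * (z - 1) * 0) = covConst k z / Complex.Gamma z := by
    rw [covConst_eq hk h hz]; ring
  rw [e] at t5
  refine t5.congr' ?_
  filter_upwards [eventually_gt_atTop 0] with n hn
  have hn' : (n : ℂ) ≠ 0 := by exact_mod_cast hn.ne'
  have h2 : (n : ℂ) ^ (z - 1) ≠ 0 := by rw [Complex.cpow_ne_zero_iff]; exact Or.inl hn'
  have e2 : (n : ℂ) ^ z = (n : ℂ) ^ (z - 1) * n := by
    rw [Complex.cpow_sub _ _ hn', Complex.cpow_one, div_mul_cancel₀ _ hn']
  rw [covMain, e2]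
  field_simp
  ring

lemma covMain_sub_isLittleO (hk : 1 ≤ k) (c : ℂ) {z : ℂ} (h : (indicialPoly k).eval z = 0)
    (hz : 0 < z.re) :
    (fun n : ℕ => covMain k c z n - covConst k z / Complex.Gamma z * (n : ℂ) ^ z) =o[atTop]
      fun n : ℕ => (n : ℝ) ^ z.re := by
  have h1 := (tendsto_covMain_div hk c h hz).sub_const (covConst k z / Complex.Gamma z)
  rw [sub_self] at h1
  have h2 := ((isLittleO_one_iff ℂ).mpr h1).mul_isBigO
    (isBigO_refl (fun n : ℕ => (n : ℂ) ^ z) atTop)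
  refine (h2.congr' (f₂ := fun n : ℕ => covMain k c z n -
    covConst k z / Complex.Gamma z * (n : ℂ) ^ z) ?_ EventuallyEq.rfl).trans_isBigO
      (IsBigO.of_bound 1 ?_)
  · filter_upwards [eventually_gt_atTop 0] with n hn
    have hn' : (n : ℂ) ≠ 0 := by exact_mod_cast hn.ne'
    have : (n : ℂ) ^ z ≠ 0 := by rw [Complex.cpow_ne_zero_iff]; exact Or.inl hn'
    field_simp
  · filter_upwards [eventually_gt_atTop 0] with n hn
    rw [one_mul, Complex.norm_natCast_cpow_of_pos hn,
      Real.norm_of_nonneg (by positivity), one_mul]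

end MarySearch

/-! ### Conjugate zeros and the real periodic function -/

namespace MarySearch

open PowerSeries Topology ComplexConjugate

variable {k : ℕ}

lemma digamma_conj {s : ℂ} (hs : 0 < s.re) :
    Complex.digamma (conj s) = conj (Complex.digamma s) := by
  have h1 := tendsto_sum_sub_log (s := conj s) (by simpa using hs)
  have h2 := (Complex.continuous_conj.tendsto _).comp (tendsto_sum_sub_log hs)
  rw [map_neg] at h2
  refine neg_injective (tendsto_nhds_unique h1 (h2.congr fun n => ?_))
  have h3 : conj (Complex.log n) = Complex.log n := by
    rw [← Complex.natCast_log, Complex.conj_ofReal]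
  simp [h3]

lemma coeffA_conj (m : ℕ) (z : ℂ) : coeffA m (conj z) = conj (coeffA m z) := by
  simp [coeffA]

lemma covConst_conj {z : ℂ} (hz : 0 < z.re) : covConst k (conj z) = conj (covConst k z) := by
  have h1 : conj z + k + 1 = conj (z + k + 1) := by simp
  have h2 : conj z + 1 = conj (z + 1) := by simp
  have hk : (0 : ℝ) ≤ k := k.cast_nonneg
  rw [covConst, h1, h2, digamma_conj (by simp; linarith), digamma_conj (by simp; linarith)]
  have h3 : conj (2 : ℂ) = 2 := Complex.conj_ofNat 2
  simp [covConst, occ, h3]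

/-- The amplitude of the oscillations of the covariance. -/
noncomputable def amplitude (k : ℕ) (z : ℂ) : ℂ :=
  coeffA (k + 1) z * (covConst k z / Complex.Gamma z)

lemma amplitude_conj {z : ℂ} (hz : 0 < z.re) : amplitude k (conj z) = conj (amplitude k z) := by
  rw [amplitude, coeffA_conj, covConst_conj hz, Complex.Gamma_conj, amplitude]
  simp

lemma natCast_cpow_conj {n : ℕ} (z : ℂ) : (n : ℂ) ^ conj z = conj ((n : ℂ) ^ z) := by
  rw [Complex.cpow_conj _ _ (by rw [Complex.natCast_arg]; exact Real.pi_pos.ne),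
    Complex.conj_natCast]

/-- The factor 4φ (1/(2φ) - x) equals 2 (1 - 2φx), which is the normalization of `covConst`; the 2
comes from adding the contributions of two conjugate zeros. -/
lemma F₂_eq (hk : 1 ≤ k) (l : ℂ) (x : ℝ) :
    F₂ (k + 1) l x = 2 * (amplitude k l * Complex.exp (Complex.I * x)).re := by
  have ho := occ_ne_zero hk
  have hk0 : (k : ℂ) ≠ 0 := by exact_mod_cast (by omega : k ≠ 0)
  rw [F₂, ← Complex.re_ofReal_mul, ← Complex.re_ofReal_mul]
  congr 1
  rw [amplitude, covConst]
  push_cast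
  rw [show (occupancy (k + 1) : ℂ) = occ k from rfl]
  have e1 : l + ((k : ℂ) + 1) - 1 = l + k := by ring
  have e2 : l + ((k : ℂ) + 1) = l + k + 1 := by ring
  have e3 : (k : ℂ) + 1 - 1 = k := by ring
  rw [e1, e2, e3]
  set ψ := ((l + k) * Complex.digamma (l + k + 1) - l * Complex.digamma (l + 1) -
    k * (1 - (Real.eulerMascheroniConstant : ℂ))) / (l + k)
  field_simp
  ring

lemma periodic_F₂ (hk : 1 ≤ k) (l : ℂ) : Function.Periodic (F₂ (k + 1) l) (2 * Real.pi) := by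
  intro x
  rw [F₂_eq hk, F₂_eq hk]
  push_cast
  rw [mul_add, Complex.exp_add, show Complex.I * (2 * (Real.pi : ℂ)) = 2 * Real.pi * Complex.I by
    ring, Complex.exp_two_pi_mul_I, mul_one]

lemma natCast_cpow_eq {n : ℕ} (hn : 0 < n) (α β : ℝ) : (n : ℂ) ^ ((α : ℂ) + (β : ℂ) * Complex.I) =
    ((n : ℝ) ^ α : ℝ) * Complex.exp (Complex.I * (β * Real.log n : ℝ)) := by
  have hn' : (n : ℂ) ≠ 0 := by exact_mod_cast hn.ne'
  rw [Complex.cpow_add _ _ hn', Complex.ofReal_cpow n.cast_nonneg, Complex.ofReal_natCast]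
  congr 1
  rw [Complex.cpow_def_of_ne_zero hn', Complex.ofReal_mul, ← Complex.natCast_log]
  congr 1
  ring

lemma covSK_sub_F₂_isLittleO (hk : 13 ≤ k) {α β : ℝ}
    (h : IsSecondZero (k + 1) ((α : ℂ) + (β : ℂ) * Complex.I)) :
    (fun n : ℕ => covSK (k + 1) n - F₂ (k + 1) ((α : ℂ) + (β : ℂ) * Complex.I)
      (β * Real.log n) * (n : ℝ) ^ α) =o[atTop] fun n : ℕ => (n : ℝ) ^ α := by
  have hk1 : 1 ≤ k := by omega
  obtain ⟨h0, him, hre1, hre2, hmax⟩ := h.spec hk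
  set l : ℂ := (α : ℂ) + (β : ℂ) * Complex.I with hl
  have hα : l.re = α := by simp [hl]
  rw [hα] at hre1 hre2 hmax
  have hc0 := eval_conj h0
  have hcre : (conj l).re = α := by rw [Complex.conj_re, hα]
  have hne : l ≠ conj l := fun he => by
    have := congrArg Complex.im he
    rw [Complex.conj_im] at this
    linarith
  have h2 : l ≠ 2 := fun he => by rw [he] at hα; norm_num at hα; linarith
  have h2' : conj l ≠ 2 := fun he => by rw [he] at hcre; norm_num at hcre; linarith
  set P : Finset ℂ := {l, conj l} with hPdef
  have hP : P ⊆ others k := by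
    intro z hz
    rw [hPdef, Finset.mem_insert, Finset.mem_singleton] at hz
    rcases hz with rfl | rfl
    · exact (mem_others hk1).mpr ⟨h2, h0⟩
    · exact (mem_others hk1).mpr ⟨h2', hc0⟩
  have hP1 : ∀ z ∈ P, z.re = α := by
    intro z hz
    rw [hPdef, Finset.mem_insert, Finset.mem_singleton] at hz
    rcases hz with rfl | rfl
    · exact hα
    · exact hcre
  have hP2 : ∀ z ∈ others k \ P, z.re < α := by
    intro z hz
    rw [hPdef, Finset.mem_sdiff, Finset.mem_insert, Finset.mem_singleton, not_or] at hz
    have hz' := (mem_others hk1).mp hz.1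
    exact hmax z hz'.2 hz'.1 hz.2.1 hz.2.2
  obtain ⟨c, N, hN, hkey⟩ := exists_keyGf_eq hk1
  have t1 := covSK_sub_isLittleO hk1 hP hre1 hre2 hP1 hP2 hN hkey
  have t2 := covMain_sub_isLittleO hk1 c h0 (by rw [hα]; linarith)
  have t3 := covMain_sub_isLittleO hk1 c hc0 (by rw [hcre]; linarith)
  rw [hα] at t2
  rw [hcre] at t3
  have t4 := (t1.add (t2.const_mul_left (coeffA (k + 1) l))).add
    (t3.const_mul_left (coeffA (k + 1) (conj l)))
  refine IsBigO.trans_isLittleO (IsBigO.of_bound 1 ?_) t4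
  filter_upwards [eventually_gt_atTop 0] with n hn
  rw [one_mul, ← Complex.norm_real]
  refine le_of_eq (congrArg _ ?_)
  -- The terms of l and its conjugate are conjugate to each other, so their sum is twice a real
  -- part, as in `F₂_eq`.
  rw [hPdef, Finset.sum_pair hne]
  have e1 : amplitude k (conj l) * (n : ℂ) ^ conj l = conj (amplitude k l * (n : ℂ) ^ l) := by
    rw [amplitude_conj (by rw [hα]; linarith), natCast_cpow_conj, map_mul]
  have e2 : ((F₂ (k + 1) l (β * Real.log n) * (n : ℝ) ^ α : ℝ) : ℂ) =
      amplitude k l * (n : ℂ) ^ l + amplitude k (conj l) * (n : ℂ) ^ conj l := by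
    rw [e1, Complex.add_conj, F₂_eq hk1, hl, natCast_cpow_eq hn, mul_left_comm,
      Complex.re_ofReal_mul]
    congr 1
    ring
  rw [Complex.ofReal_sub, e2, amplitude, amplitude]
  ring

end MarySearch

theorem theorem2p1 (m : ℕ) :
    (3 ≤ m → m ≤ 13 →
      ∃ C_R : ℝ, C_R ≠ 0 ∧
        (fun n : ℕ => MarySearch.covSK m n) ~[atTop] (fun n : ℕ => C_R * (n : ℝ))) ∧
    (14 ≤ m →
      (∃ α β : ℝ, MarySearch.IsSecondZero m ((α : ℂ) + (β : ℂ) * Complex.I)) ∧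
      ∀ α β : ℝ, MarySearch.IsSecondZero m ((α : ℂ) + (β : ℂ) * Complex.I) →
        Function.Periodic (MarySearch.F₂ m ((α : ℂ) + (β : ℂ) * Complex.I)) (2 * Real.pi) ∧
        (fun n : ℕ => MarySearch.covSK m n -
            MarySearch.F₂ m ((α : ℂ) + (β : ℂ) * Complex.I) (β * Real.log n) * (n : ℝ) ^ α)
          =o[atTop] (fun n : ℕ => (n : ℝ) ^ α)) := by
  rcases m with _ | k
  · exact ⟨fun h => absurd h (by norm_num), fun h => absurd h (by norm_num)⟩
  · refine ⟨fun h1 h2 => MarySearch.isEquivalent_covSK (by omega) (by omega), fun h1 =>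
      ⟨MarySearch.exists_isSecondZero (by omega), fun α β h =>
        ⟨MarySearch.periodic_F₂ (by omega) _, MarySearch.covSK_sub_F₂_isLittleO (by omega) h⟩⟩⟩
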